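/- Let $(M,g)$ be an oriented smooth Riemannian $3$-manifold without boundary, with Riemannian volume form $\mu$. A smooth vector field $X$ on $M$ is called a rotational Beltrami field if it is divergence free, $d(\iota_X\mu)=0$, and satisfies $\operatorname{curl}X=fX$ for some nowhere vanishing function $f\in C^\infty(M)$; here $\operatorname{curl}X$ is the vector field determined by $\iota_{\operatorname{curl}X}\,\mu=d(\iota_Xg)$. A smooth vector field $Y$ on a surface $\Sigma$ is called Hamiltonian if there are a symplectic (area) form $\sigma$ on $\Sigma$ and a function $H\in C^\infty(\Sigma)$ with $\iota_Y\sigma=dH$. **Proposition.** Let $X$ be a rotational Beltrami field on $M$, and let $\Sigma\subset M$ be a closed (compact, without boundary) smoothly embedded surface that is invariant under $X$, i.e. every integral curve of $X$ that meets $\Sigma$ is contained in $\Sigma$. Assume that $X$ is not identically zero on at least one connected component of $M$ that meets $\Sigma$ (if $M$ is connected: $\Sigma\neq\emptyset$ and $X\not\equiv0$). Then the restriction $X|_\Sigma$, which is tangent to $\Sigma$, is not a Hamiltonian vector field on $\Sigma$, for any choice of area form $\sigma$ and function $H$. -/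

import Mathlib

open Manifold Bundle Set Filter Topology
open scoped ContDiff

noncomputable section

namespace BeltramiSurface

/-! ### Differential forms on boundaryless manifolds

A `k`-form on an `n`-manifold `M` is a function assigning to each `p : M` an alternating map
`TangentSpace (𝓡 n) p [⋀^Fin k]→L[ℝ] ℝ`. -/

section Forms

variable {n k : ℕ} {M : Type*} [TopologicalSpace M] [ChartedSpace (EuclideanSpace ℝ (Fin n)) M]

/-- A (not necessarily smooth) differential `k`-form on the `n`-manifold `M`. -/
abbrev Form (n k : ℕ) (M : Type*) [TopologicalSpace M]
    [ChartedSpace (EuclideanSpace ℝ (Fin n)) M] : Type _ :=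
  ∀ p : M, TangentSpace (𝓡 n) p [⋀^Fin k]→L[ℝ] ℝ

/-- The expression of a form in the preferred chart at `p₀`: its pullback under the inverse of the
chart. It is meaningful on the target of the chart, an open subset of `ℝⁿ`. -/
def chartForm (η : Form n k M) (p₀ : M) (x : EuclideanSpace ℝ (Fin n)) :
    EuclideanSpace ℝ (Fin n) [⋀^Fin k]→L[ℝ] ℝ :=
  (η ((extChartAt (𝓡 n) p₀).symm x)).compContinuousLinearMap
    (mfderiv 𝓘(ℝ, EuclideanSpace ℝ (Fin n)) (𝓡 n) (extChartAt (𝓡 n) p₀).symm x)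

/-- A form is smooth if its expression in each preferred chart is smooth. -/
def IsSmoothForm (η : Form n k M) : Prop :=
  ∀ p₀ : M, ContDiffOn ℝ ∞ (chartForm η p₀) (extChartAt (𝓡 n) p₀).target

/-- The exterior derivative of a form: at `p`, differentiate the expression of the form in the
chart at `p` and pull the result back to `M` by the chart. -/
def extDerivM (η : Form n k M) : Form n (k + 1) M := fun p =>
  (extDeriv (chartForm η p) (extChartAt (𝓡 n) p p)).compContinuousLinearMap
    (mfderiv (𝓡 n) 𝓘(ℝ, EuclideanSpace ℝ (Fin n)) (extChartAt (𝓡 n) p) p)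

/-- The contraction `ι_X η` of a form with a vector field. -/
def contract (X : ∀ p : M, TangentSpace (𝓡 n) p) (η : Form n (k + 1) M) : Form n k M :=
  fun p =>
    { (η p).toAlternatingMap.curryLeft (X p) with
      cont := (η p).cont.comp (continuous_const.matrixVecCons continuous_id) }

@[simp]
theorem contract_apply (X : ∀ p : M, TangentSpace (𝓡 n) p) (η : Form n (k + 1) M) (p : M)
    (v : Fin k → TangentSpace (𝓡 n) p) :
    contract X η p v = η p (Matrix.vecCons (X p) v) := rfl

/-- A vector field is smooth if it is a smooth section of the tangent bundle. -/
def IsSmoothField [IsManifold (𝓡 n) 1 M] (X : ∀ p : M, TangentSpace (𝓡 n) p) : Prop :=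
  ContMDiff (𝓡 n) (𝓡 n).tangent ∞ (fun p => (⟨p, X p⟩ : TangentBundle (𝓡 n) M))

/-- A symplectic form: a smooth closed nondegenerate `2`-form. -/
structure IsSymplecticForm (σ : Form n 2 M) : Prop where
  smooth : IsSmoothForm σ
  closed : ∀ p, extDerivM σ p = 0
  nondegenerate : ∀ (p : M) (v : TangentSpace (𝓡 n) p), (∀ w, σ p ![v, w] = 0) → v = 0

/-- A vector field `Y` is Hamiltonian if `ι_Y σ = dH` for some symplectic form `σ` and some
smooth function `H`. -/
def IsHamiltonianField (Y : ∀ p : M, TangentSpace (𝓡 n) p) : Prop :=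
  ∃ σ : Form n 2 M, IsSymplecticForm σ ∧
    ∃ H : M → ℝ, ContMDiff (𝓡 n) 𝓘(ℝ, ℝ) ∞ H ∧
      ∀ (p : M) (v : TangentSpace (𝓡 n) p), σ p ![Y p, v] = mfderiv (𝓡 n) 𝓘(ℝ, ℝ) H p v

/-- A subset is invariant under a vector field if every integral curve (on an open interval)
that meets the subset is contained in it. -/
def IsInvariantUnder (X : ∀ p : M, TangentSpace (𝓡 n) p) (A : Set M) : Prop :=
  ∀ (γ : ℝ → M) (a b : ℝ), IsMIntegralCurveOn (I := 𝓡 n) γ X (Ioo a b) →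
    (∃ t ∈ Ioo a b, γ t ∈ A) → ∀ t ∈ Ioo a b, γ t ∈ A

/-- A pointwise orientation of the tangent spaces of `M` is an orientation of `M` if in every
preferred trivialization of the tangent bundle it is locally constant. -/
def IsManifoldOrientation [IsManifold (𝓡 n) 1 M]
    (o : ∀ p : M, Orientation ℝ (TangentSpace (𝓡 n) p) (Fin n)) : Prop :=
  ∀ p₀ : M, ∃ o₀ : Orientation ℝ (EuclideanSpace ℝ (Fin n)) (Fin n),
    ∀ᶠ p in 𝓝 p₀,
      ∀ hp : p ∈ (trivializationAt (EuclideanSpace ℝ (Fin n)) (TangentSpace (𝓡 n)) p₀).baseSet,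
        Orientation.map (Fin n)
          ((trivializationAt (EuclideanSpace ℝ (Fin n)) (TangentSpace (𝓡 n)) p₀).linearEquivAt
            ℝ p hp) (o p) = o₀

end Forms

/-! ### Restriction of a vector field to an immersed submanifold -/

section Restriction

variable {m n : ℕ}
  {S : Type*} [TopologicalSpace S] [ChartedSpace (EuclideanSpace ℝ (Fin m)) S]
  {M : Type*} [TopologicalSpace M] [ChartedSpace (EuclideanSpace ℝ (Fin n)) M]

/-- The restriction of `X` along an immersion `j`: the vector field `Y` on `S` with
`dj (Y s) = X (j s)`. It is uniquely determined where `X` is tangent to the image of `j`. -/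
def restrictField (j : S → M) (X : ∀ p : M, TangentSpace (𝓡 n) p) :
    ∀ s : S, TangentSpace (𝓡 m) s :=
  fun s => Function.invFun (mfderiv (𝓡 m) (𝓡 n) j s) (X (j s))

end Restriction

/-! ### Vector calculus on oriented Riemannian manifolds -/

section Riemannian

variable {n : ℕ} {M : Type*} [TopologicalSpace M] [ChartedSpace (EuclideanSpace ℝ (Fin n)) M]
  [RiemannianBundle (fun p : M => TangentSpace (𝓡 n) p)]

instance finrankTangentSpace (p : M) : Fact (Module.finrank ℝ (TangentSpace (𝓡 n) p) = n) :=
  ⟨finrank_euclideanSpace_fin (𝕜 := ℝ) (n := n)⟩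

/-- The Riemannian volume form determined by the metric and an orientation. -/
def volForm (o : ∀ p : M, Orientation ℝ (TangentSpace (𝓡 n) p) (Fin n)) : Form n n M :=
  fun p => (o p).volumeForm.mkContinuous 1 (fun v => by
    simpa using (o p).abs_volumeForm_apply_le v)

/-- The `1`-form `ι_X g = g(X, ·)` dual to a vector field. -/
def flat (X : ∀ p : M, TangentSpace (𝓡 n) p) : Form n 1 M :=
  fun p => ContinuousAlternatingMap.ofSubsingleton ℝ (TangentSpace (𝓡 n) p) ℝ (0 : Fin 1)
    (innerSL ℝ (X p))

/-- `X` is divergence free: `d (ι_X μ) = 0`, with `μ` the Riemannian volume form. -/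
def IsDivergenceFree {n : ℕ} {M : Type*} [TopologicalSpace M]
    [ChartedSpace (EuclideanSpace ℝ (Fin (n + 1))) M]
    [RiemannianBundle (fun p : M => TangentSpace (𝓡 (n + 1)) p)]
    (o : ∀ p : M, Orientation ℝ (TangentSpace (𝓡 (n + 1)) p) (Fin (n + 1)))
    (X : ∀ p : M, TangentSpace (𝓡 (n + 1)) p) : Prop :=
  ∀ p, extDerivM (contract X (volForm o)) p = 0

variable {M : Type*} [TopologicalSpace M] [ChartedSpace (EuclideanSpace ℝ (Fin 3)) M]
  [RiemannianBundle (fun p : M => TangentSpace (𝓡 3) p)]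

/-- `W = curl X`: the vector field `W` is determined by `ι_W μ = d (ι_X g)`. -/
def IsCurl (o : ∀ p : M, Orientation ℝ (TangentSpace (𝓡 3) p) (Fin 3))
    (X W : ∀ p : M, TangentSpace (𝓡 3) p) : Prop :=
  ∀ p, contract W (volForm o) p = extDerivM (flat X) p

/-- `X` is a rotational Beltrami field: it is smooth, divergence free, and satisfies
`curl X = f X` for some nowhere vanishing smooth function `f`. -/
def IsRotationalBeltrami [IsManifold (𝓡 3) 1 M]
    (o : ∀ p : M, Orientation ℝ (TangentSpace (𝓡 3) p) (Fin 3))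
    (X : ∀ p : M, TangentSpace (𝓡 3) p) : Prop :=
  IsSmoothField X ∧ IsDivergenceFree o X ∧
    ∃ f : M → ℝ, ContMDiff (𝓡 3) 𝓘(ℝ, ℝ) ∞ f ∧ (∀ p, f p ≠ 0) ∧
      IsCurl o X (fun p => f p • X p)

end Riemannian

end BeltramiSurface

end

/-!
A Hamiltonian restriction would force `X` to vanish on the surface, and a Beltrami field that
vanishes on a surface vanishes identically near it, hence on a whole connected component.

**Vanishing on the surface.** A local defining function of the embedded surface `j : S → M` is
constant along the integral curves of `X` that start on it, so `X` is tangent to the surface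
(`mfderiv_restrictField`) and its restriction is a vector field `Y`. Let `β` be the pullback of the
one-form `α = g(X, ·)` to `S`. Then `dβ` is the pullback of `dα = f ι_X μ`, which is zero: on tangent
vectors of `S` it is `f μ` evaluated on three vectors of a plane (`extDerivM_pullbackForm_flat`).
If `ι_Y σ = dH`, then `d(Hβ) = dH ∧ β = -β(Y) σ = -|X|² σ` (`wedgeQuotient_of_hamiltonian`). By
Stokes' theorem the integral of `|X|²` against the area `|σ|` over the compact surface is zero
(`eq_zero_of_wedgeQuotient_eq_neg`), so `X = 0` on `S`
(`eq_zero_of_isHamiltonianField_restrictField`). Only this instance of Stokes' theorem is needed; it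
is proved with a partition of unity and integration by parts in charts. An area form exists, so the
charts can be oriented by the sign of its coefficient.

**Unique continuation.** In a chart the components of `α` solve a first order system: the curl of
`α` is a pointwise linear function of `α`, and `div (A α) = 0` for the positive definite matrix
`A = √(det g) g⁻¹` (`exists_isDivCurlSolution`). Differentiating the second equation and using the
first to interchange indices gives `|div (A ∇αᵢ)| ≤ C (|α| + |∇α|)`, a scalar elliptic inequality
with the same principal part for every component
(`IsDivCurlSolution.exists_differential_inequality`). Suppose `α = 0` on a regular hypersurface
`ρ = 0`. Then `∇αᵢ` is proportional to `∇ρ` there, and the two equations together with the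
positivity of `A` force `∇α = 0`; the same argument applied to `∇αᵢ` and the second order equation
forces the second derivatives to vanish. The extension of `α` by zero across the hypersurface is
therefore of class `C²`, satisfies the same inequality, and vanishes on an open set, so that weak
unique continuation applies to it
(`IsDivCurlSolution.eventually_eq_zero_of_eq_zero_on_hypersurface`). The same weak unique
continuation shows that the interior of the zero set of `X` is closed; being also open, it contains
the connected components that the surface meets
(`eq_zero_on_connectedComponent_of_eq_zero_on_surface`).

**Weak unique continuation.** The differential inequality is treated with the Carleman estimate
`∫ e^{2τφ} (τ³ w² + τ |∇w|²) ≤ C ∫ e^{2τφ} |div (a∇w)|²` for compactly supported `w`, large `τ` and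
a convexified weight `φ = e^{λψ}` (`exists_carleman_estimate`). Writing `v = e^{τφ} w`, the conjugated
operator is the sum of a symmetric and an antisymmetric part; their product is a divergence plus a
quadratic form in `(v, ∇v)` (`rellich_identity`), which is positive definite when `λ` is large
(`exists_weight_rellich_lower_bound`). With `ψ = -|x - q|²` and a radial cutoff, letting `τ → ∞`
propagates the zero set from a neighbourhood of the centre of a ball to the ball
(`eq_zero_on_ball_of_eq_zero_near_center`).
-/

namespace BeltramiSurface

open MeasureTheory

/-! ### Partial derivatives on Euclidean space -/

/-- The `k`-th partial derivative of a real function on `ℝⁿ`. -/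
noncomputable def pd {n : ℕ} (k : Fin n) (f : EuclideanSpace ℝ (Fin n) → ℝ)
    (x : EuclideanSpace ℝ (Fin n)) : ℝ :=
  fderiv ℝ f x (EuclideanSpace.single k 1)

section PartialDerivatives

variable {n : ℕ} {f g : EuclideanSpace ℝ (Fin n) → ℝ} {x : EuclideanSpace ℝ (Fin n)}

theorem pd_add (k : Fin n) (hf : DifferentiableAt ℝ f x) (hg : DifferentiableAt ℝ g x) :
    pd k (fun y => f y + g y) x = pd k f x + pd k g x := by
  simp [pd, fderiv_fun_add hf hg]

theorem pd_sub (k : Fin n) (hf : DifferentiableAt ℝ f x) (hg : DifferentiableAt ℝ g x) :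
    pd k (fun y => f y - g y) x = pd k f x - pd k g x := by
  simp [pd, fderiv_fun_sub hf hg]

theorem pd_mul (k : Fin n) (hf : DifferentiableAt ℝ f x) (hg : DifferentiableAt ℝ g x) :
    pd k (fun y => f y * g y) x = pd k f x * g x + f x * pd k g x := by
  simp [pd, fderiv_fun_mul hf hg]; ring

theorem pd_const_mul (k : Fin n) (c : ℝ) (hf : DifferentiableAt ℝ f x) :
    pd k (fun y => c * f y) x = c * pd k f x := by
  simp [pd, fderiv_const_mul hf]

theorem pd_neg (k : Fin n) : pd k (fun y => - f y) x = - pd k f x := by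
  simp [pd, fderiv_fun_neg]

theorem pd_sum {ι : Type*} (s : Finset ι) (k : Fin n) {F : ι → EuclideanSpace ℝ (Fin n) → ℝ}
    (hF : ∀ i ∈ s, DifferentiableAt ℝ (F i) x) :
    pd k (fun y => ∑ i ∈ s, F i y) x = ∑ i ∈ s, pd k (F i) x := by
  simp [pd, fderiv_fun_sum hF]

theorem pd_exp (k : Fin n) (hf : DifferentiableAt ℝ f x) :
    pd k (fun y => Real.exp (f y)) x = Real.exp (f x) * pd k f x := by
  simp [pd, fderiv_exp hf]

theorem pd_eq_of_eventuallyEq (k : Fin n) (h : f =ᶠ[𝓝 x] g) : pd k f x = pd k g x := by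
  simp [pd, h.fderiv_eq]

theorem pd_congr_nhds (k : Fin n) (h : f =ᶠ[𝓝 x] g) : pd k f =ᶠ[𝓝 x] pd k g := by
  filter_upwards [h.fderiv (𝕜 := ℝ)] with y hy
  simp [pd, hy]

theorem contDiff_pd {m m' : ℕ∞ω} (k : Fin n) (hf : ContDiff ℝ m f) (hm : m' + 1 ≤ m) :
    ContDiff ℝ m' (pd k f) :=
  (hf.fderiv_right hm).clm_apply contDiff_const

theorem contDiffOn_pd {m m' : ℕ∞ω} {U : Set (EuclideanSpace ℝ (Fin n))} (hU : IsOpen U)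
    (k : Fin n) (hf : ContDiffOn ℝ m f U) (hm : m' + 1 ≤ m) :
    ContDiffOn ℝ m' (pd k f) U :=
  (hf.fderiv_of_isOpen hU hm).clm_apply contDiffOn_const

/-- Symmetry of second derivatives. -/
theorem pd_pd_comm (k l : Fin n) (hf : ContDiffAt ℝ 2 f x) : pd k (pd l f) x = pd l (pd k f) x := by
  have hd : DifferentiableAt ℝ (fderiv ℝ f) x :=
    (hf.fderiv_right (m := 1) (by norm_num)).differentiableAt (by norm_num)
  have key : ∀ a b : Fin n, pd a (pd b f) x
      = fderiv ℝ (fderiv ℝ f) x (EuclideanSpace.single a 1) (EuclideanSpace.single b 1) := by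
    intro a b
    have : HasFDerivAt (pd b f) ((fderiv ℝ (fderiv ℝ f) x).flip (EuclideanSpace.single b 1)) x :=
      (ContinuousLinearMap.apply ℝ ℝ (EuclideanSpace.single b (1 : ℝ))).hasFDerivAt.comp x
        hd.hasFDerivAt
    simp [pd, this.fderiv]
  rw [key, key]
  exact (hf.isSymmSndFDerivAt (by simp)) _ _

theorem fderiv_apply_eq_sum_pd (v : EuclideanSpace ℝ (Fin n)) :
    fderiv ℝ f x v = ∑ k, v k * pd k f x := by
  conv_lhs => rw [← (EuclideanSpace.basisFun (Fin n) ℝ).sum_repr v]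
  simp [pd]

/-- The integral of a derivative of a compactly supported `C¹` function vanishes. -/
theorem integral_pd_eq_zero (k : Fin n) (hf : ContDiff ℝ 1 f) (hc : HasCompactSupport f) :
    ∫ y, pd k f y = 0 := by
  have hfd : Continuous (pd k f) := (contDiff_pd (m' := 0) k hf (by norm_num)).continuous
  have hfc : HasCompactSupport (pd k f) :=
    (hc.fderiv (𝕜 := ℝ)).comp_left (g := fun A : EuclideanSpace ℝ (Fin n) →L[ℝ] ℝ =>
      A (EuclideanSpace.single k 1)) rfl
  have := integral_mul_fderiv_eq_neg_fderiv_mul_of_integrable (μ := volume) (𝕜 := ℝ)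
    (f := fun _ : EuclideanSpace ℝ (Fin n) => (1 : ℝ)) (g := f)
    (v := EuclideanSpace.single k (1 : ℝ)) (by simp)
    (by simpa only [one_mul] using! hfd.integrable_of_hasCompactSupport hfc)
    (by simpa using! hf.continuous.integrable_of_hasCompactSupport hc)
    (by fun_prop) (fun y _ => hf.differentiable (by norm_num) y)
  simpa [pd] using this

end PartialDerivatives

/-! ### Second order operators in divergence form -/

/-- The flux `∑ₗ aₖₗ ∂ₗv` of `v` for the coefficient matrix `a`. -/
noncomputable def flux {n : ℕ} (a : Fin n → Fin n → EuclideanSpace ℝ (Fin n) → ℝ)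
    (v : EuclideanSpace ℝ (Fin n) → ℝ) (k : Fin n) (x : EuclideanSpace ℝ (Fin n)) : ℝ :=
  ∑ l, a k l x * pd l v x

/-- The operator `v ↦ ∑ₖₗ ∂ₖ(aₖₗ ∂ₗv)`. -/
noncomputable def divOp {n : ℕ} (a : Fin n → Fin n → EuclideanSpace ℝ (Fin n) → ℝ)
    (v : EuclideanSpace ℝ (Fin n) → ℝ) (x : EuclideanSpace ℝ (Fin n)) : ℝ :=
  ∑ k, pd k (flux a v k) x

section Rellich

variable {n : ℕ} {a : Fin n → Fin n → EuclideanSpace ℝ (Fin n) → ℝ}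

theorem contDiff_flux {m m' : ℕ∞ω} {v : EuclideanSpace ℝ (Fin n) → ℝ}
    (ha : ∀ k l, ContDiff ℝ m' (a k l)) (hv : ContDiff ℝ m v) (hm : m' + 1 ≤ m) (k : Fin n) :
    ContDiff ℝ m' (flux a v k) :=
  ContDiff.sum fun l _ => (ha k l).mul (contDiff_pd l hv hm)

theorem divOp_congr_nhds {v w : EuclideanSpace ℝ (Fin n) → ℝ} {x : EuclideanSpace ℝ (Fin n)}
    (h : v =ᶠ[𝓝 x] w) : divOp a v x = divOp a w x := by
  refine Finset.sum_congr rfl fun k _ => pd_eq_of_eventuallyEq k ?_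
  have : ∀ l, pd l v =ᶠ[𝓝 x] pd l w := fun l => pd_congr_nhds l h
  filter_upwards [eventually_all.2 this] with y hy
  simp [flux, hy]

/-- The vector field whose divergence appears when the conjugated operator is multiplied by a
first order operator `b · ∇ + s`. -/
noncomputable def rellichField (a : Fin n → Fin n → EuclideanSpace ℝ (Fin n) → ℝ)
    (b : Fin n → EuclideanSpace ℝ (Fin n) → ℝ) (s Q : EuclideanSpace ℝ (Fin n) → ℝ) (τ : ℝ)
    (v : EuclideanSpace ℝ (Fin n) → ℝ) (k : Fin n) (x : EuclideanSpace ℝ (Fin n)) : ℝ :=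
  -(flux a v k x * ∑ m, b m x * pd m v x) + (1 / 2) * (b k x * ∑ l, pd l v x * flux a v l x)
    - (s x * v x) * flux a v k x - (τ ^ 2 / 2) * ((Q x * b k x) * (v x * v x))

theorem contDiff_rellichField {b : Fin n → EuclideanSpace ℝ (Fin n) → ℝ}
    {s Q v : EuclideanSpace ℝ (Fin n) → ℝ} (τ : ℝ)
    (ha : ∀ k l, ContDiff ℝ 1 (a k l)) (hb : ∀ k, ContDiff ℝ 1 (b k)) (hs : ContDiff ℝ 1 s)
    (hQ : ContDiff ℝ 1 Q) (hv : ContDiff ℝ 2 v) (k : Fin n) :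
    ContDiff ℝ 1 (rellichField a b s Q τ v k) := by
  have h1 : ∀ k, ContDiff ℝ 1 (pd k v) := fun k => contDiff_pd k hv (by norm_num)
  have h2 : ∀ k, ContDiff ℝ 1 (flux a v k) := fun k => contDiff_flux ha hv (by norm_num) k
  have h3 : ContDiff ℝ 1 v := hv.of_le (by norm_num)
  unfold rellichField
  fun_prop

/-- The Rellich–Pohozaev identity: the product of the symmetric part `div (a∇v) + τ²Qv` and the
antisymmetric part `b · ∇v + sv` of a conjugated operator is, up to a divergence, a quadratic form
in `(v, ∇v)`. -/
theorem rellich_identity {b : Fin n → EuclideanSpace ℝ (Fin n) → ℝ}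
    {s Q v : EuclideanSpace ℝ (Fin n) → ℝ} (τ : ℝ)
    (ha : ∀ k l, ContDiff ℝ 1 (a k l)) (hsymm : ∀ k l x, a k l x = a l k x)
    (hb : ∀ k, ContDiff ℝ 1 (b k)) (hs : ContDiff ℝ 1 s)
    (hQ : ContDiff ℝ 1 Q) (hv : ContDiff ℝ 2 v) (x : EuclideanSpace ℝ (Fin n)) :
    -(divOp a v x + τ ^ 2 * (Q x * v x)) * ((∑ m, b m x * pd m v x) + s x * v x) =
      (∑ k, pd k (rellichField a b s Q τ v k) x)
      + ((∑ k, flux a v k x * ∑ m, pd k (b m) x * pd m v x)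
        - (1 / 2) * (∑ m, b m x * ∑ k, ∑ l, pd m (a k l) x * (pd k v x * pd l v x))
        + (s x - (1 / 2) * ∑ k, pd k (b k) x) * ∑ k, pd k v x * flux a v k x)
      + v x * (∑ k, pd k s x * flux a v k x)
      + τ ^ 2 * ((1 / 2) * (∑ k, pd k (fun y => Q y * b k y) x) - s x * Q x) * (v x) ^ 2 := by
  have h1 : ∀ k, ContDiff ℝ 1 (pd k v) := fun k => contDiff_pd k hv (by norm_num)
  have h2 : ∀ k, ContDiff ℝ 1 (flux a v k) := fun k => contDiff_flux ha hv (by norm_num) k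
  have h3 : ContDiff ℝ 1 v := hv.of_le (by norm_num)
  have d1 : ∀ k, DifferentiableAt ℝ (pd k v) x := fun k => (h1 k).differentiable (by norm_num) x
  have d2 : ∀ k, DifferentiableAt ℝ (flux a v k) x :=
    fun k => (h2 k).differentiable (by norm_num) x
  have d3 : DifferentiableAt ℝ v x := h3.differentiable (by norm_num) x
  have da : ∀ k l, DifferentiableAt ℝ (a k l) x :=
    fun k l => (ha k l).differentiable (by norm_num) x
  have db : ∀ k, DifferentiableAt ℝ (b k) x := fun k => (hb k).differentiable (by norm_num) x
  have ds : DifferentiableAt ℝ s x := hs.differentiable (by norm_num) x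
  have dQ : DifferentiableAt ℝ Q x := hQ.differentiable (by norm_num) x
  -- the two occurrences of second derivatives of `v` cancel by symmetry
  have e1 : ∑ k, flux a v k x * pd k (fun y => ∑ m, b m y * pd m v y) x
      = (∑ k, flux a v k x * ∑ m, pd k (b m) x * pd m v x)
        + ∑ k, ∑ m, flux a v k x * (b m x * pd m (pd k v) x) := by
    rw [← Finset.sum_add_distrib]
    refine Finset.sum_congr rfl fun k _ => ?_
    rw [pd_sum _ _ (fun m _ => (db m).fun_mul (d1 m)), ← Finset.mul_sum, ← mul_add,
      ← Finset.sum_add_distrib]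
    congr 1
    refine Finset.sum_congr rfl fun m _ => ?_
    rw [pd_mul k (db m) (d1 m), pd_pd_comm m k hv.contDiffAt]
  have e2 : ∑ m, b m x * pd m (fun y => ∑ l, pd l v y * flux a v l y) x
      = (∑ m, b m x * ∑ k, ∑ l, pd m (a k l) x * (pd k v x * pd l v x))
        + 2 * ∑ k, ∑ m, flux a v k x * (b m x * pd m (pd k v) x) := by
    have hG : ∀ m, pd m (fun y => ∑ l, pd l v y * flux a v l y) x
        = (∑ k, ∑ l, pd m (a k l) x * (pd k v x * pd l v x))
          + 2 * ∑ k, flux a v k x * pd m (pd k v) x := by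
      intro m
      rw [pd_sum _ _ (fun l _ => (d1 l).fun_mul (d2 l))]
      have hk : ∀ k, pd m (fun y => pd k v y * flux a v k y) x
          = flux a v k x * pd m (pd k v) x
            + ((∑ l, pd m (a k l) x * (pd k v x * pd l v x))
              + ∑ l, a k l x * pd k v x * pd m (pd l v) x) := by
        intro k
        rw [pd_mul m (d1 k) (d2 k)]
        have : pd m (flux a v k) x
            = ∑ l, (pd m (a k l) x * pd l v x + a k l x * pd m (pd l v) x) := by
          unfold flux
          rw [pd_sum _ _ (fun l _ => (da k l).fun_mul (d1 l))]
          exact Finset.sum_congr rfl fun l _ => pd_mul m (da k l) (d1 l)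
        rw [this, mul_comm, ← Finset.sum_add_distrib, Finset.mul_sum]
        congr 1
        refine Finset.sum_congr rfl fun l _ => ?_
        ring
      simp only [hk, Finset.sum_add_distrib]
      have hsw : ∑ k, ∑ l, a k l x * pd k v x * pd m (pd l v) x
          = ∑ k, flux a v k x * pd m (pd k v) x := by
        rw [Finset.sum_comm]
        refine Finset.sum_congr rfl fun l _ => ?_
        rw [flux, Finset.sum_mul]
        refine Finset.sum_congr rfl fun k _ => ?_
        rw [hsymm k l]
      rw [hsw]; ring
    simp only [hG, mul_add, Finset.sum_add_distrib]
    congr 1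
    rw [Finset.sum_comm, Finset.mul_sum]
    refine Finset.sum_congr rfl fun m _ => ?_
    rw [Finset.mul_sum, Finset.mul_sum, Finset.mul_sum]
    refine Finset.sum_congr rfl fun k _ => ?_
    ring
  have dB : DifferentiableAt ℝ (fun y => ∑ m, b m y * pd m v y) x := by fun_prop
  have dG : DifferentiableAt ℝ (fun y => ∑ l, pd l v y * flux a v l y) x := by fun_prop
  have hF : ∀ k, pd k (rellichField a b s Q τ v k) x =
      -(pd k (flux a v k) x * (∑ m, b m x * pd m v x)
          + flux a v k x * pd k (fun y => ∑ m, b m y * pd m v y) x)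
        + (1 / 2) * (pd k (b k) x * (∑ l, pd l v x * flux a v l x)
          + b k x * pd k (fun y => ∑ l, pd l v y * flux a v l y) x)
        - ((pd k s x * v x + s x * pd k v x) * flux a v k x
          + s x * v x * pd k (flux a v k) x)
        - (τ ^ 2 / 2) * (pd k (fun y => Q y * b k y) x * (v x * v x)
          + Q x * b k x * (pd k v x * v x + v x * pd k v x)) := by
    intro k
    have dbk := db k
    have d2k := d2 k
    unfold rellichField
    rw [pd_sub k (by fun_prop) (by fun_prop), pd_sub k (by fun_prop) (by fun_prop),
      pd_add k (by fun_prop) (by fun_prop), pd_neg, pd_mul k d2k dB,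
      pd_const_mul k _ (by fun_prop), pd_mul k dbk dG, pd_mul k (by fun_prop) d2k,
      pd_mul k ds d3, pd_const_mul k _ (by fun_prop),
      pd_mul k (f := fun y => Q y * b k y) (by fun_prop) (by fun_prop), pd_mul k d3 d3]
  have hsum : ∑ k, pd k (rellichField a b s Q τ v k) x =
      -(divOp a v x * ∑ m, b m x * pd m v x)
      - (∑ k, flux a v k x * pd k (fun y => ∑ m, b m y * pd m v y) x)
      + (1 / 2) * ((∑ k, pd k (b k) x) * ∑ l, pd l v x * flux a v l x)
      + (1 / 2) * (∑ k, b k x * pd k (fun y => ∑ l, pd l v y * flux a v l y) x)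
      - v x * (∑ k, pd k s x * flux a v k x) - s x * (∑ k, pd k v x * flux a v k x)
      - s x * v x * divOp a v x
      - (τ ^ 2 / 2) * ((∑ k, pd k (fun y => Q y * b k y) x) * (v x) ^ 2)
      - τ ^ 2 * (Q x * v x * ∑ k, b k x * pd k v x) := by
    simp only [hF, divOp]
    generalize hB : (∑ m, b m x * pd m v x) = B
    generalize hG : (∑ l, pd l v x * flux a v l x) = G
    rw [show s x * G = s x * ∑ l, pd l v x * flux a v l x by rw [hG],
      show Q x * v x * B = Q x * v x * ∑ m, b m x * pd m v x by rw [hB]]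
    simp only [Finset.mul_sum, Finset.sum_mul, ← Finset.sum_neg_distrib, ← Finset.sum_add_distrib,
      ← Finset.sum_sub_distrib]
    refine Finset.sum_congr rfl fun k _ => ?_
    ring
  rw [hsum, e1, e2]
  ring

end Rellich

/-! ### The Carleman estimate -/

section Carleman

variable {n : ℕ} {a : Fin n → Fin n → EuclideanSpace ℝ (Fin n) → ℝ}

theorem exists_quadratic_bound {r : Fin n → Fin n → EuclideanSpace ℝ (Fin n) → ℝ}
    (hr : ∀ k l, Continuous (r k l)) {K : Set (EuclideanSpace ℝ (Fin n))} (hK : IsCompact K) :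
    ∃ C, 0 ≤ C ∧ ∀ x ∈ K, ∀ ξ : Fin n → ℝ,
      |∑ k, ∑ l, r k l x * (ξ k * ξ l)| ≤ C * ∑ k, ξ k ^ 2 := by
  have h : ∀ k l, ∃ B, ∀ x ∈ K, ‖r k l x‖ ≤ B :=
    fun k l => hK.exists_bound_of_continuousOn (hr k l).continuousOn
  choose B hB using h
  refine ⟨∑ k, ∑ l, |B k l|, by positivity, fun x hx ξ => ?_⟩
  rw [Finset.sum_mul]
  refine (Finset.abs_sum_le_sum_abs _ _).trans (Finset.sum_le_sum fun k _ => ?_)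
  rw [Finset.sum_mul]
  refine (Finset.abs_sum_le_sum_abs _ _).trans (Finset.sum_le_sum fun l _ => ?_)
  rw [abs_mul]
  have h1 : |r k l x| ≤ |B k l| := (hB k l x hx).trans (le_abs_self _)
  have hk : ξ k ^ 2 ≤ ∑ j, ξ j ^ 2 :=
    Finset.single_le_sum (f := fun j => ξ j ^ 2) (fun j _ => sq_nonneg _) (Finset.mem_univ k)
  have hl : ξ l ^ 2 ≤ ∑ j, ξ j ^ 2 :=
    Finset.single_le_sum (f := fun j => ξ j ^ 2) (fun j _ => sq_nonneg _) (Finset.mem_univ l)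
  have h2 : |ξ k * ξ l| ≤ ∑ j, ξ j ^ 2 := by
    rw [abs_le]; constructor <;> nlinarith [sq_nonneg (ξ k + ξ l), sq_nonneg (ξ k - ξ l)]
  gcongr

theorem exists_ellipticity_constant {r : Fin n → Fin n → EuclideanSpace ℝ (Fin n) → ℝ}
    (hr : ∀ k l, Continuous (r k l)) {K : Set (EuclideanSpace ℝ (Fin n))} (hK : IsCompact K)
    (hpos : ∀ x ∈ K, ∀ ξ : Fin n → ℝ, ξ ≠ 0 → 0 < ∑ k, ∑ l, r k l x * (ξ k * ξ l)) :
    ∃ c, 0 < c ∧ ∀ x ∈ K, ∀ ξ : Fin n → ℝ,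
      c * ∑ k, ξ k ^ 2 ≤ ∑ k, ∑ l, r k l x * (ξ k * ξ l) := by
  set T : Set (EuclideanSpace ℝ (Fin n) × EuclideanSpace ℝ (Fin n)) :=
    K ×ˢ Metric.sphere 0 1 with hT
  have hTc : IsCompact T := hK.prod (isCompact_sphere 0 1)
  set g : EuclideanSpace ℝ (Fin n) × EuclideanSpace ℝ (Fin n) → ℝ :=
    fun p => ∑ k, ∑ l, r k l p.1 * (p.2 k * p.2 l) with hg
  have hgc : Continuous g := by fun_prop
  obtain ⟨c, hc, hcg⟩ : ∃ c, 0 < c ∧ ∀ p ∈ T, c ≤ g p := by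
    rcases T.eq_empty_or_nonempty with he | hne
    · exact ⟨1, one_pos, by simp [he]⟩
    · obtain ⟨p, hp, hmin⟩ := hTc.exists_isMinOn hne hgc.continuousOn
      refine ⟨g p, hpos p.1 hp.1 _ ?_, fun y hy => hmin hy⟩
      intro h0
      have h1 : ‖p.2‖ = 1 := by simpa using hp.2
      have : p.2 = 0 := by ext i; exact congrFun h0 i
      simp [this] at h1
  refine ⟨c, hc, fun x hx ξ => ?_⟩
  set v : EuclideanSpace ℝ (Fin n) := WithLp.toLp 2 ξ with hv
  have hn : ‖v‖ ^ 2 = ∑ k, ξ k ^ 2 := by simp [EuclideanSpace.norm_sq_eq, hv]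
  rcases eq_or_ne v 0 with h0 | h0
  · have : ∀ k, ξ k = 0 := fun k => by
      have := congrArg (fun w : EuclideanSpace ℝ (Fin n) => w k) h0
      simpa [hv] using this
    simp [this]
  · have hvn : 0 < ‖v‖ := norm_pos_iff.2 h0
    have := hcg (x, ‖v‖⁻¹ • v) ⟨hx, by simp [norm_smul, hvn.ne']⟩
    have e : g (x, ‖v‖⁻¹ • v) = (‖v‖ ^ 2)⁻¹ * ∑ k, ∑ l, r k l x * (ξ k * ξ l) := by
      simp only [hg, hv, Finset.mul_sum]
      refine Finset.sum_congr rfl fun k _ => Finset.sum_congr rfl fun l _ => ?_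
      simp
      ring
    rw [e, inv_mul_eq_div, le_div_iff₀ (by positivity), hn] at this
    exact this

/-- The conjugate `e^{τφ} ∘ div (a∇·) ∘ e^{-τφ}` of a second order operator. -/
theorem divOp_conjugate (ha : ∀ k l, ContDiff ℝ 1 (a k l)) (hsymm : ∀ k l x, a k l x = a l k x)
    {φ w : EuclideanSpace ℝ (Fin n) → ℝ} (hφ : ContDiff ℝ 2 φ) (hw : ContDiff ℝ 2 w) (τ : ℝ)
    (x : EuclideanSpace ℝ (Fin n)) :
    Real.exp (τ * φ x) * divOp a w x =
      divOp a (fun y => Real.exp (τ * φ y) * w y) x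
      - 2 * τ * (∑ k, flux a φ k x * pd k (fun y => Real.exp (τ * φ y) * w y) x)
      - τ * divOp a φ x * (Real.exp (τ * φ x) * w x)
      + τ ^ 2 * (∑ k, pd k φ x * flux a φ k x) * (Real.exp (τ * φ x) * w x) := by
  have hφ1 : Differentiable ℝ φ := hφ.differentiable (by norm_num)
  have hw1 : Differentiable ℝ w := hw.differentiable (by norm_num)
  have hv : ∀ k y, pd k (fun y => Real.exp (τ * φ y) * w y) y
      = Real.exp (τ * φ y) * (pd k w y + τ * (w y * pd k φ y)) := by
    intro k y
    rw [pd_mul k (by fun_prop) (hw1 y), pd_exp k (by fun_prop), pd_const_mul k _ (hφ1 y)]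
    ring
  have hfl : ∀ k, flux a (fun y => Real.exp (τ * φ y) * w y) k
      = fun y => Real.exp (τ * φ y) * (flux a w k y + τ * (w y * flux a φ k y)) := by
    intro k
    ext y
    simp only [flux, hv, Finset.mul_sum, ← Finset.sum_add_distrib]
    refine Finset.sum_congr rfl fun l _ => ?_
    ring
  have dw : ∀ k, DifferentiableAt ℝ (flux a w k) x := fun k =>
    (contDiff_flux (m' := 1) ha hw (by norm_num) k).differentiable (by norm_num) x
  have dφ : ∀ k, DifferentiableAt ℝ (flux a φ k) x := fun k =>
    (contDiff_flux (m' := 1) ha hφ (by norm_num) k).differentiable (by norm_num) x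
  have hd : ∀ k, pd k (flux a (fun y => Real.exp (τ * φ y) * w y) k) x
      = Real.exp (τ * φ x) * (τ * pd k φ x * (flux a w k x + τ * (w x * flux a φ k x))
        + (pd k (flux a w k) x + τ * (pd k w x * flux a φ k x + w x * pd k (flux a φ k) x))) := by
    intro k
    have dwk := dw k
    have dφk := dφ k
    rw [hfl k, pd_mul k (by fun_prop) (by fun_prop), pd_exp k (by fun_prop),
      pd_const_mul k _ (hφ1 x), pd_add k dwk (by fun_prop), pd_const_mul k _ (by fun_prop),
      pd_mul k (hw1 x) dφk]
    ring
  have hsw : ∑ k, pd k φ x * flux a w k x = ∑ k, pd k w x * flux a φ k x := by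
    simp only [flux, Finset.mul_sum]
    rw [Finset.sum_comm]
    refine Finset.sum_congr rfl fun k _ => Finset.sum_congr rfl fun l _ => ?_
    rw [hsymm k l]; ring
  have e1 : divOp a (fun y => Real.exp (τ * φ y) * w y) x
      = Real.exp (τ * φ x) * (τ * (∑ k, pd k φ x * flux a w k x)
        + τ ^ 2 * w x * (∑ k, pd k φ x * flux a φ k x) + divOp a w x
        + τ * (∑ k, pd k w x * flux a φ k x) + τ * w x * divOp a φ x) := by
    simp only [divOp, hd, Finset.mul_sum, ← Finset.sum_add_distrib]
    refine Finset.sum_congr rfl fun k _ => ?_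
    ring
  have e2 : ∑ k, flux a φ k x * pd k (fun y => Real.exp (τ * φ y) * w y) x
      = Real.exp (τ * φ x) * ((∑ k, pd k w x * flux a φ k x)
        + τ * w x * (∑ k, pd k φ x * flux a φ k x)) := by
    simp only [hv, Finset.mul_sum, ← Finset.sum_add_distrib]
    refine Finset.sum_congr rfl fun k _ => ?_
    ring
  rw [e1, e2, hsw]
  ring

/-- The convexified weight `exp (lam * ψ)`. -/
noncomputable def weight (lam : ℝ) (ψ : EuclideanSpace ℝ (Fin n) → ℝ)
    (x : EuclideanSpace ℝ (Fin n)) : ℝ :=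
  Real.exp (lam * ψ x)

theorem pd_weight (lam : ℝ) {ψ : EuclideanSpace ℝ (Fin n) → ℝ} (hψ : Differentiable ℝ ψ)
    (k : Fin n) (x : EuclideanSpace ℝ (Fin n)) :
    pd k (weight lam ψ) x = lam * weight lam ψ x * pd k ψ x := by
  unfold weight
  rw [pd_exp k (by fun_prop), pd_const_mul k _ (hψ x)]; ring

theorem flux_weight (lam : ℝ) {ψ : EuclideanSpace ℝ (Fin n) → ℝ} (hψ : Differentiable ℝ ψ)
    (k : Fin n) (x : EuclideanSpace ℝ (Fin n)) :
    flux a (weight lam ψ) k x = lam * weight lam ψ x * flux a ψ k x := by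
  simp only [flux, pd_weight lam hψ, Finset.mul_sum]
  exact Finset.sum_congr rfl fun l _ => by ring

/-- Pseudoconvexity of the convexified weight: for `lam` large, the quadratic form in the
Rellich–Pohozaev identity for `b = 2 a∇φ`, `φ = exp (lam ψ)`, is positive definite. The multiplier
`s` exceeds `div b / 2` by the term `lam² φ ⟨a∇ψ, ∇ψ⟩`, half of which is paid for by the
coefficient of `v²`. -/
theorem exists_weight_rellich_lower_bound
    (ha : ∀ k l, ContDiff ℝ ∞ (a k l)) (hsymm : ∀ k l x, a k l x = a l k x)
    {ψ : EuclideanSpace ℝ (Fin n) → ℝ} (hψ : ContDiff ℝ ∞ ψ)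
    {K : Set (EuclideanSpace ℝ (Fin n))} (hK : IsCompact K)
    (hpos : ∀ x ∈ K, ∀ ξ : Fin n → ℝ, ξ ≠ 0 → 0 < ∑ k, ∑ l, a k l x * (ξ k * ξ l))
    (hgrad : ∀ x ∈ K, ∃ k, pd k ψ x ≠ 0) :
    ∃ lam > 0, ∃ c > 0, ∃ (b : Fin n → EuclideanSpace ℝ (Fin n) → ℝ)
      (s Q : EuclideanSpace ℝ (Fin n) → ℝ),
      (∀ k, ContDiff ℝ ∞ (b k)) ∧ ContDiff ℝ ∞ s ∧ ContDiff ℝ ∞ Q ∧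
      (∀ k x, b k x = 2 * flux a (weight lam ψ) k x) ∧
      (∀ x, Q x = ∑ k, pd k (weight lam ψ) x * flux a (weight lam ψ) k x) ∧
      ∀ x ∈ K, ∀ (τ : ℝ) (v : EuclideanSpace ℝ (Fin n) → ℝ), ContDiff ℝ 2 v →
        (∑ k, pd k (rellichField a b s Q τ v k) x) + c * (∑ k, pd k v x ^ 2)
          + v x * (∑ k, pd k s x * flux a v k x) + τ ^ 2 * c * v x ^ 2 ≤
        -(divOp a v x + τ ^ 2 * (Q x * v x)) * ((∑ m, b m x * pd m v x) + s x * v x) := by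
  have hψd : Differentiable ℝ ψ := hψ.differentiable (by simp)
  have hβ : ∀ k, ContDiff ℝ ∞ (flux a ψ k) := contDiff_flux ha hψ (by simp)
  have hψk : ∀ k, ContDiff ℝ ∞ (pd k ψ) := fun k => contDiff_pd k hψ (by simp)
  set q : EuclideanSpace ℝ (Fin n) → ℝ := fun x => ∑ k, pd k ψ x * flux a ψ k x with hq
  have hqs : ContDiff ℝ ∞ q := by fun_prop
  have hqpos : ∀ x ∈ K, 0 < q x := by
    intro x hx
    have := hpos x hx (fun k => pd k ψ x) (by
      obtain ⟨k, hk⟩ := hgrad x hx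
      exact fun h => hk (congrFun h k))
    convert this using 1
    simp only [hq, flux, Finset.mul_sum]
    exact Finset.sum_congr rfl fun k _ => Finset.sum_congr rfl fun l _ => by ring
  obtain ⟨q₀, hq₀, hqK⟩ : ∃ q₀ > 0, ∀ x ∈ K, q₀ ≤ q x := by
    rcases K.eq_empty_or_nonempty with he | hne
    · exact ⟨1, one_pos, by simp [he]⟩
    · obtain ⟨p, hp, hmin⟩ := hK.exists_isMinOn hne hqs.continuous.continuousOn
      exact ⟨q p, hqpos p hp, fun y hy => hmin hy⟩
  obtain ⟨c₀, hc₀, hell⟩ := exists_ellipticity_constant (fun k l => (ha k l).continuous) hK hpos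
  -- the part of the quadratic form in `∇v` that is of lower order in `lam`
  set r : Fin n → Fin n → EuclideanSpace ℝ (Fin n) → ℝ := fun l m x =>
    2 * (∑ k, a k l x * pd k (flux a ψ m) x) - ∑ k, flux a ψ k x * pd k (a l m) x with hr
  have hrs : ∀ k l, Continuous (r k l) := by
    intro l m
    have h1 : ∀ k, Continuous (pd k (flux a ψ m)) := fun k =>
      (contDiff_pd (m' := ∞) k (hβ m) (by simp)).continuous
    have h2 : ∀ k, Continuous (pd k (a l m)) := fun k =>
      (contDiff_pd (m' := ∞) k (ha l m) (by simp)).continuous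
    have h3 : ∀ k, Continuous (flux a ψ k) := fun k => (hβ k).continuous
    have h4 : ∀ k l, Continuous (a k l) := fun k l => (ha k l).continuous
    fun_prop
  obtain ⟨C₁, hC₁, hrK⟩ := exists_quadratic_bound hrs hK
  obtain ⟨C₂, hC₂⟩ : ∃ C₂, ∀ x ∈ K, ‖∑ k, flux a ψ k x * pd k q x‖ ≤ C₂ := by
    refine hK.exists_bound_of_continuousOn (Continuous.continuousOn ?_)
    have h1 : ∀ k, Continuous (pd k q) := fun k =>
      (contDiff_pd (m' := ∞) k hqs (by simp)).continuous
    have h3 : ∀ k, Continuous (flux a ψ k) := fun k => (hβ k).continuous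
    fun_prop
  -- `lam` makes the quadratic form in `∇v` and the coefficient of `τ² v²` at least `1`, up to
  -- powers of `lam φ`
  obtain ⟨lam, hlam1, hlamA, hlamB⟩ : ∃ lam : ℝ, 1 ≤ lam ∧ 1 ≤ lam * (q₀ * c₀) - C₁ ∧
      1 ≤ lam * q₀ ^ 2 - C₂ := by
    have t1 : Tendsto (fun l : ℝ => l * (q₀ * c₀)) atTop atTop :=
      tendsto_id.atTop_mul_const (by positivity)
    have t2 : Tendsto (fun l : ℝ => l * q₀ ^ 2) atTop atTop :=
      tendsto_id.atTop_mul_const (by positivity)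
    obtain ⟨l, h1, h2, h3⟩ := ((eventually_ge_atTop (1 : ℝ)).and
      ((t1.eventually_ge_atTop (1 + C₁)).and (t2.eventually_ge_atTop (1 + C₂)))).exists
    exact ⟨l, h1, by linarith, by linarith⟩
  set φ := weight lam ψ with hφ
  have hφs : ContDiff ℝ ∞ φ := by
    rw [hφ]; unfold weight; fun_prop
  have hφpos : ∀ x, 0 < φ x := fun x => Real.exp_pos _
  have hφd : Differentiable ℝ φ := hφs.differentiable (by simp)
  obtain ⟨φ₀, hφ₀, hφK⟩ : ∃ φ₀ > 0, ∀ x ∈ K, φ₀ ≤ φ x := by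
    rcases K.eq_empty_or_nonempty with he | hne
    · exact ⟨1, one_pos, by simp [he]⟩
    · obtain ⟨p, hp, hmin⟩ := hK.exists_isMinOn hne hφs.continuous.continuousOn
      exact ⟨φ p, hφpos p, fun y hy => hmin hy⟩
  set b : Fin n → EuclideanSpace ℝ (Fin n) → ℝ := fun k x => (2 * lam) * (φ x * flux a ψ k x)
    with hb
  set Q : EuclideanSpace ℝ (Fin n) → ℝ := fun x => lam ^ 2 * ((φ x * φ x) * q x) with hQ
  have hbs : ∀ k, ContDiff ℝ ∞ (b k) := by intro k; have := hβ k; fun_prop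
  have hQs : ContDiff ℝ ∞ Q := by fun_prop
  -- the additional term in `s` moves part of the positivity of the `v²` coefficient to the gradient
  set s : EuclideanSpace ℝ (Fin n) → ℝ :=
    fun x => (1 / 2) * (∑ k, pd k (b k) x) + lam ^ 2 * (φ x * q x) with hs
  have hss : ContDiff ℝ ∞ s := by
    have : ∀ k, ContDiff ℝ ∞ (pd k (b k)) := fun k => contDiff_pd k (hbs k) (by simp)
    fun_prop
  have hpφ : ∀ k x, pd k φ x = lam * φ x * pd k ψ x := fun k x => pd_weight lam hψd k x
  have hfφ : ∀ k x, flux a φ k x = lam * φ x * flux a ψ k x := fun k x => flux_weight lam hψd k x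
  -- the gradient term carries the factor `lam φ` and the `v²` term the factor `lam³ φ³`
  refine ⟨lam, by linarith, min φ₀ (φ₀ ^ 3), by positivity, b, s, Q, hbs, hss, hQs, ?_, ?_, ?_⟩
  · intro k x
    rw [hfφ]; ring
  · intro x
    simp only [hQ, hq, Finset.mul_sum]
    refine Finset.sum_congr rfl fun k _ => ?_
    rw [show pd k (weight lam ψ) x = _ from hpφ k x,
      show flux a (weight lam ψ) k x = _ from hfφ k x]
    ring
  intro x hx τ v hv
  rw [rellich_identity τ (fun k l => (ha k l).of_le (by simp)) hsymm
    (fun k => (hbs k).of_le (by simp)) (hss.of_le (by simp)) (hQs.of_le (by simp)) hv x]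
  have dβ : ∀ k, DifferentiableAt ℝ (flux a ψ k) x := fun k => (hβ k).differentiable (by simp) x
  have dq : DifferentiableAt ℝ q x := hqs.differentiable (by simp) x
  have hpb : ∀ k m, pd k (b m) x
      = 2 * lam * φ x * (lam * pd k ψ x * flux a ψ m x + pd k (flux a ψ m) x) := by
    intro k m
    have := dβ m
    rw [pd_const_mul k _ (by fun_prop), pd_mul k (hφd x) this, hpφ]; ring
  have hpQ : ∀ k, pd k Q x
      = lam ^ 2 * φ x ^ 2 * (2 * lam * pd k ψ x * q x + pd k q x) := by
    intro k
    rw [pd_const_mul k _ (by fun_prop), pd_mul k (by fun_prop) dq, pd_mul k (hφd x) (hφd x), hpφ]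
    ring
  have hw : ∑ k, flux a v k x * pd k ψ x = ∑ m, flux a ψ m x * pd m v x := by
    simp only [flux, Finset.sum_mul]
    rw [Finset.sum_comm]
    refine Finset.sum_congr rfl fun k _ => Finset.sum_congr rfl fun l _ => ?_
    rw [hsymm k l]; ring
  have hG : ∑ k, pd k v x * flux a v k x = ∑ k, ∑ l, a k l x * (pd k v x * pd l v x) := by
    simp only [flux, Finset.mul_sum]
    exact Finset.sum_congr rfl fun k _ => Finset.sum_congr rfl fun l _ => by ring
  have hM : (∑ k, flux a v k x * ∑ m, pd k (b m) x * pd m v x)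
        - (1 / 2) * (∑ m, b m x * ∑ k, ∑ l, pd m (a k l) x * (pd k v x * pd l v x))
      = lam * φ x * (2 * lam * (∑ m, flux a ψ m x * pd m v x) ^ 2
        + ∑ k, ∑ l, r k l x * (pd k v x * pd l v x)) := by
    have f1 : ∑ k, flux a v k x * ∑ m, pd k (b m) x * pd m v x
        = 2 * lam * φ x * (lam * (∑ k, flux a v k x * pd k ψ x)
            * (∑ m, flux a ψ m x * pd m v x)
          + ∑ k, flux a v k x * ∑ m, pd k (flux a ψ m) x * pd m v x) := by
      simp only [hpb]
      rw [mul_assoc lam, Finset.sum_mul, Finset.mul_sum, ← Finset.sum_add_distrib, Finset.mul_sum]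
      refine Finset.sum_congr rfl fun k _ => ?_
      simp only [Finset.mul_sum, ← Finset.sum_add_distrib]
      exact Finset.sum_congr rfl fun m _ => by ring
    have f2 : ∑ k, flux a v k x * ∑ m, pd k (flux a ψ m) x * pd m v x
        = ∑ l, ∑ m, (∑ k, a k l x * pd k (flux a ψ m) x) * (pd l v x * pd m v x) := by
      have hfl : ∀ k, flux a v k x * ∑ m, pd k (flux a ψ m) x * pd m v x
          = ∑ l, ∑ m, a k l x * pd l v x * (pd k (flux a ψ m) x * pd m v x) := fun k => by
        rw [show flux a v k x = ∑ l, a k l x * pd l v x from rfl, Finset.sum_mul_sum]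
      simp only [hfl]
      rw [Finset.sum_comm]
      refine Finset.sum_congr rfl fun l _ => ?_
      rw [Finset.sum_comm]
      refine Finset.sum_congr rfl fun m _ => ?_
      rw [Finset.sum_mul]
      exact Finset.sum_congr rfl fun k _ => by ring
    have f3 : ∑ m, b m x * ∑ k, ∑ l, pd m (a k l) x * (pd k v x * pd l v x)
        = 2 * lam * φ x * ∑ k, ∑ l, (∑ m, flux a ψ m x * pd m (a k l) x)
            * (pd k v x * pd l v x) := by
      simp only [hb, Finset.mul_sum, Finset.sum_mul]
      rw [Finset.sum_comm]
      refine Finset.sum_congr rfl fun k _ => ?_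
      rw [Finset.sum_comm]
      exact Finset.sum_congr rfl fun l _ => Finset.sum_congr rfl fun m _ => by ring
    rw [f1, f2, f3, hw]
    have f4 : ∑ k, ∑ l, r k l x * (pd k v x * pd l v x)
        = 2 * (∑ l, ∑ m, (∑ k, a k l x * pd k (flux a ψ m) x) * (pd l v x * pd m v x))
          - ∑ k, ∑ l, (∑ m, flux a ψ m x * pd m (a k l) x) * (pd k v x * pd l v x) := by
      rw [Finset.mul_sum, ← Finset.sum_sub_distrib]
      refine Finset.sum_congr rfl fun l _ => ?_
      rw [Finset.mul_sum, ← Finset.sum_sub_distrib]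
      refine Finset.sum_congr rfl fun m _ => ?_
      simp only [hr]
      ring
    rw [f4]; ring
  have hN : (1 / 2) * (∑ k, pd k (fun y => Q y * b k y) x) - s x * Q x
      = lam ^ 3 * φ x ^ 3 * (lam * q x ^ 2 + ∑ k, flux a ψ k x * pd k q x) := by
    have f1 : ∑ k, pd k (fun y => Q y * b k y) x
        = (∑ k, pd k Q x * b k x) + Q x * ∑ k, pd k (b k) x := by
      rw [Finset.mul_sum, ← Finset.sum_add_distrib]
      exact Finset.sum_congr rfl fun k _ => pd_mul k (hQs.differentiable (by simp) x)
        ((hbs k).differentiable (by simp) x)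
    have f2 : ∑ k, pd k Q x * b k x = 2 * lam ^ 3 * φ x ^ 3
        * (2 * lam * q x * (∑ k, pd k ψ x * flux a ψ k x) + ∑ k, flux a ψ k x * pd k q x) := by
      simp only [hpQ, hb, Finset.mul_sum, ← Finset.sum_add_distrib]
      exact Finset.sum_congr rfl fun k _ => by ring
    rw [f1, f2, show ∑ k, pd k ψ x * flux a ψ k x = q x from rfl]
    simp only [hs, hQ]
    ring
  rw [hM, hN, hG]
  have hφx := hφK x hx
  have hqx := hqK x hx
  have hellx := hell x hx (fun k => pd k v x)
  have hrx := (abs_le.1 (hrK x hx (fun k => pd k v x))).1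
  have hCx := (abs_le.1 (hC₂ x hx)).1
  have hD : 0 ≤ ∑ k, pd k v x ^ 2 := Finset.sum_nonneg fun k _ => sq_nonneg _
  generalize (∑ k, ∑ l, r k l x * (pd k v x * pd l v x)) = R at *
  generalize (∑ k, ∑ l, a k l x * (pd k v x * pd l v x)) = G at *
  generalize (∑ k, pd k v x ^ 2) = D at *
  generalize (∑ k, flux a ψ k x * pd k q x) = Z at *
  have hsx : s x - 1 / 2 * ∑ k, pd k (b k) x = lam ^ 2 * (φ x * q x) := by simp only [hs]; ring
  rw [hsx]
  have g1 : min φ₀ (φ₀ ^ 3) * D ≤ lam * φ x * (2 * lam * (∑ m, flux a ψ m x * pd m v x) ^ 2 + R)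
      + lam ^ 2 * (φ x * q x) * G := by
    have h1 : q₀ * c₀ * D ≤ q x * G := by
      rw [mul_assoc]; exact mul_le_mul hqx hellx (by positivity) (hq₀.le.trans hqx)
    have h2 : D ≤ 2 * lam * (∑ m, flux a ψ m x * pd m v x) ^ 2 + R + lam * (q x * G) := by
      have : 0 ≤ 2 * lam * (∑ m, flux a ψ m x * pd m v x) ^ 2 := by positivity
      have h3 : lam * (q₀ * c₀ * D) ≤ lam * (q x * G) := by gcongr
      nlinarith
    have h4 : φ₀ ≤ lam * φ x := by nlinarith
    calc min φ₀ (φ₀ ^ 3) * D ≤ φ₀ * D := by gcongr; exact min_le_left _ _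
      _ ≤ lam * φ x * (2 * lam * (∑ m, flux a ψ m x * pd m v x) ^ 2 + R + lam * (q x * G)) :=
        mul_le_mul h4 h2 hD (hφ₀.le.trans h4)
      _ = _ := by ring
  have g2 : min φ₀ (φ₀ ^ 3) ≤ lam ^ 3 * φ x ^ 3 * (lam * q x ^ 2 + Z) := by
    have h1 : 1 ≤ lam * q x ^ 2 + Z := by
      have : lam * q₀ ^ 2 ≤ lam * q x ^ 2 := by gcongr
      linarith
    have h2 : (1:ℝ) ≤ lam ^ 3 := one_le_pow₀ hlam1
    have h3 : φ₀ ^ 3 ≤ φ x ^ 3 := by gcongr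
    calc min φ₀ (φ₀ ^ 3) ≤ φ₀ ^ 3 := min_le_right _ _
      _ ≤ lam ^ 3 * φ x ^ 3 := by nlinarith [pow_pos hφ₀ 3]
      _ ≤ lam ^ 3 * φ x ^ 3 * (lam * q x ^ 2 + Z) := le_mul_of_one_le_right (by
          have := hφpos x; positivity) h1
  have g3 : τ ^ 2 * min φ₀ (φ₀ ^ 3) * v x ^ 2
      ≤ τ ^ 2 * (lam ^ 3 * φ x ^ 3 * (lam * q x ^ 2 + Z)) * v x ^ 2 := by gcongr
  linarith

theorem pd_eq_zero_of_notMem_tsupport {f : EuclideanSpace ℝ (Fin n) → ℝ}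
    {x : EuclideanSpace ℝ (Fin n)} (hx : x ∉ tsupport f) (k : Fin n) : pd k f x = 0 := by
  rw [pd_eq_of_eventuallyEq k (notMem_tsupport_iff_eventuallyEq.1 hx)]
  simp [pd]

theorem divOp_eq_zero_of_notMem_tsupport {f : EuclideanSpace ℝ (Fin n) → ℝ}
    {x : EuclideanSpace ℝ (Fin n)} (hx : x ∉ tsupport f) : divOp a f x = 0 := by
  rw [divOp_congr_nhds (notMem_tsupport_iff_eventuallyEq.1 hx)]
  have h : flux a (0 : EuclideanSpace ℝ (Fin n) → ℝ) = 0 := by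
    ext k y; simp [flux, pd]
  simp [divOp, h, pd]

theorem tsupport_rellichField_subset {b : Fin n → EuclideanSpace ℝ (Fin n) → ℝ}
    {s Q v : EuclideanSpace ℝ (Fin n) → ℝ} {τ : ℝ} {k : Fin n} :
    tsupport (rellichField a b s Q τ v k) ⊆ tsupport v := by
  refine closure_minimal (fun x hx => ?_) (isClosed_tsupport v)
  by_contra h
  have h1 : ∀ k, pd k v x = 0 := pd_eq_zero_of_notMem_tsupport h
  exact hx (by simp [rellichField, flux, h1, image_eq_zero_of_notMem_tsupport h])

/-- With `L` the second order term, `T = a∇φ · ∇v`, `Q = ⟨a∇φ, ∇φ⟩` and `p = div (a∇φ)`, the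
conjugated operator is the symmetric part `L + τ²Qv` plus the antisymmetric part `-τ (2T + sv)` plus
the error `τ (s - p) v`. Up to the square of the error, the square of the operator is at least twice
the product of the two parts. -/
theorem four_mul_le_conjugate_sq (L Q v T s p τ : ℝ) :
    4 * τ * (-(L + τ ^ 2 * (Q * v)) * (2 * T + s * v))
      ≤ 2 * (L - 2 * τ * T - τ * p * v + τ ^ 2 * Q * v) ^ 2 + 2 * τ ^ 2 * (s - p) ^ 2 * v ^ 2 := by
  have h1 := sq_nonneg ((L + τ ^ 2 * (Q * v)) + τ * (2 * T + s * v))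
  have h2 := sq_nonneg ((L - 2 * τ * T - τ * p * v + τ ^ 2 * Q * v) + τ * (s - p) * v)
  linear_combination h1 + h2

/-- The Carleman estimate before integration. -/
theorem exists_carleman_pointwise
    (ha : ∀ k l, ContDiff ℝ ∞ (a k l)) (hsymm : ∀ k l x, a k l x = a l k x)
    {ψ : EuclideanSpace ℝ (Fin n) → ℝ} (hψ : ContDiff ℝ ∞ ψ)
    {K : Set (EuclideanSpace ℝ (Fin n))} (hK : IsCompact K)
    (hpos : ∀ x ∈ K, ∀ ξ : Fin n → ℝ, ξ ≠ 0 → 0 < ∑ k, ∑ l, a k l x * (ξ k * ξ l))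
    (hgrad : ∀ x ∈ K, ∃ k, pd k ψ x ≠ 0) :
    ∃ lam > 0, ∃ c > 0, ∃ τ₀ > 0, ∀ τ ≥ τ₀, ∀ w : EuclideanSpace ℝ (Fin n) → ℝ,
      ContDiff ℝ 2 w → tsupport w ⊆ K →
      ∃ F : Fin n → EuclideanSpace ℝ (Fin n) → ℝ, (∀ k, ContDiff ℝ 1 (F k)) ∧
        (∀ k, tsupport (F k) ⊆ K) ∧ ∀ x,
        c * ((Real.exp (τ * weight lam ψ x)) ^ 2
          * (τ ^ 3 * w x ^ 2 + τ * ∑ k, pd k w x ^ 2)) + 2 * τ * ∑ k, pd k (F k) x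
          ≤ (Real.exp (τ * weight lam ψ x) * divOp a w x) ^ 2 := by
  obtain ⟨lam, hlam, c, hc, b, s, Q, hb, hs, hQ, hbφ, hQφ, hlow⟩ :=
    exists_weight_rellich_lower_bound ha hsymm hψ hK hpos hgrad
  set φ := weight lam ψ with hφdef
  have hφ : ContDiff ℝ ∞ φ := by rw [hφdef]; unfold weight; fun_prop
  have hφd : Differentiable ℝ φ := hφ.differentiable (by simp)
  have hpφ : ∀ k, Continuous (pd k φ) := fun k =>
    (contDiff_pd (m' := ∞) k hφ (by simp)).continuous
  have hps : ∀ k, Continuous (pd k s) := fun k =>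
    (contDiff_pd (m' := ∞) k hs (by simp)).continuous
  have hpf : ∀ k, Continuous (pd k (flux a φ k)) := fun k =>
    (contDiff_pd (m' := ∞) k (contDiff_flux (m' := ∞) ha hφ (by simp) k) (by simp)).continuous
  have hac : ∀ k l, Continuous (a k l) := fun k l => (ha k l).continuous
  have hsc := hs.continuous
  obtain ⟨C₃, hC₃⟩ : ∃ C, ∀ x ∈ K, ‖∑ l, (∑ k, pd k s x * a k l x) ^ 2‖ ≤ C :=
    hK.exists_bound_of_continuousOn (Continuous.continuousOn (by fun_prop))
  obtain ⟨C₄, hC₄⟩ : ∃ C, ∀ x ∈ K, ‖(s x - divOp a φ x) ^ 2‖ ≤ C :=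
    hK.exists_bound_of_continuousOn (Continuous.continuousOn (by unfold divOp; fun_prop))
  obtain ⟨C₅, hC₅⟩ : ∃ C, ∀ x ∈ K, ‖∑ k, pd k φ x ^ 2‖ ≤ C :=
    hK.exists_bound_of_continuousOn (Continuous.continuousOn (by fun_prop))
  refine ⟨lam, hlam, c / (2 + 2 * |C₅|), by positivity,
    1 + (|C₃| / c + |C₄|) / c, by positivity, fun τ hτ w hw hwK => ?_⟩
  have hτ1 : 1 ≤ τ := le_trans (by simp; positivity) hτ
  have hτc : |C₃| / c + |C₄| ≤ c * τ := by
    have : (|C₃| / c + |C₄|) / c ≤ τ := by linarith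
    rwa [div_le_iff₀ hc, mul_comm] at this
  set v : EuclideanSpace ℝ (Fin n) → ℝ := fun y => Real.exp (τ * φ y) * w y with hv
  have hφ2 : ContDiff ℝ 2 φ := contDiff_infty.1 hφ 2
  have hv2 : ContDiff ℝ 2 v := by fun_prop
  have hvK : tsupport v ⊆ K := (tsupport_mul_subset_right).trans hwK
  refine ⟨rellichField a b s Q τ v, fun k => contDiff_rellichField τ
    (fun k l => (ha k l).of_le (by simp)) (fun k => (hb k).of_le (by simp)) (hs.of_le (by simp))
    (hQ.of_le (by simp)) hv2 k, fun k => tsupport_rellichField_subset.trans hvK, fun x => ?_⟩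
  by_cases hxK : x ∈ K
  swap
  · have hxw : x ∉ tsupport w := fun h => hxK (hwK h)
    have h1 : ∀ k, pd k w x = 0 := pd_eq_zero_of_notMem_tsupport hxw
    have h2 : ∀ k, pd k (rellichField a b s Q τ v k) x = 0 := fun k =>
      pd_eq_zero_of_notMem_tsupport
        (fun h => hxK (hvK (tsupport_rellichField_subset h))) k
    simp [h1, h2, image_eq_zero_of_notMem_tsupport hxw, divOp_eq_zero_of_notMem_tsupport hxw]
  have hcon := divOp_conjugate (fun k l => (ha k l).of_le (by simp)) hsymm hφ2 hw τ x
  have hlow' := hlow x hxK τ v hv2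
  have hpv : ∀ k, pd k v x = Real.exp (τ * φ x) * pd k w x + τ * (v x * pd k φ x) := by
    intro k
    rw [pd_mul k (by fun_prop) (hw.differentiable (by norm_num) x), pd_exp k (by fun_prop),
      pd_const_mul k _ (hφd x)]
    simp only [hv]; ring
  -- the cross term is absorbed by `c |∇v|² / 2` and a multiple of `v²`
  have hcross : -(c / 2 * (∑ k, pd k v x ^ 2) + |C₃| / (2 * c) * v x ^ 2)
      ≤ v x * (∑ k, pd k s x * flux a v k x) := by
    have e : v x * (∑ k, pd k s x * flux a v k x)
        = ∑ l, v x * (∑ k, pd k s x * a k l x) * pd l v x := by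
      simp only [flux, Finset.mul_sum, Finset.sum_mul]
      rw [Finset.sum_comm]
      exact Finset.sum_congr rfl fun l _ => Finset.sum_congr rfl fun k _ => by ring
    have h1 : ∀ l, -(c / 2 * pd l v x ^ 2
        + (∑ k, pd k s x * a k l x) ^ 2 * (v x ^ 2 / (2 * c)))
        ≤ v x * (∑ k, pd k s x * a k l x) * pd l v x := by
      intro l
      generalize (∑ k, pd k s x * a k l x) = g
      have : v x * g * pd l v x + (c / 2 * pd l v x ^ 2 + g ^ 2 * (v x ^ 2 / (2 * c)))
          = (c * pd l v x + v x * g) ^ 2 / (2 * c) := by field_simp; ring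
      have h : 0 ≤ (c * pd l v x + v x * g) ^ 2 / (2 * c) := by positivity
      linarith
    have h2 : ∑ l, (∑ k, pd k s x * a k l x) ^ 2 ≤ |C₃| :=
      ((le_abs_self _).trans (hC₃ x hxK)).trans (le_abs_self _)
    rw [e]
    refine le_trans ?_ (Finset.sum_le_sum fun l _ => h1 l)
    rw [Finset.sum_neg_distrib, Finset.sum_add_distrib, ← Finset.mul_sum, ← Finset.sum_mul]
    have : (∑ l, (∑ k, pd k s x * a k l x) ^ 2) * (v x ^ 2 / (2 * c))
        ≤ |C₃| * (v x ^ 2 / (2 * c)) := by gcongr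
    have e2 : |C₃| / (2 * c) * v x ^ 2 = |C₃| * (v x ^ 2 / (2 * c)) := by ring
    rw [e2]
    linarith
  have hbv : ∑ m, b m x * pd m v x = 2 * ∑ m, flux a φ m x * pd m v x := by
    simp only [hbφ, Finset.mul_sum]
    exact Finset.sum_congr rfl fun k _ => by ring
  have hDw : Real.exp (τ * φ x) ^ 2 * ∑ k, pd k w x ^ 2
      ≤ 2 * ∑ k, pd k v x ^ 2 + 2 * τ ^ 2 * |C₅| * v x ^ 2 := by
    have h1 : ∀ k, Real.exp (τ * φ x) ^ 2 * pd k w x ^ 2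
        ≤ 2 * pd k v x ^ 2 + (2 * τ ^ 2 * v x ^ 2) * pd k φ x ^ 2 := by
      intro k
      rw [hpv k]
      nlinarith [sq_nonneg (Real.exp (τ * φ x) * pd k w x + 2 * (τ * (v x * pd k φ x)))]
    have h2 : ∑ k, pd k φ x ^ 2 ≤ |C₅| :=
      ((le_abs_self _).trans (hC₅ x hxK)).trans (le_abs_self _)
    rw [Finset.mul_sum]
    refine (Finset.sum_le_sum fun k _ => h1 k).trans ?_
    rw [Finset.sum_add_distrib, ← Finset.mul_sum, ← Finset.mul_sum]
    have : (2 * τ ^ 2 * v x ^ 2) * ∑ k, pd k φ x ^ 2 ≤ (2 * τ ^ 2 * v x ^ 2) * |C₅| := by gcongr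
    linarith
  have hC4 : (s x - divOp a φ x) ^ 2 ≤ |C₄| :=
    ((le_abs_self _).trans (hC₄ x hxK)).trans (le_abs_self _)
  rw [hcon]
  have hvx : Real.exp (τ * φ x) ^ 2 * w x ^ 2 = v x ^ 2 := by simp only [hv]; ring
  rw [← hφdef, show Real.exp (τ * φ x) * w x = v x from rfl,
    show (∑ k, pd k φ x * flux a φ k x) = Q x from (hQφ x).symm,
    show (fun y => Real.exp (τ * φ y) * w y) = v from rfl]
  rw [hbv] at hlow'
  generalize (∑ k, pd k (rellichField a b s Q τ v k) x) = dF at *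
  generalize hDd : (∑ k, pd k v x ^ 2) = D at *
  generalize (v x * ∑ k, pd k s x * flux a v k x) = Y at *
  generalize (∑ k, flux a φ k x * pd k v x) = T at *
  set Dw := ∑ k, pd k w x ^ 2 with hDwdef
  generalize divOp a v x = Lv at *
  generalize divOp a φ x = Lφ at *
  generalize Q x = Qx at *
  generalize s x = sx at *
  have hD0 : 0 ≤ D := by rw [← hDd]; positivity
  generalize v x = V at *
  -- `(P₁ - τP₂)² ≥ -4τP₁P₂`, and `P₁ - τP₂` is the conjugated operator up to a term of order zero
  have hsq := four_mul_le_conjugate_sq Lv Qx V T sx Lφ τ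
  have hτ0 : 0 < τ := by linarith
  have hA : 2 * τ * dF + τ * c * D + c * τ ^ 3 * V ^ 2
      ≤ (Lv - 2 * τ * T - τ * Lφ * V + τ ^ 2 * Qx * V) ^ 2 := by
    have h1 : 4 * τ * (dF + c / 2 * D - |C₃| / (2 * c) * V ^ 2 + τ ^ 2 * c * V ^ 2)
        ≤ 4 * τ * (-(Lv + τ ^ 2 * (Qx * V)) * (2 * T + sx * V)) := by
      gcongr; linarith
    have h2 : 2 * τ ^ 2 * (sx - Lφ) ^ 2 * V ^ 2 ≤ 2 * τ ^ 2 * |C₄| * V ^ 2 := by gcongr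
    have h3 : (|C₃| / c * τ + |C₄| * τ ^ 2) * V ^ 2 ≤ c * τ ^ 3 * V ^ 2 := by
      gcongr
      have hh : |C₃| / c * τ ≤ |C₃| / c * τ ^ 2 := by
        gcongr; nlinarith
      have : (|C₃| / c + |C₄|) * τ ^ 2 ≤ c * τ * τ ^ 2 := by gcongr
      linear_combination this + hh
    have e : |C₃| / (2 * c) = (|C₃| / c) / 2 := by field_simp
    rw [e] at h1
    linear_combination (1 / 2) * h1 + (1 / 2) * hsq + (1 / 2) * h2 + h3
  have hc' : 0 < c / (2 + 2 * |C₅|) := by positivity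
  set c' := c / (2 + 2 * |C₅|) with hc'def
  have hcc : c = c' * (2 + 2 * |C₅|) := by rw [hc'def]; field_simp
  have hB : c' * (Real.exp (τ * φ x) ^ 2 * (τ ^ 3 * w x ^ 2 + τ * Dw))
      ≤ τ * c * D + c * τ ^ 3 * V ^ 2 := by
    have e : c' * (Real.exp (τ * φ x) ^ 2 * (τ ^ 3 * w x ^ 2 + τ * Dw))
        = c' * τ ^ 3 * V ^ 2 + c' * τ * (Real.exp (τ * φ x) ^ 2 * Dw) := by
      rw [← hvx]; ring
    have h1 : c' * τ * (Real.exp (τ * φ x) ^ 2 * Dw)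
        ≤ c' * τ * (2 * D + 2 * τ ^ 2 * |C₅| * V ^ 2) := by gcongr
    have h2 : 0 ≤ c' * |C₅| * τ * D := by positivity
    rw [hcc, e]
    have h3 : 0 ≤ c' * τ ^ 3 * V ^ 2 := by positivity
    linear_combination h1 + 2 * h2 + h3
  linarith

/-- The Carleman estimate for second order elliptic operators. -/
theorem exists_carleman_estimate
    (ha : ∀ k l, ContDiff ℝ ∞ (a k l)) (hsymm : ∀ k l x, a k l x = a l k x)
    {ψ : EuclideanSpace ℝ (Fin n) → ℝ} (hψ : ContDiff ℝ ∞ ψ)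
    {K : Set (EuclideanSpace ℝ (Fin n))} (hK : IsCompact K)
    (hpos : ∀ x ∈ K, ∀ ξ : Fin n → ℝ, ξ ≠ 0 → 0 < ∑ k, ∑ l, a k l x * (ξ k * ξ l))
    (hgrad : ∀ x ∈ K, ∃ k, pd k ψ x ≠ 0) :
    ∃ lam > 0, ∃ c > 0, ∃ τ₀ > 0, ∀ τ ≥ τ₀, ∀ w : EuclideanSpace ℝ (Fin n) → ℝ,
      ContDiff ℝ 2 w → tsupport w ⊆ K →
        c * (∫ x, (Real.exp (τ * weight lam ψ x)) ^ 2
          * (τ ^ 3 * w x ^ 2 + τ * ∑ k, pd k w x ^ 2))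
          ≤ ∫ x, (Real.exp (τ * weight lam ψ x) * divOp a w x) ^ 2 := by
  obtain ⟨lam, hlam, c, hc, τ₀, hτ₀, h⟩ := exists_carleman_pointwise ha hsymm hψ hK hpos hgrad
  refine ⟨lam, hlam, c, hc, τ₀, hτ₀, fun τ hτ w hw hwK => ?_⟩
  obtain ⟨F, hF, hFK, hle⟩ := h τ hτ w hw hwK
  have hφ : Continuous (weight lam ψ) := by
    have := hψ.continuous
    unfold weight; fun_prop
  have hwc : HasCompactSupport w := hK.of_isClosed_subset (isClosed_tsupport w) hwK
  have hpw : ∀ k, Continuous (pd k w) := fun k =>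
    (contDiff_pd (m' := 1) k hw (by norm_num)).continuous
  have hwcont := hw.continuous
  have hLw : Continuous (divOp a w) := by
    have : ∀ k, Continuous (pd k (flux a w k)) := fun k =>
      (contDiff_pd (m' := 0) k (contDiff_flux (m' := 1) (fun k l => (ha k l).of_le (by simp)) hw
        (by norm_num) k) (by norm_num)).continuous
    unfold divOp; fun_prop
  have hFc : ∀ k, HasCompactSupport (F k) := fun k =>
    hK.of_isClosed_subset (isClosed_tsupport _) (hFK k)
  have hpF : ∀ k, Continuous (pd k (F k)) := fun k =>
    (contDiff_pd (m' := 0) k (hF k) (by norm_num)).continuous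
  have hz : ∀ k, ∀ x ∉ K, pd k (F k) x = 0 := fun k x hx =>
    pd_eq_zero_of_notMem_tsupport (fun h => hx (hFK k h)) k
  have hIF : ∀ k, Integrable (pd k (F k)) := fun k =>
    (hpF k).integrable_of_hasCompactSupport (HasCompactSupport.intro hK (hz k))
  have hI1 : Integrable fun x => (Real.exp (τ * weight lam ψ x)) ^ 2
          * (τ ^ 3 * w x ^ 2 + τ * ∑ k, pd k w x ^ 2) := by
    refine Continuous.integrable_of_hasCompactSupport (by fun_prop)
      (HasCompactSupport.intro hK fun x hx => ?_)
    have hxw : x ∉ tsupport w := fun h => hx (hwK h)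
    simp [image_eq_zero_of_notMem_tsupport hxw, pd_eq_zero_of_notMem_tsupport hxw]
  have hI2 : Integrable fun x => (Real.exp (τ * weight lam ψ x) * divOp a w x) ^ 2 := by
    refine Continuous.integrable_of_hasCompactSupport (by fun_prop)
      (HasCompactSupport.intro hK fun x hx => ?_)
    simp [divOp_eq_zero_of_notMem_tsupport (a := a) (fun h => hx (hwK h))]
  have hdiv : ∫ x, 2 * τ * ∑ k, pd k (F k) x = 0 := by
    rw [integral_const_mul, integral_finsetSum _ fun k _ => hIF k]
    simp [integral_pd_eq_zero _ (hF _) (hFc _)]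
  have hmono := integral_mono ((hI1.const_mul c).add
    ((integrable_finsetSum Finset.univ fun k _ => hIF k).const_mul (2 * τ))) hI2 hle
  simp only [Pi.add_apply] at hmono
  rw [integral_add (hI1.const_mul c)
    ((integrable_finsetSum Finset.univ fun k _ => hIF k).const_mul (2 * τ)),
    hdiv, add_zero, integral_const_mul] at hmono
  exact hmono

end Carleman

/-! ### Weak unique continuation -/

section UniqueContinuation

variable {n : ℕ}

theorem contDiff_mul_of_tsupport_subset {m : ℕ∞ω} {U : Set (EuclideanSpace ℝ (Fin n))}
    (hU : IsOpen U) {χ f : EuclideanSpace ℝ (Fin n) → ℝ} (hχ : ContDiff ℝ m χ)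
    (hf : ContDiffOn ℝ m f U) (hs : tsupport χ ⊆ U) : ContDiff ℝ m fun x => χ x * f x := by
  rw [contDiff_iff_contDiffAt]
  intro x
  by_cases hx : x ∈ U
  · exact hχ.contDiffAt.mul (hf.contDiffAt (hU.mem_nhds hx))
  · have h0 := notMem_tsupport_iff_eventuallyEq.1 (fun h => hx (hs h))
    refine (contDiffAt_const (c := (0 : ℝ))).congr_of_eventuallyEq ?_
    filter_upwards [h0] with y hy
    simp [hy]

theorem divOp_congr_coeff {a a' : Fin n → Fin n → EuclideanSpace ℝ (Fin n) → ℝ}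
    {v : EuclideanSpace ℝ (Fin n) → ℝ} {x : EuclideanSpace ℝ (Fin n)}
    (h : ∀ k l, a k l =ᶠ[𝓝 x] a' k l) : divOp a v x = divOp a' v x := by
  refine Finset.sum_congr rfl fun k _ => pd_eq_of_eventuallyEq k ?_
  filter_upwards [eventually_all.2 (h k)] with y hy
  simp [flux, hy]

theorem pd_neg_norm_sub_sq (q : EuclideanSpace ℝ (Fin n)) (k : Fin n)
    (x : EuclideanSpace ℝ (Fin n)) : pd k (fun y => -‖y - q‖ ^ 2) x = -(2 * (x k - q k)) := by
  have h : HasFDerivAt (fun y : EuclideanSpace ℝ (Fin n) => -‖y - q‖ ^ 2)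
      (-(2 • (innerSL ℝ (x - q)))) x := by
    have := (hasStrictFDerivAt_norm_sq (x - q)).hasFDerivAt.comp x ((hasFDerivAt_id x).sub_const q)
    simpa using! this.neg
  simp [pd, h.fderiv, EuclideanSpace.inner_single_right]

/-- Weak unique continuation: a solution of the differential inequality
`|div (a∇u)| ≤ C (|u| + |∇u|)` in a ball which vanishes near the centre vanishes in the ball. -/
theorem eq_zero_on_ball_of_eq_zero_near_center {ι : Type*} [Fintype ι]
    {U : Set (EuclideanSpace ℝ (Fin n))} (hU : IsOpen U)
    {a : Fin n → Fin n → EuclideanSpace ℝ (Fin n) → ℝ}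
    (ha : ∀ k l, ContDiffOn ℝ ∞ (a k l) U) (hsymm : ∀ k l, ∀ x ∈ U, a k l x = a l k x)
    (hpos : ∀ x ∈ U, ∀ ξ : Fin n → ℝ, ξ ≠ 0 → 0 < ∑ k, ∑ l, a k l x * (ξ k * ξ l))
    {u : ι → EuclideanSpace ℝ (Fin n) → ℝ} (hu : ∀ i, ContDiffOn ℝ 2 (u i) U)
    {q : EuclideanSpace ℝ (Fin n)} {r R R' C : ℝ} (hr : 0 < r) (hRR' : R < R')
    (hball : Metric.closedBall q R' ⊆ U)
    (hineq : ∀ x ∈ Metric.ball q R', ∑ i, divOp a (u i) x ^ 2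
      ≤ C * ∑ i, (u i x ^ 2 + ∑ k, pd k (u i) x ^ 2))
    (hzero : ∀ x ∈ Metric.ball q r, ∀ i, u i x = 0) :
    ∀ x ∈ Metric.ball q R, ∀ i, u i x = 0 := by
  rcases le_or_gt R 0 with hR0 | hR0
  · simp [Metric.ball_eq_empty.2 hR0]
  obtain ⟨R₁, hR1, hR1'⟩ := exists_between hRR'
  obtain ⟨R₂, hR12, hR2'⟩ := exists_between hR1'
  let χ : ContDiffBump q := ⟨R₁, R₂, by linarith, hR12⟩
  let ρ : ContDiffBump q := ⟨R₂, R', by linarith, hR2'⟩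
  have hχU : tsupport χ ⊆ U := by
    rw [χ.tsupport_eq]; exact (Metric.closedBall_subset_closedBall hR2'.le).trans hball
  have hρU : tsupport ρ ⊆ U := by rw [ρ.tsupport_eq]; exact hball
  have hχ2 : ∀ x ∈ tsupport χ, dist x q ≤ R₂ := by
    intro x hx; rw [χ.tsupport_eq] at hx; exact hx
  -- global coefficients, agreeing with the given ones on the support of the cutoff
  set A : Fin n → Fin n → EuclideanSpace ℝ (Fin n) → ℝ :=
    fun k l x => ρ x * a k l x with hA
  have hAs : ∀ k l, ContDiff ℝ ∞ (A k l) := fun k l =>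
    contDiff_mul_of_tsupport_subset hU ρ.contDiff (ha k l) hρU
  have hAsymm : ∀ k l x, A k l x = A l k x := by
    intro k l x
    by_cases hx : x ∈ U
    · simp only [hA, hsymm k l x hx]
    · simp [hA, image_eq_zero_of_notMem_tsupport (fun h => hx (hρU h))]
  have hAa : ∀ x, dist x q ≤ R₂ → ∀ k l, A k l x = a k l x := by
    intro x hx k l
    simp only [hA, ρ.one_of_mem_closedBall hx, one_mul]
  set w : ι → EuclideanSpace ℝ (Fin n) → ℝ := fun i x => χ x * u i x with hw
  have hws : ∀ i, ContDiff ℝ 2 (w i) := fun i =>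
    contDiff_mul_of_tsupport_subset hU χ.contDiff (hu i) hχU
  have hwu : ∀ x, dist x q < R₁ → ∀ i, w i =ᶠ[𝓝 x] u i := by
    intro x hx i
    filter_upwards [Metric.isOpen_ball.mem_nhds (Metric.mem_ball.2 hx)] with y hy
    simp only [hw, χ.one_of_mem_closedBall (Metric.ball_subset_closedBall hy), one_mul]
  set K : Set (EuclideanSpace ℝ (Fin n)) := {x | r ≤ dist x q} ∩ Metric.closedBall q R₂ with hK
  have hKc : IsCompact K := (isCompact_closedBall q R₂).inter_left
    (isClosed_le continuous_const (by fun_prop))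
  have hwK : ∀ i, tsupport (w i) ⊆ K := by
    intro i
    refine closure_minimal (fun x hx => ⟨?_, ?_⟩) hKc.isClosed
    · by_contra h
      exact hx (by simp [hw, hzero x (by simpa using h) i])
    · exact hχ2 x (subset_tsupport _ fun h => hx (by simp [hw, h]))
  set ψ : EuclideanSpace ℝ (Fin n) → ℝ := fun y => -‖y - q‖ ^ 2 with hψdef
  have hψ : ContDiff ℝ ∞ ψ := ((contDiff_id.sub contDiff_const).norm_sq ℝ).neg
  have hgrad : ∀ x ∈ K, ∃ k, pd k ψ x ≠ 0 := by
    intro x hx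
    by_contra! h
    have : x = q := by
      ext k
      have := h k
      rw [pd_neg_norm_sub_sq] at this
      linarith
    have h1 := hx.1
    simp [this] at h1
    linarith
  have hApos : ∀ x ∈ K, ∀ ξ : Fin n → ℝ, ξ ≠ 0 → 0 < ∑ k, ∑ l, A k l x * (ξ k * ξ l) := by
    intro x hx ξ hξ
    simp only [hAa x hx.2]
    exact hpos x (hball (Metric.closedBall_subset_closedBall hR2'.le hx.2)) ξ hξ
  obtain ⟨lam, hlam, c, hc, τ₀, hτ₀, hcar⟩ :=
    exists_carleman_estimate hAs hAsymm hψ hKc hApos hgrad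
  set φ := weight lam ψ with hφdef
  have hφc : Continuous φ := by
    have := hψ.continuous
    rw [hφdef]; unfold weight; fun_prop
  have hφmono : ∀ {x : EuclideanSpace ℝ (Fin n)} {t : ℝ}, 0 ≤ t → dist x q ≤ t →
      Real.exp (lam * -t ^ 2) ≤ φ x := by
    intro x t ht hx
    simp only [hφdef, weight, hψdef, ← dist_eq_norm]
    gcongr
  have hφmono' : ∀ {x : EuclideanSpace ℝ (Fin n)} {t : ℝ}, 0 ≤ t → t ≤ dist x q →
      φ x ≤ Real.exp (lam * -t ^ 2) := by
    intro x t ht hx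
    simp only [hφdef, weight, hψdef, ← dist_eq_norm]
    gcongr
  set φ₁ := Real.exp (lam * -R₁ ^ 2) with hφ₁
  set φ₂ := Real.exp (lam * -R ^ 2) with hφ₂
  have hφ12 : φ₁ < φ₂ := by
    rw [hφ₁, hφ₂]
    gcongr
  -- continuity and supports
  have hwc : ∀ i, Continuous (w i) := fun i => (hws i).continuous
  have hpw : ∀ i k, Continuous (pd k (w i)) := fun i k =>
    (contDiff_pd (m' := 1) k (hws i) (by norm_num)).continuous
  have hLw : ∀ i, Continuous (divOp A (w i)) := by
    intro i
    have : ∀ k, Continuous (pd k (flux A (w i) k)) := fun k =>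
      (contDiff_pd (m' := 0) k (contDiff_flux (m' := 1) (fun k l => (hAs k l).of_le (by simp))
        (hws i) (by norm_num) k) (by norm_num)).continuous
    unfold divOp; fun_prop
  have hw0 : ∀ x ∉ K, ∀ i, w i x = 0 := fun x hx i =>
    image_eq_zero_of_notMem_tsupport fun h => hx (hwK i h)
  have hpw0 : ∀ x ∉ K, ∀ i k, pd k (w i) x = 0 := fun x hx i k =>
    pd_eq_zero_of_notMem_tsupport (fun h => hx (hwK i h)) k
  have hLw0 : ∀ x ∉ K, ∀ i, divOp A (w i) x = 0 := fun x hx i =>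
    divOp_eq_zero_of_notMem_tsupport fun h => hx (hwK i h)
  set g : EuclideanSpace ℝ (Fin n) → ℝ := fun x => ∑ i, w i x ^ 2 with hg
  set h : EuclideanSpace ℝ (Fin n) → ℝ := fun x => ∑ i, ∑ k, pd k (w i) x ^ 2 with hh
  set f : EuclideanSpace ℝ (Fin n) → ℝ := fun x => ∑ i, divOp A (w i) x ^ 2 with hf
  have hgc : Continuous g := by fun_prop
  have hhc : Continuous h := by fun_prop
  have hfc : Continuous f := by fun_prop
  have hg0 : ∀ x, 0 ≤ g x := fun x => by positivity
  have hh0 : ∀ x, 0 ≤ h x := fun x => by positivity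
  have hfK : HasCompactSupport f := HasCompactSupport.intro hKc fun x hx => by
    simp [hf, hLw0 x hx]
  obtain ⟨B, hB⟩ := hfK.exists_bound_of_continuous hfc
  have hI : ∀ (τ : ℝ) (F : EuclideanSpace ℝ (Fin n) → ℝ), Continuous F → (∀ x ∉ K, F x = 0) →
      Integrable fun x => Real.exp (τ * φ x) ^ 2 * F x := by
    intro τ F hF hF0
    refine Continuous.integrable_of_hasCompactSupport (by fun_prop)
      (HasCompactSupport.intro hKc fun x hx => by simp [hF0 x hx])
  have hIg := fun τ => hI τ g hgc fun x hx => by simp [hg, hw0 x hx]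
  have hIh := fun τ => hI τ h hhc fun x hx => by simp [hh, hpw0 x hx]
  have hIf := fun τ => hI τ f hfc fun x hx => by simp [hf, hLw0 x hx]
  have hsum : ∀ τ ≥ τ₀, c * (τ ^ 3 * (∫ x, Real.exp (τ * φ x) ^ 2 * g x)
      + τ * ∫ x, Real.exp (τ * φ x) ^ 2 * h x) ≤ ∫ x, Real.exp (τ * φ x) ^ 2 * f x := by
    intro τ hτ
    have e1 : c * (τ ^ 3 * (∫ x, Real.exp (τ * φ x) ^ 2 * g x)
        + τ * ∫ x, Real.exp (τ * φ x) ^ 2 * h x)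
        = ∑ i, c * ∫ x, Real.exp (τ * φ x) ^ 2 * (τ ^ 3 * w i x ^ 2
          + τ * ∑ k, pd k (w i) x ^ 2) := by
      rw [← integral_const_mul, ← integral_const_mul,
        ← integral_add ((hIg τ).const_mul _) ((hIh τ).const_mul _), ← Finset.mul_sum,
        ← integral_finsetSum]
      · congr 2
        ext x
        simp only [hg, hh, Finset.mul_sum, ← Finset.sum_add_distrib]
        refine Finset.sum_congr rfl fun i _ => ?_
        rw [mul_add, Finset.mul_sum]
        congr 1
        · ring
        · exact Finset.sum_congr rfl fun k _ => by ring
      · intro i _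
        exact hI τ _ (by fun_prop) fun x hx => by simp [hw0 x hx, hpw0 x hx]
    have e2 : ∫ x, Real.exp (τ * φ x) ^ 2 * f x
        = ∑ i, ∫ x, (Real.exp (τ * φ x) * divOp A (w i) x) ^ 2 := by
      rw [← integral_finsetSum]
      · congr 1
        ext x
        simp only [hf, Finset.mul_sum, mul_pow]
      · intro i _
        simp only [mul_pow]
        exact hI τ _ (by have := hLw i; fun_prop) fun x hx => by simp [hLw0 x hx]
    rw [e1, e2]
    exact Finset.sum_le_sum fun i _ => hcar τ hτ (w i) (hws i) (hwK i)
  -- on the shell `R₁ ≤ |x - q| ≤ R₂` the weight is at most `φ₁`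
  have hpt : ∀ τ ≥ 0, ∀ x, Real.exp (τ * φ x) ^ 2 * f x ≤
      |C| * (Real.exp (τ * φ x) ^ 2 * g x) + |C| * (Real.exp (τ * φ x) ^ 2 * h x)
        + (Metric.closedBall q R₂).indicator (fun _ => Real.exp (τ * φ₁) ^ 2 * |B|) x := by
    intro τ hτ x
    have hgx := hg0 x
    have hhx := hh0 x
    have hind : 0 ≤ (Metric.closedBall q R₂).indicator
        (fun _ => Real.exp (τ * φ₁) ^ 2 * |B|) x := indicator_nonneg (fun _ _ => by positivity) x
    rcases lt_or_ge (dist x q) R₁ with hx | hx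
    · have hfx : f x ≤ |C| * (g x + h x) := by
        have e1 : ∀ i, divOp A (w i) x = divOp a (u i) x := by
          intro i
          rw [divOp_congr_nhds (hwu x hx i)]
          refine divOp_congr_coeff fun k l => ?_
          filter_upwards [Metric.isOpen_ball.mem_nhds (Metric.mem_ball.2 hx)] with y hy
          exact hAa y (le_trans (le_of_lt hy) hR12.le) k l
        have e2 : g x + h x = ∑ i, (u i x ^ 2 + ∑ k, pd k (u i) x ^ 2) := by
          simp only [hg, hh, Finset.sum_add_distrib]
          congr 1
          · exact Finset.sum_congr rfl fun i _ => by rw [(hwu x hx i).eq_of_nhds]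
          · exact Finset.sum_congr rfl fun i _ => Finset.sum_congr rfl fun k _ => by
              rw [pd_eq_of_eventuallyEq k (hwu x hx i)]
        calc f x = ∑ i, divOp a (u i) x ^ 2 := by simp only [hf, e1]
          _ ≤ C * (g x + h x) := by
            rw [e2]; exact hineq x (Metric.mem_ball.2 (by linarith))
          _ ≤ _ := by gcongr; exact le_abs_self C
      have : Real.exp (τ * φ x) ^ 2 * f x ≤ Real.exp (τ * φ x) ^ 2 * (|C| * (g x + h x)) := by
        gcongr
      linarith
    · have h1 : 0 ≤ |C| * (Real.exp (τ * φ x) ^ 2 * g x) := by positivity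
      have h2 : 0 ≤ |C| * (Real.exp (τ * φ x) ^ 2 * h x) := by positivity
      by_cases hxb : x ∈ Metric.closedBall q R₂
      · rw [indicator_of_mem hxb]
        have h3 : f x ≤ |B| := ((le_abs_self _).trans (hB x)).trans (le_abs_self B)
        have h4 : φ x ≤ φ₁ := hφmono' (by linarith) hx
        have h5 : 0 ≤ f x := by positivity
        have : Real.exp (τ * φ x) ^ 2 * f x ≤ Real.exp (τ * φ₁) ^ 2 * |B| := by gcongr
        linarith
      · have : f x = 0 := by
          simp [hf, hLw0 x fun hxK => hxb hxK.2]
        rw [this]; simp only [mul_zero]; linarith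
  set V := (volume (Metric.closedBall q R₂)).toReal with hV
  have hint : ∀ τ ≥ 0, ∫ x, Real.exp (τ * φ x) ^ 2 * f x
      ≤ |C| * (∫ x, Real.exp (τ * φ x) ^ 2 * g x) + |C| * (∫ x, Real.exp (τ * φ x) ^ 2 * h x)
        + V * (Real.exp (τ * φ₁) ^ 2 * |B|) := by
    intro τ hτ
    have hIi : Integrable ((Metric.closedBall q R₂).indicator
        (fun _ => Real.exp (τ * φ₁) ^ 2 * |B|)) :=
      (integrable_indicator_iff Metric.isClosed_closedBall.measurableSet).2
        (integrableOn_const (isCompact_closedBall q R₂).measure_lt_top.ne)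
    have hIadd : Integrable fun x => |C| * (Real.exp (τ * φ x) ^ 2 * g x)
        + |C| * (Real.exp (τ * φ x) ^ 2 * h x) := ((hIg τ).const_mul |C|).add ((hIh τ).const_mul |C|)
    refine (integral_mono (hIf τ) (hIadd.add hIi) (hpt τ hτ)).trans (le_of_eq ?_)
    simp only [Pi.add_apply]
    rw [integral_add hIadd hIi,
      integral_add ((hIg τ).const_mul |C|) ((hIh τ).const_mul |C|), integral_const_mul,
      integral_const_mul, integral_indicator Metric.isClosed_closedBall.measurableSet,
      setIntegral_const]
    simp [hV, Measure.real]
  set I := ∫ x in Metric.ball q R, g x with hIdef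
  have hgi : IntegrableOn g (Metric.ball q R) :=
    (hgc.continuousOn.integrableOn_compact (isCompact_closedBall q R)).mono_set
      Metric.ball_subset_closedBall
  have hlow : ∀ τ ≥ 0, Real.exp (τ * φ₂) ^ 2 * I ≤ ∫ x, Real.exp (τ * φ x) ^ 2 * g x := by
    intro τ hτ
    rw [hIdef, ← integral_const_mul]
    refine le_trans (setIntegral_mono_on (hgi.const_mul _) (hIg τ).integrableOn
      Metric.isOpen_ball.measurableSet fun x hx => ?_)
      (setIntegral_le_integral (hIg τ) (Eventually.of_forall fun x => ?_))
    · have : φ₂ ≤ φ x := hφmono hR0.le (le_of_lt hx)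
      have := hg0 x
      gcongr
    · have := hg0 x
      positivity
  -- for large `τ` the left side of the Carleman estimate absorbs the lower order terms, and only
  -- the error on the shell, where the weight is smaller than on the ball, remains
  have hfin : ∀ τ ≥ max (max τ₀ 1) (2 * |C| / c),
      (c / 2) * I ≤ V * |B| * Real.exp (-(τ * (2 * (φ₂ - φ₁)))) := by
    intro τ hτ
    have hτ0 : τ₀ ≤ τ := ((le_max_left _ _).trans (le_max_left _ _)).trans hτ
    have hτ1 : 1 ≤ τ := ((le_max_right _ _).trans (le_max_left _ _)).trans hτ
    have hτC : |C| ≤ c / 2 * τ := by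
      have := (le_max_right _ _).trans hτ
      rw [div_le_iff₀ hc] at this
      linarith
    have hW := hlow τ (by linarith)
    have h1 := (hsum τ hτ0).trans (hint τ (by linarith))
    have hWn : 0 ≤ ∫ x, Real.exp (τ * φ x) ^ 2 * g x :=
      integral_nonneg fun x => by have := hg0 x; positivity
    have hDn : 0 ≤ ∫ x, Real.exp (τ * φ x) ^ 2 * h x :=
      integral_nonneg fun x => by have := hh0 x; positivity
    generalize (∫ x, Real.exp (τ * φ x) ^ 2 * g x) = W at *
    generalize (∫ x, Real.exp (τ * φ x) ^ 2 * h x) = D at *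
    have h2 : |C| * D ≤ c / 2 * τ * D := by gcongr
    have h3 : |C| * W ≤ c / 2 * τ * W := by gcongr
    have h4 : c * (τ * W) ≤ c * (τ ^ 3 * W) := by
      gcongr; exact le_self_pow₀ hτ1 (by norm_num)
    have h5 : c / 2 * W ≤ c / 2 * (τ * W) := by
      gcongr; exact le_mul_of_one_le_left hWn hτ1
    have h6 : 0 ≤ c * (τ * D) := by positivity
    have h7 : c / 2 * W ≤ V * (Real.exp (τ * φ₁) ^ 2 * |B|) := by linarith
    have h8 : c / 2 * (Real.exp (τ * φ₂) ^ 2 * I) ≤ V * (Real.exp (τ * φ₁) ^ 2 * |B|) :=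
      le_trans (by gcongr) h7
    have e : Real.exp (-(τ * (2 * (φ₂ - φ₁)))) =
        Real.exp (τ * φ₁) ^ 2 / Real.exp (τ * φ₂) ^ 2 := by
      rw [← Real.exp_nat_mul, ← Real.exp_nat_mul, ← Real.exp_sub]
      congr 1; push_cast; ring
    rw [e, ← mul_div_assoc, le_div_iff₀ (by positivity)]
    linarith
  have hI0 : I ≤ 0 := by
    have hlim : Tendsto (fun τ : ℝ => V * |B| * Real.exp (-(τ * (2 * (φ₂ - φ₁))))) atTop (𝓝 0) := by
      have : Tendsto (fun τ : ℝ => τ * (2 * (φ₂ - φ₁))) atTop atTop :=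
        tendsto_id.atTop_mul_const (by linarith)
      simpa using (Real.tendsto_exp_neg_atTop_nhds_zero.comp this).const_mul (V * |B|)
    have := ge_of_tendsto hlim ((eventually_ge_atTop _).mono hfin)
    by_contra! hIpos
    have : 0 < c / 2 * I := by positivity
    linarith
  have hIz : I = 0 := le_antisymm hI0 (integral_nonneg hg0)
  have hae : g =ᵐ[volume.restrict (Metric.ball q R)] fun _ => (0 : ℝ) :=
    (setIntegral_eq_zero_iff_of_nonneg_ae (Eventually.of_forall hg0) hgi).1 hIz
  have hgz : EqOn g (fun _ => 0) (Metric.ball q R) :=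
    Measure.eqOn_open_of_ae_eq hae Metric.isOpen_ball hgc.continuousOn continuousOn_const
  intro x hx i
  have h1 : ∑ i, w i x ^ 2 = 0 := hgz hx
  have h2 := (Finset.sum_eq_zero_iff_of_nonneg fun i _ => sq_nonneg (w i x)).1 h1 i
    (Finset.mem_univ i)
  rw [← (hwu x ((Metric.mem_ball.1 hx).trans hR1) i).eq_of_nhds]
  exact pow_eq_zero_iff (two_ne_zero) |>.1 h2

/-- Weak unique continuation at a point in the closure of the interior of the zero set. -/
theorem eventually_eq_zero_of_mem_closure {ι : Type*} [Fintype ι]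
    {U : Set (EuclideanSpace ℝ (Fin n))} (hU : IsOpen U)
    {a : Fin n → Fin n → EuclideanSpace ℝ (Fin n) → ℝ}
    (ha : ∀ k l, ContDiffOn ℝ ∞ (a k l) U) (hsymm : ∀ k l, ∀ x ∈ U, a k l x = a l k x)
    (hpos : ∀ x ∈ U, ∀ ξ : Fin n → ℝ, ξ ≠ 0 → 0 < ∑ k, ∑ l, a k l x * (ξ k * ξ l))
    {u : ι → EuclideanSpace ℝ (Fin n) → ℝ} (hu : ∀ i, ContDiffOn ℝ 2 (u i) U)
    {p : EuclideanSpace ℝ (Fin n)} (hp : p ∈ U) {C : ℝ}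
    (hineq : ∀ᶠ x in 𝓝 p, ∑ i, divOp a (u i) x ^ 2
      ≤ C * ∑ i, (u i x ^ 2 + ∑ k, pd k (u i) x ^ 2))
    (hcl : p ∈ closure {q | ∀ᶠ x in 𝓝 q, ∀ i, u i x = 0}) :
    ∀ᶠ x in 𝓝 p, ∀ i, u i x = 0 := by
  obtain ⟨δ, hδ, hball⟩ := Metric.eventually_nhds_iff_ball.1 (hineq.and (hU.mem_nhds hp))
  obtain ⟨q, hq, hqp⟩ := Metric.mem_closure_iff.1 hcl (δ / 8) (by positivity)
  obtain ⟨r, hr, hrz⟩ := Metric.eventually_nhds_iff_ball.1 hq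
  have hsub : Metric.closedBall q (δ / 2) ⊆ Metric.ball p δ := by
    intro x hx
    have := dist_triangle x q p
    rw [Metric.mem_closedBall] at hx
    rw [dist_comm] at hqp
    rw [Metric.mem_ball]; linarith
  have key := eq_zero_on_ball_of_eq_zero_near_center hU ha hsymm hpos hu hr
    (show δ / 4 < δ / 2 by linarith) (fun x hx => (hball x (hsub hx)).2)
    (fun x hx => (hball x (hsub (Metric.ball_subset_closedBall hx))).1) hrz
  filter_upwards [Metric.isOpen_ball.mem_nhds (show p ∈ Metric.ball q (δ / 4) by
    rw [Metric.mem_ball]; linarith)] with x hx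
  exact key x hx

end UniqueContinuation

/-! ### Elliptic div-curl systems -/

section DivCurl

variable {n : ℕ}

/-- A div-curl system on an open subset of `ℝⁿ` for the covector field `α`: its exterior derivative
is a pointwise linear function of `α`, and the vector field `A α` is divergence free, where `A` is
a symmetric positive definite matrix. -/
structure IsDivCurlSolution (U : Set (EuclideanSpace ℝ (Fin n)))
    (A : Fin n → Fin n → EuclideanSpace ℝ (Fin n) → ℝ)
    (c : Fin n → Fin n → Fin n → EuclideanSpace ℝ (Fin n) → ℝ)
    (α : Fin n → EuclideanSpace ℝ (Fin n) → ℝ) : Prop where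
  isOpen : IsOpen U
  smooth_A : ∀ k l, ContDiffOn ℝ ∞ (A k l) U
  symm_A : ∀ k l, ∀ x ∈ U, A k l x = A l k x
  pos_A : ∀ x ∈ U, ∀ ξ : Fin n → ℝ, ξ ≠ 0 → 0 < ∑ k, ∑ l, A k l x * (ξ k * ξ l)
  smooth_c : ∀ i j k, ContDiffOn ℝ ∞ (c i j k) U
  smooth_α : ∀ i, ContDiffOn ℝ ∞ (α i) U
  curl_eq : ∀ i j, ∀ x ∈ U, pd i (α j) x - pd j (α i) x = ∑ k, c i j k x * α k x
  div_eq : ∀ x ∈ U, ∑ k, pd k (fun y => ∑ l, A k l y * α l y) x = 0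

variable {U : Set (EuclideanSpace ℝ (Fin n))}
  {A : Fin n → Fin n → EuclideanSpace ℝ (Fin n) → ℝ}
  {c : Fin n → Fin n → Fin n → EuclideanSpace ℝ (Fin n) → ℝ}
  {α : Fin n → EuclideanSpace ℝ (Fin n) → ℝ}

theorem differentiableAt_of_contDiffOn_infty {f : EuclideanSpace ℝ (Fin n) → ℝ}
    {x : EuclideanSpace ℝ (Fin n)}
    (hU : IsOpen U) (hf : ContDiffOn ℝ ∞ f U) (hx : x ∈ U) : DifferentiableAt ℝ f x :=
  (hf.contDiffAt (hU.mem_nhds hx)).differentiableAt (by simp)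

/-- Each component of a solution of a div-curl system solves a scalar second order equation, up to
terms of first order in the system: the second order part of `div (A ∇αᵢ)` is `∂ᵢ (div (A α))`. -/
theorem IsDivCurlSolution.exists_divOp_eq (h : IsDivCurlSolution U A c α) :
    ∃ (P : Fin n → Fin n → EuclideanSpace ℝ (Fin n) → ℝ)
      (D : Fin n → Fin n → Fin n → EuclideanSpace ℝ (Fin n) → ℝ),
      (∀ i m, ContinuousOn (P i m) U) ∧ (∀ k i m, ContinuousOn (D k i m) U) ∧
      ∀ i, ∀ x ∈ U, divOp A (α i) x =
        ∑ m, (P i m x * α m x + ∑ k, D k i m x * pd k (α m) x) := by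
  have hU := h.isOpen
  set D : Fin n → Fin n → Fin n → EuclideanSpace ℝ (Fin n) → ℝ := fun k i m x =>
    (∑ l, A k l x * c l i m x) - pd i (A k m) x with hD
  have hDs : ∀ k i m, ContDiffOn ℝ ∞ (D k i m) U := fun k i m =>
    (ContDiffOn.sum fun l _ => (h.smooth_A k l).mul (h.smooth_c l i m)).sub
      (contDiffOn_pd hU i (h.smooth_A k m) (by simp))
  refine ⟨fun i m x => ∑ k, pd k (D k i m) x, D, fun i m => ?_,
    fun k i m => (hDs k i m).continuousOn, fun i x hx => ?_⟩
  · exact continuousOn_finsetSum _ fun k _ =>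
      (contDiffOn_pd (m' := ∞) hU k (hDs k i m) (by simp)).continuousOn
  have dA : ∀ k l, ∀ y ∈ U, DifferentiableAt ℝ (A k l) y := fun k l y hy =>
    differentiableAt_of_contDiffOn_infty hU (h.smooth_A k l) hy
  have dα : ∀ l, ∀ y ∈ U, DifferentiableAt ℝ (α l) y := fun l y hy =>
    differentiableAt_of_contDiffOn_infty hU (h.smooth_α l) hy
  have dD : ∀ k i m, ∀ y ∈ U, DifferentiableAt ℝ (D k i m) y := fun k i m y hy =>
    differentiableAt_of_contDiffOn_infty hU (hDs k i m) hy
  -- the curl equation interchanges the indices of `∂ₗαᵢ`, so that the flux of `αᵢ` is `∂ᵢ(A α)` up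
  -- to terms without derivatives
  set G : Fin n → EuclideanSpace ℝ (Fin n) → ℝ := fun k y => ∑ l, A k l y * α l y with hG
  have hGs : ∀ k, ContDiffOn ℝ ∞ (G k) U := fun k =>
    ContDiffOn.sum fun l _ => (h.smooth_A k l).mul (h.smooth_α l)
  have hflux : ∀ k, ∀ y ∈ U, flux A (α i) k y = pd i (G k) y + ∑ m, D k i m y * α m y := by
    intro k y hy
    have e1 : pd i (G k) y = ∑ l, (pd i (A k l) y * α l y + A k l y * pd i (α l) y) := by
      simp only [hG]
      rw [pd_sum _ _ fun l _ => (dA k l y hy).fun_mul (dα l y hy)]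
      exact Finset.sum_congr rfl fun l _ => pd_mul i (dA k l y hy) (dα l y hy)
    have e2 : ∀ l, pd l (α i) y = pd i (α l) y + ∑ m, c l i m y * α m y := fun l => by
      rw [← h.curl_eq l i y hy]; ring
    have e3 : ∑ m, (∑ l, A k l y * c l i m y) * α m y
        = ∑ l, A k l y * ∑ m, c l i m y * α m y := by
      simp only [Finset.sum_mul, Finset.mul_sum]
      rw [Finset.sum_comm]
      exact Finset.sum_congr rfl fun l _ => Finset.sum_congr rfl fun m _ => by ring
    simp only [flux, e1, e2, hD, sub_mul, Finset.sum_sub_distrib, e3, mul_add,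
      Finset.sum_add_distrib]
    ring
  have hev : ∀ k, flux A (α i) k =ᶠ[𝓝 x] fun y => pd i (G k) y + ∑ m, D k i m y * α m y :=
    fun k => by filter_upwards [hU.mem_nhds hx] with y hy using hflux k y hy
  have hpG : ∀ k, DifferentiableAt ℝ (pd i (G k)) x := fun k =>
    differentiableAt_of_contDiffOn_infty hU (contDiffOn_pd (m' := ∞) hU i (hGs k) (by simp)) hx
  have hpk : ∀ k, pd k (flux A (α i) k) x = pd i (pd k (G k)) x
      + ∑ m, (pd k (D k i m) x * α m x + D k i m x * pd k (α m) x) := by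
    intro k
    have dDα : ∀ m, DifferentiableAt ℝ (fun y => D k i m y * α m y) x := fun m =>
      (dD k i m x hx).fun_mul (dα m x hx)
    rw [pd_eq_of_eventuallyEq k (hev k),
      pd_add k (hpG k) (DifferentiableAt.fun_sum fun m _ => dDα m),
      pd_pd_comm k i ((contDiffOn_infty.1 (hGs k) 2).contDiffAt (hU.mem_nhds hx)),
      pd_sum _ _ fun m _ => dDα m]
    congr 1
    exact Finset.sum_congr rfl fun m _ => pd_mul k (dD k i m x hx) (dα m x hx)
  have hzero : ∑ k, pd i (pd k (G k)) x = 0 := by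
    rw [← pd_sum _ _ fun k _ => differentiableAt_of_contDiffOn_infty hU
      (contDiffOn_pd (m' := ∞) hU k (hGs k) (by simp)) hx]
    have : (fun y => ∑ k, pd k (G k) y) =ᶠ[𝓝 x] fun _ => 0 := by
      filter_upwards [hU.mem_nhds hx] with y hy using h.div_eq y hy
    rw [pd_eq_of_eventuallyEq i this]
    simp [pd]
  simp only [divOp, hpk]
  rw [Finset.sum_add_distrib, hzero, zero_add, Finset.sum_comm]
  refine Finset.sum_congr rfl fun m _ => ?_
  rw [Finset.sum_add_distrib, Finset.sum_mul]

/-- On compact sets the components of a solution satisfy the differential inequality of the unique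
continuation theorem, with a common principal part. -/
theorem IsDivCurlSolution.exists_differential_inequality (h : IsDivCurlSolution U A c α)
    {K : Set (EuclideanSpace ℝ (Fin n))} (hK : IsCompact K) (hKU : K ⊆ U) :
    ∃ C, 0 ≤ C ∧ ∀ x ∈ K, ∑ i, divOp A (α i) x ^ 2
      ≤ C * ∑ i, (α i x ^ 2 + ∑ k, pd k (α i) x ^ 2) := by
  obtain ⟨P, D, hP, hD, heq⟩ := h.exists_divOp_eq
  obtain ⟨B, hB⟩ : ∃ B, ∀ x ∈ K, ‖∑ i, ∑ m, (P i m x ^ 2 + ∑ k, D k i m x ^ 2)‖ ≤ B := by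
    refine hK.exists_bound_of_continuousOn (ContinuousOn.mono ?_ hKU)
    exact continuousOn_finsetSum _ fun i _ => continuousOn_finsetSum _ fun m _ =>
      ((hP i m).pow 2).add (continuousOn_finsetSum _ fun k _ => (hD k i m).pow 2)
  refine ⟨|B|, abs_nonneg B, fun x hx => ?_⟩
  have h1 : ∀ i, divOp A (α i) x ^ 2 ≤ (∑ m, (P i m x ^ 2 + ∑ k, D k i m x ^ 2))
      * ∑ m, (α m x ^ 2 + ∑ k, pd k (α m) x ^ 2) := by
    intro i
    rw [heq i x (hKU hx)]
    -- Cauchy–Schwarz over the index set `Fin n × Option (Fin n)`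
    have hcs := Finset.sum_mul_sq_le_sq_mul_sq (Finset.univ : Finset (Fin n × Option (Fin n)))
      (fun z => z.2.elim (P i z.1 x) fun k => D k i z.1 x)
      (fun z => z.2.elim (α z.1 x) fun k => pd k (α z.1) x)
    simpa [Fintype.sum_prod_type, Fintype.sum_option] using hcs
  calc ∑ i, divOp A (α i) x ^ 2
      ≤ ∑ i, (∑ m, (P i m x ^ 2 + ∑ k, D k i m x ^ 2))
          * ∑ m, (α m x ^ 2 + ∑ k, pd k (α m) x ^ 2) := Finset.sum_le_sum fun i _ => h1 i
    _ = (∑ i, ∑ m, (P i m x ^ 2 + ∑ k, D k i m x ^ 2))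
          * ∑ m, (α m x ^ 2 + ∑ k, pd k (α m) x ^ 2) := by rw [Finset.sum_mul]
    _ ≤ |B| * ∑ m, (α m x ^ 2 + ∑ k, pd k (α m) x ^ 2) := by
        gcongr
        exact ((le_abs_self _).trans (hB x hx)).trans (le_abs_self B)

/-- Unique continuation for div-curl systems. -/
theorem IsDivCurlSolution.eventually_eq_zero_of_mem_closure (h : IsDivCurlSolution U A c α)
    {p : EuclideanSpace ℝ (Fin n)} (hp : p ∈ U)
    (hcl : p ∈ closure {q | ∀ᶠ x in 𝓝 q, ∀ i, α i x = 0}) :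
    ∀ᶠ x in 𝓝 p, ∀ i, α i x = 0 := by
  obtain ⟨K, hKp, hKU, hK⟩ := local_compact_nhds (h.isOpen.mem_nhds hp)
  obtain ⟨C, -, hC⟩ := h.exists_differential_inequality hK hKU
  refine BeltramiSurface.eventually_eq_zero_of_mem_closure h.isOpen h.smooth_A h.symm_A h.pos_A
    (fun i => contDiffOn_infty.1 (h.smooth_α i) 2) hp (C := C) ?_ hcl
  filter_upwards [hKp] with x hx using hC x hx

/-! ### Vanishing of a solution on a hypersurface -/

/-- A function vanishing on a regular hypersurface has derivative proportional to that of the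
defining function. -/
theorem exists_pd_eq_mul_pd {ρ f : EuclideanSpace ℝ (Fin n) → ℝ} {x : EuclideanSpace ℝ (Fin n)}
    (hρ : ContDiffAt ℝ 1 ρ x) (hf : ContDiffAt ℝ 1 f x) (hx : ρ x = 0)
    (hρ' : ∃ k, pd k ρ x ≠ 0) (hz : ∀ᶠ y in 𝓝 x, ρ y = 0 → f y = 0) :
    ∃ t : ℝ, ∀ k, pd k f x = t * pd k ρ x := by
  have hext : IsLocalExtrOn f {y | ρ y = ρ x} x := by
    left
    have hfx : f x = 0 := hz.self_of_nhds hx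
    refine eventually_nhdsWithin_iff.2 ?_
    filter_upwards [hz] with y hy hyρ
    rw [hfx, hy (hyρ.trans hx)]
  obtain ⟨s, t, hst, heq⟩ := hext.exists_multipliers_of_hasStrictFDerivAt_1d
    (hρ.hasStrictFDerivAt (by norm_num)) (hf.hasStrictFDerivAt (by norm_num))
  have hk : ∀ k, s * pd k ρ x + t * pd k f x = 0 := fun k => by
    simpa [pd] using congrArg (fun L => L (EuclideanSpace.single k (1 : ℝ))) heq
  have ht : t ≠ 0 := by
    rintro rfl
    obtain ⟨k, hk'⟩ := hρ'
    have := hk k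
    simp only [zero_mul, add_zero, mul_eq_zero, hk', or_false] at this
    simp [this] at hst
  refine ⟨-s / t, fun k => ?_⟩
  have := hk k
  field_simp
  linarith

/-- The overdetermined symbol of a div-curl system is injective: a covector that is proportional to
`ξ ≠ 0` and orthogonal to it for a positive definite form is zero. -/
theorem eq_zero_of_mul_symm_of_sum_eq_zero {B : Fin n → Fin n → ℝ}
    (hB : ∀ ξ : Fin n → ℝ, ξ ≠ 0 → 0 < ∑ k, ∑ l, B k l * (ξ k * ξ l))
    {ξ μ : Fin n → ℝ} (hξ : ξ ≠ 0) (hs : ∀ k l, μ k * ξ l = μ l * ξ k)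
    (h0 : ∑ k, ∑ l, B k l * (ξ k * μ l) = 0) : μ = 0 := by
  obtain ⟨k₀, hk₀⟩ := Function.ne_iff.1 hξ
  have hk₀ : ξ k₀ ≠ 0 := hk₀
  have hμ : ∀ l, μ l = (μ k₀ / ξ k₀) * ξ l := fun l => by
    have := hs k₀ l
    field_simp
    linarith
  have h1 : (μ k₀ / ξ k₀) * ∑ k, ∑ l, B k l * (ξ k * ξ l) = 0 := by
    rw [← h0, Finset.mul_sum]
    refine Finset.sum_congr rfl fun k _ => ?_
    rw [Finset.mul_sum]
    exact Finset.sum_congr rfl fun l _ => by rw [hμ l]; ring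
  have h2 : μ k₀ / ξ k₀ = 0 := (mul_eq_zero.1 h1).resolve_right (hB ξ hξ).ne'
  ext l
  simp [hμ l, h2]

variable {ρ : EuclideanSpace ℝ (Fin n) → ℝ}

/-- If `α = 0` on `{ρ = 0}`, then `∂ₖαᵢ = μᵢ ∂ₖρ` there; the curl equation makes `μ` parallel to `∇ρ`
and the divergence equation makes it orthogonal to `∇ρ`, so `μ = 0`. -/
theorem IsDivCurlSolution.pd_eq_zero_of_eq_zero_on_hypersurface (h : IsDivCurlSolution U A c α)
    (hρ : ContDiffOn ℝ ∞ ρ U) (hρ' : ∀ x ∈ U, ρ x = 0 → ∃ k, pd k ρ x ≠ 0)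
    (hz : ∀ x ∈ U, ρ x = 0 → ∀ i, α i x = 0) {x : EuclideanSpace ℝ (Fin n)} (hx : x ∈ U)
    (hxρ : ρ x = 0) (i k : Fin n) : pd k (α i) x = 0 := by
  have hU := h.isOpen
  have dA : ∀ k l, DifferentiableAt ℝ (A k l) x := fun k l =>
    differentiableAt_of_contDiffOn_infty hU (h.smooth_A k l) hx
  have dα : ∀ l, DifferentiableAt ℝ (α l) x := fun l =>
    differentiableAt_of_contDiffOn_infty hU (h.smooth_α l) hx
  have hα0 : ∀ i, α i x = 0 := hz x hx hxρ
  have h1 : ∀ i, ∃ t : ℝ, ∀ k, pd k (α i) x = t * pd k ρ x := fun i =>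
    exists_pd_eq_mul_pd ((contDiffOn_infty.1 hρ 1).contDiffAt (hU.mem_nhds hx))
      ((contDiffOn_infty.1 (h.smooth_α i) 1).contDiffAt (hU.mem_nhds hx)) hxρ (hρ' x hx hxρ)
      (by filter_upwards [hU.mem_nhds hx] with y hy using fun h0 => hz y hy h0 i)
  choose μ hμ using h1
  have hμ0 : μ = 0 := by
    refine eq_zero_of_mul_symm_of_sum_eq_zero (h.pos_A x hx) (ξ := fun k => pd k ρ x) ?_ ?_ ?_
    · obtain ⟨k, hk⟩ := hρ' x hx hxρ
      exact fun h0 => hk (congrFun h0 k)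
    · intro k l
      have := h.curl_eq k l x hx
      simp only [hα0, mul_zero, Finset.sum_const_zero, hμ] at this
      linarith
    · rw [← h.div_eq x hx]
      refine Finset.sum_congr rfl fun k _ => ?_
      rw [pd_sum _ _ fun l _ => (dA k l).fun_mul (dα l)]
      refine Finset.sum_congr rfl fun l _ => ?_
      rw [pd_mul k (dA k l) (dα l), hα0 l, hμ]
      ring
  simp [hμ, hμ0]

theorem IsDivCurlSolution.divOp_eq_zero_of_eq_zero_on_hypersurface (h : IsDivCurlSolution U A c α)
    (hρ : ContDiffOn ℝ ∞ ρ U) (hρ' : ∀ x ∈ U, ρ x = 0 → ∃ k, pd k ρ x ≠ 0)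
    (hz : ∀ x ∈ U, ρ x = 0 → ∀ i, α i x = 0) {x : EuclideanSpace ℝ (Fin n)} (hx : x ∈ U)
    (hxρ : ρ x = 0) (i : Fin n) : divOp A (α i) x = 0 := by
  obtain ⟨P, D, -, -, heq⟩ := h.exists_divOp_eq
  rw [heq i x hx]
  simp [hz x hx hxρ, h.pd_eq_zero_of_eq_zero_on_hypersurface hρ hρ' hz hx hxρ]

/-- The gradient of `αᵢ` vanishes on `{ρ = 0}`, so `∂ₗ∂ₖαᵢ = μₖ ∂ₗρ` there; the symmetry of second
derivatives makes `μ` parallel to `∇ρ` and the equation `div (A ∇αᵢ) = 0` makes it orthogonal. -/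
theorem IsDivCurlSolution.pd_pd_eq_zero_of_eq_zero_on_hypersurface
    (h : IsDivCurlSolution U A c α)
    (hρ : ContDiffOn ℝ ∞ ρ U) (hρ' : ∀ x ∈ U, ρ x = 0 → ∃ k, pd k ρ x ≠ 0)
    (hz : ∀ x ∈ U, ρ x = 0 → ∀ i, α i x = 0) {x : EuclideanSpace ℝ (Fin n)} (hx : x ∈ U)
    (hxρ : ρ x = 0) (i k l : Fin n) : pd l (pd k (α i)) x = 0 := by
  have hU := h.isOpen
  have hpα : ∀ k, ContDiffOn ℝ ∞ (pd k (α i)) U := fun k =>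
    contDiffOn_pd hU k (h.smooth_α i) (by simp)
  have dA : ∀ k l, DifferentiableAt ℝ (A k l) x := fun k l =>
    differentiableAt_of_contDiffOn_infty hU (h.smooth_A k l) hx
  have dα : ∀ l, DifferentiableAt ℝ (pd l (α i)) x := fun l =>
    differentiableAt_of_contDiffOn_infty hU (hpα l) hx
  have hp0 : ∀ y ∈ U, ρ y = 0 → ∀ k, pd k (α i) y = 0 := fun y hy hy0 k =>
    h.pd_eq_zero_of_eq_zero_on_hypersurface hρ hρ' hz hy hy0 i k
  have h1 : ∀ k, ∃ t : ℝ, ∀ l, pd l (pd k (α i)) x = t * pd l ρ x := fun k =>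
    exists_pd_eq_mul_pd ((contDiffOn_infty.1 hρ 1).contDiffAt (hU.mem_nhds hx))
      ((contDiffOn_infty.1 (hpα k) 1).contDiffAt (hU.mem_nhds hx)) hxρ (hρ' x hx hxρ)
      (by filter_upwards [hU.mem_nhds hx] with y hy using fun h0 => hp0 y hy h0 k)
  choose μ hμ using h1
  have hμ0 : μ = 0 := by
    refine eq_zero_of_mul_symm_of_sum_eq_zero (h.pos_A x hx) (ξ := fun k => pd k ρ x) ?_ ?_ ?_
    · obtain ⟨k, hk⟩ := hρ' x hx hxρ
      exact fun h0 => hk (congrFun h0 k)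
    · intro k l
      rw [← hμ, ← hμ]
      exact pd_pd_comm l k ((contDiffOn_infty.1 (h.smooth_α i) 2).contDiffAt (hU.mem_nhds hx))
    · rw [← h.divOp_eq_zero_of_eq_zero_on_hypersurface hρ hρ' hz hx hxρ i]
      refine Finset.sum_congr rfl fun k _ => ?_
      unfold flux
      rw [pd_sum _ _ fun l _ => (dA k l).fun_mul (dα l)]
      refine Finset.sum_congr rfl fun l _ => ?_
      rw [pd_mul k (dA k l) (dα l), hp0 x hx hxρ, hμ]
      ring
  simp [hμ, hμ0]

theorem fderiv_eq_zero_of_pd_eq_zero {f : EuclideanSpace ℝ (Fin n) → ℝ}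
    {x : EuclideanSpace ℝ (Fin n)} (h : ∀ k, pd k f x = 0) : fderiv ℝ f x = 0 := by
  ext v
  simp [fderiv_apply_eq_sum_pd, h]

open Classical in
/-- Extension by zero from `{0 < ρ}` preserves differentiability when the function and its derivative
vanish on `{ρ = 0}`. -/
theorem hasFDerivAt_indicator_pos {F : Type*} [NormedAddCommGroup F] [NormedSpace ℝ F]
    (hU : IsOpen U) (hρ : ContinuousOn ρ U) {f : EuclideanSpace ℝ (Fin n) → F}
    {x : EuclideanSpace ℝ (Fin n)} (hx : x ∈ U) (hf : DifferentiableAt ℝ f x)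
    (h0 : ρ x = 0 → f x = 0) (h1 : ρ x = 0 → fderiv ℝ f x = 0) :
    HasFDerivAt ({y | 0 < ρ y}.indicator f) ({y | 0 < ρ y}.indicator (fderiv ℝ f) x) x := by
  have hρx := hρ.continuousAt (hU.mem_nhds hx)
  rcases lt_trichotomy (ρ x) 0 with hlt | heq | hgt
  · rw [indicator_of_notMem (by simp [hlt.le])]
    refine (hasFDerivAt_const (0 : F) x).congr_of_eventuallyEq ?_
    filter_upwards [hρx.eventually (gt_mem_nhds hlt)] with y hy
    exact indicator_of_notMem (by simp [hy.le]) _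
  · rw [indicator_of_notMem (by simp [heq])]
    have hd := hf.hasFDerivAt
    rw [h1 heq, hasFDerivAt_iff_isLittleO_nhds_zero] at hd
    rw [hasFDerivAt_iff_isLittleO_nhds_zero]
    refine Asymptotics.IsBigO.trans_isLittleO (Asymptotics.isBigO_of_le _ fun y => ?_) hd
    simp only [h0 heq, indicator, zero_apply, sub_zero, mem_ofPred_eq, ite_self]
    split_ifs <;> simp
  · rw [indicator_of_mem (by simpa using hgt)]
    refine hf.hasFDerivAt.congr_of_eventuallyEq ?_
    filter_upwards [hρx.eventually (lt_mem_nhds hgt)] with y hy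
    exact indicator_of_mem (by simpa using hy) _

theorem continuousOn_indicator_pos {F : Type*} [NormedAddCommGroup F]
    (hU : IsOpen U) (hρ : ContinuousOn ρ U) {f : EuclideanSpace ℝ (Fin n) → F}
    (hf : ContinuousOn f U) (h0 : ∀ x ∈ U, ρ x = 0 → f x = 0) :
    ContinuousOn ({y | 0 < ρ y}.indicator f) U := by
  intro x hx
  refine ContinuousAt.continuousWithinAt ?_
  have hρx := hρ.continuousAt (hU.mem_nhds hx)
  have hfx := hf.continuousAt (hU.mem_nhds hx)
  rcases lt_trichotomy (ρ x) 0 with hlt | heq | hgt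
  · refine (continuousAt_const (y := (0 : F))).congr ?_
    filter_upwards [hρx.eventually (gt_mem_nhds hlt)] with y hy
    exact (indicator_of_notMem (by simp [hy.le]) _).symm
  · have hx0 : {y | 0 < ρ y}.indicator f x = 0 := indicator_of_notMem (by simp [heq]) _
    rw [ContinuousAt, hx0]
    rw [ContinuousAt, h0 x hx heq] at hfx
    refine squeeze_zero_norm (fun y => ?_) (tendsto_zero_iff_norm_tendsto_zero.1 hfx)
    exact norm_indicator_le_norm_self _ _
  · refine hfx.congr ?_
    filter_upwards [hρx.eventually (lt_mem_nhds hgt)] with y hy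
    exact (indicator_of_mem (by simpa using hy) _).symm

theorem contDiffOn_succ_indicator_pos {F : Type*} [NormedAddCommGroup F] [NormedSpace ℝ F] {m : ℕ}
    (hU : IsOpen U) (hρ : ContinuousOn ρ U) {f : EuclideanSpace ℝ (Fin n) → F}
    (hf : ∀ x ∈ U, DifferentiableAt ℝ f x)
    (h0 : ∀ x ∈ U, ρ x = 0 → f x = 0) (h1 : ∀ x ∈ U, ρ x = 0 → fderiv ℝ f x = 0)
    (hind : ContDiffOn ℝ m ({y | 0 < ρ y}.indicator (fderiv ℝ f)) U) :
    ContDiffOn ℝ (m + 1) ({y | 0 < ρ y}.indicator f) U := by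
  have hd : ∀ x ∈ U, HasFDerivAt ({y | 0 < ρ y}.indicator f)
      ({y | 0 < ρ y}.indicator (fderiv ℝ f) x) x := fun x hx =>
    hasFDerivAt_indicator_pos hU hρ hx (hf x hx) (h0 x hx) (h1 x hx)
  rw [contDiffOn_succ_iff_fderiv_of_isOpen hU]
  exact ⟨fun x hx => (hd x hx).differentiableAt.differentiableWithinAt, by simp,
    hind.congr fun x hx => (hd x hx).fderiv⟩

theorem pd_indicator_pos (hU : IsOpen U) (hρ : ContinuousOn ρ U)
    {f : EuclideanSpace ℝ (Fin n) → ℝ}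
    {x : EuclideanSpace ℝ (Fin n)} (hx : x ∈ U) (hf : DifferentiableAt ℝ f x)
    (h0 : ρ x = 0 → f x = 0) (h1 : ρ x = 0 → ∀ k, pd k f x = 0) (k : Fin n) :
    pd k ({y | 0 < ρ y}.indicator f) x = {y | 0 < ρ y}.indicator (pd k f) x := by
  rw [pd, (hasFDerivAt_indicator_pos hU hρ hx hf h0
    fun h => fderiv_eq_zero_of_pd_eq_zero (h1 h)).fderiv]
  by_cases h : 0 < ρ x <;> simp [indicator, h, pd]

/-- A solution of a div-curl system vanishing on a regular hypersurface `{ρ = 0}` vanishes near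
it on the side `{ρ > 0}`: all its derivatives up to order two vanish on the hypersurface, so its
extension by zero to the other side is of class `C²`, satisfies the same differential inequality,
and vanishes on an open set. -/
theorem IsDivCurlSolution.eventually_eq_zero_of_pos_side (h : IsDivCurlSolution U A c α)
    (hρ : ContDiffOn ℝ ∞ ρ U) (hρ' : ∀ x ∈ U, ρ x = 0 → ∃ k, pd k ρ x ≠ 0)
    (hz : ∀ x ∈ U, ρ x = 0 → ∀ i, α i x = 0) {p : EuclideanSpace ℝ (Fin n)} (hp : p ∈ U)
    (hpρ : ρ p = 0) : ∀ᶠ x in 𝓝 p, 0 < ρ x → ∀ i, α i x = 0 := by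
  have hU := h.isOpen
  have hρc := hρ.continuousOn
  have h1 := fun {x} (hx : x ∈ U) (hxρ : ρ x = 0) (i k : Fin n) =>
    h.pd_eq_zero_of_eq_zero_on_hypersurface hρ hρ' hz hx hxρ i k
  have h2 := fun {x} (hx : x ∈ U) (hxρ : ρ x = 0) (i k l : Fin n) =>
    h.pd_pd_eq_zero_of_eq_zero_on_hypersurface hρ hρ' hz hx hxρ i k l
  have hpα : ∀ i k, ContDiffOn ℝ ∞ (pd k (α i)) U := fun i k =>
    contDiffOn_pd hU k (h.smooth_α i) (by simp)
  have dα : ∀ i, ∀ x ∈ U, DifferentiableAt ℝ (α i) x := fun i x hx =>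
    differentiableAt_of_contDiffOn_infty hU (h.smooth_α i) hx
  have dpα : ∀ i k, ∀ x ∈ U, DifferentiableAt ℝ (pd k (α i)) x := fun i k x hx =>
    differentiableAt_of_contDiffOn_infty hU (hpα i k) hx
  have hf1 : ∀ i, ContDiffOn ℝ 1 (fderiv ℝ (α i)) U := fun i =>
    (contDiffOn_infty.1 (h.smooth_α i) 2).fderiv_of_isOpen hU (by norm_num)
  have hf2 : ∀ i, ∀ x ∈ U, ρ x = 0 → fderiv ℝ (fderiv ℝ (α i)) x = 0 := by
    intro i x hx hxρ
    have hd : DifferentiableAt ℝ (fderiv ℝ (α i)) x :=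
      ((hf1 i).contDiffAt (hU.mem_nhds hx)).differentiableAt (by norm_num)
    have hflip : (fderiv ℝ (fderiv ℝ (α i)) x).flip = 0 := by
      ext v w
      have : ∀ k w, fderiv ℝ (fderiv ℝ (α i)) x w (EuclideanSpace.single k 1) = 0 := by
        intro k w
        have e : fderiv ℝ (pd k (α i)) x = 0 :=
          fderiv_eq_zero_of_pd_eq_zero fun l => h2 hx hxρ i k l
        have e2 := ((ContinuousLinearMap.apply ℝ ℝ
          (EuclideanSpace.single k (1 : ℝ))).hasFDerivAt.comp x hd.hasFDerivAt).fderiv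
        have e3 : (⇑(ContinuousLinearMap.apply ℝ ℝ (EuclideanSpace.single k (1 : ℝ)))
          ∘ fderiv ℝ (α i)) = pd k (α i) := rfl
        rw [e3, e] at e2
        simpa using (congrArg (fun L => L w) e2).symm
      conv_lhs => rw [← (EuclideanSpace.basisFun (Fin n) ℝ).sum_repr v]
      simp [this]
    ext v w
    simpa using congrArg (fun L => L w v) hflip
  set S : Set (EuclideanSpace ℝ (Fin n)) := {y | 0 < ρ y} with hS
  set u : Fin n → EuclideanSpace ℝ (Fin n) → ℝ := fun i => S.indicator (α i) with hu
  have hdf : ∀ i, ∀ x ∈ U, DifferentiableAt ℝ (fderiv ℝ (α i)) x := fun i x hx =>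
    ((hf1 i).contDiffAt (hU.mem_nhds hx)).differentiableAt (by norm_num)
  have hfz : ∀ i, ∀ x ∈ U, ρ x = 0 → fderiv ℝ (α i) x = 0 := fun i x hx h0 =>
    fderiv_eq_zero_of_pd_eq_zero fun k => h1 hx h0 i k
  have hu2 : ∀ i, ContDiffOn ℝ 2 (u i) U := by
    intro i
    have hc2 : ContinuousOn (S.indicator (fderiv ℝ (fderiv ℝ (α i)))) U :=
      continuousOn_indicator_pos hU hρc ((hf1 i).continuousOn_fderiv_of_isOpen hU (by norm_num))
        (hf2 i)
    have hc1 := contDiffOn_succ_indicator_pos (m := 0) hU hρc (hdf i) (hfz i) (hf2 i)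
      (contDiffOn_zero.2 hc2)
    have hc0 := contDiffOn_succ_indicator_pos (m := 1) hU hρc (dα i)
      (fun x hx h0 => hz x hx h0 i) (hfz i) (by simpa using hc1)
    rwa [show ((1 : ℕ) : ℕ∞ω) + 1 = 2 by norm_num] at hc0
  have hpu : ∀ i k, ∀ x ∈ U, pd k (u i) x = S.indicator (pd k (α i)) x := fun i k x hx =>
    pd_indicator_pos hU hρc hx (dα i x hx) (fun h0 => hz x hx h0 i) (fun h0 k => h1 hx h0 i k) k
  have hLu : ∀ i, ∀ x ∈ U, divOp A (u i) x = S.indicator (divOp A (α i)) x := by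
    intro i x hx
    have dA : ∀ k l, DifferentiableAt ℝ (A k l) x := fun k l =>
      differentiableAt_of_contDiffOn_infty hU (h.smooth_A k l) hx
    have e1 : ∀ k, flux A (u i) k =ᶠ[𝓝 x] S.indicator (flux A (α i) k) := by
      intro k
      filter_upwards [hU.mem_nhds hx] with y hy
      simp only [flux, hpu i _ y hy]
      by_cases hyS : y ∈ S <;> simp [hyS, flux]
    have dfl : ∀ k, DifferentiableAt ℝ (flux A (α i) k) x := fun k =>
      DifferentiableAt.fun_sum fun l _ => (dA k l).fun_mul (dpα i l x hx)
    have hfl0 : ρ x = 0 → ∀ k, flux A (α i) k x = 0 := fun h0 k => by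
      simp [flux, h1 hx h0]
    have hpfl0 : ρ x = 0 → ∀ k m, pd m (flux A (α i) k) x = 0 := by
      intro h0 k m
      unfold flux
      rw [pd_sum _ _ fun l _ => (dA k l).fun_mul (dpα i l x hx)]
      refine Finset.sum_eq_zero fun l _ => ?_
      rw [pd_mul m (dA k l) (dpα i l x hx), h1 hx h0, h2 hx h0]
      ring
    have e2 : ∀ k, pd k (flux A (u i) k) x = S.indicator (pd k (flux A (α i) k)) x := fun k => by
      rw [pd_eq_of_eventuallyEq k (e1 k)]
      exact pd_indicator_pos hU hρc hx (dfl k) (fun h0 => hfl0 h0 k) (fun h0 => hpfl0 h0 k) k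
    simp only [divOp, e2]
    by_cases hxS : x ∈ S <;> simp [hxS, divOp]
  -- the complementary side accumulates at `p`, since the derivative of `ρ` does not vanish there
  have hcl : p ∈ closure {q | ∀ᶠ x in 𝓝 q, ∀ i, u i x = 0} := by
    have hneg : ∃ᶠ q in 𝓝 p, ρ q < 0 := by
      intro hcon
      have hmin : IsLocalMin ρ p := by
        filter_upwards [hcon] with y hy
        rw [hpρ]; exact not_lt.1 hy
      obtain ⟨k, hk⟩ := hρ' p hp hpρ
      exact hk (by simp [pd, hmin.fderiv_eq_zero])
    refine mem_closure_iff_frequently.2 ((hneg.and_eventually (hU.mem_nhds hp)).mono ?_)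
    rintro q ⟨hq, hqU⟩
    filter_upwards [(hρc.continuousAt (hU.mem_nhds hqU)).eventually (gt_mem_nhds hq)] with y hy i
    exact indicator_of_notMem (by simp [hS, hy.le]) _
  obtain ⟨K, hKp, hKU, hK⟩ := local_compact_nhds (hU.mem_nhds hp)
  obtain ⟨C, hC0, hC⟩ := h.exists_differential_inequality hK hKU
  have key := BeltramiSurface.eventually_eq_zero_of_mem_closure hU h.smooth_A h.symm_A h.pos_A
    hu2 hp (C := C) (by
      filter_upwards [hKp] with x hx
      have hux : ∀ i, u i x = S.indicator (α i) x := fun _ => rfl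
      simp only [hLu _ x (hKU hx), hpu _ _ x (hKU hx), hux]
      by_cases hxS : x ∈ S
      · simpa [hxS] using hC x hx
      · simp [hxS]) hcl
  filter_upwards [key] with x hx hxS i
  exact (indicator_of_mem (show x ∈ S from hxS) (α i)).symm.trans (hx i)

/-- A solution of a div-curl system vanishing on a regular hypersurface vanishes near it. -/
theorem IsDivCurlSolution.eventually_eq_zero_of_eq_zero_on_hypersurface
    (h : IsDivCurlSolution U A c α)
    (hρ : ContDiffOn ℝ ∞ ρ U) (hρ' : ∀ x ∈ U, ρ x = 0 → ∃ k, pd k ρ x ≠ 0)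
    (hz : ∀ x ∈ U, ρ x = 0 → ∀ i, α i x = 0) {p : EuclideanSpace ℝ (Fin n)} (hp : p ∈ U)
    (hpρ : ρ p = 0) : ∀ᶠ x in 𝓝 p, ∀ i, α i x = 0 := by
  have hneg := h.eventually_eq_zero_of_pos_side (ρ := fun x => -ρ x) hρ.neg
    (fun x hx h0 => by
      obtain ⟨k, hk⟩ := hρ' x hx (neg_eq_zero.1 h0)
      exact ⟨k, by rwa [pd_neg, neg_ne_zero]⟩)
    (fun x hx h0 => hz x hx (neg_eq_zero.1 h0)) hp (by simp [hpρ])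
  filter_upwards [h.eventually_eq_zero_of_pos_side hρ hρ' hz hp hpρ, hneg,
    h.isOpen.mem_nhds hp] with x hx1 hx2 hxU
  rcases lt_trichotomy (ρ x) 0 with hlt | heq | hgt
  · exact hx2 (by linarith)
  · exact hz x hxU heq
  · exact hx1 hgt

end DivCurl

/-! ### Coordinate frames -/

section Frames

variable {n : ℕ} {M : Type*} [TopologicalSpace M] [ChartedSpace (EuclideanSpace ℝ (Fin n)) M]

/-- The `k`-th coordinate vector field of the preferred chart at `p₀`, at the point with
coordinates `x`. -/
noncomputable def chartFrame (p₀ : M) (k : Fin n) (x : EuclideanSpace ℝ (Fin n)) :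
    TangentSpace (𝓡 n) ((extChartAt (𝓡 n) p₀).symm x) :=
  mfderiv 𝓘(ℝ, EuclideanSpace ℝ (Fin n)) (𝓡 n) (extChartAt (𝓡 n) p₀).symm x
    (EuclideanSpace.single k (1 : ℝ))

theorem isOpen_extChartAt_target_euclidean (p₀ : M) : IsOpen (extChartAt (𝓡 n) p₀).target :=
  isOpen_extChartAt_target p₀

variable [IsManifold (𝓡 n) ∞ M]

theorem contMDiffOn_chartFrame (p₀ : M) (k : Fin n) :
    ContMDiffOn 𝓘(ℝ, EuclideanSpace ℝ (Fin n)) (𝓡 n).tangent ∞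
      (fun x => (⟨(extChartAt (𝓡 n) p₀).symm x, chartFrame p₀ k x⟩ : TangentBundle (𝓡 n) M))
      (extChartAt (𝓡 n) p₀).target := by
  have hT := isOpen_extChartAt_target_euclidean (n := n) p₀
  have h1 := (contMDiffOn_extChartAt_symm (I := 𝓡 n) (n := ∞) p₀).contMDiffOn_tangentMapWithin
    (m := ∞) (by simp) hT.uniqueMDiffOn
  have h2 : ContMDiff 𝓘(ℝ, EuclideanSpace ℝ (Fin n)) 𝓘(ℝ, EuclideanSpace ℝ (Fin n)).tangent ∞
      (fun x => (⟨x, EuclideanSpace.single k (1 : ℝ)⟩ :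
        TangentBundle 𝓘(ℝ, EuclideanSpace ℝ (Fin n)) (EuclideanSpace ℝ (Fin n)))) := by
    exact contMDiff_vectorSpace_iff_contDiff.2 contDiff_const
  refine (h1.comp (s := (extChartAt (𝓡 n) p₀).target) h2.contMDiffOn
    (fun x hx => hx)).congr ?_
  intro x hx
  simp only [Function.comp, tangentMapWithin, chartFrame]
  rw [mfderivWithin_of_isOpen hT hx]

theorem hasInverse_chart_mfderiv (p₀ : M) {x : EuclideanSpace ℝ (Fin n)}
    (hx : x ∈ (extChartAt (𝓡 n) p₀).target) :
    (mfderiv (𝓡 n) 𝓘(ℝ, EuclideanSpace ℝ (Fin n)) (extChartAt (𝓡 n) p₀)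
        ((extChartAt (𝓡 n) p₀).symm x)) ∘L
      (mfderiv 𝓘(ℝ, EuclideanSpace ℝ (Fin n)) (𝓡 n) (extChartAt (𝓡 n) p₀).symm x)
        = ContinuousLinearMap.id _ _ ∧
    (mfderiv 𝓘(ℝ, EuclideanSpace ℝ (Fin n)) (𝓡 n) (extChartAt (𝓡 n) p₀).symm x) ∘L
      (mfderiv (𝓡 n) 𝓘(ℝ, EuclideanSpace ℝ (Fin n)) (extChartAt (𝓡 n) p₀)
        ((extChartAt (𝓡 n) p₀).symm x)) = ContinuousLinearMap.id _ _ := by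
  have h1 := mfderiv_extChartAt_comp_mfderivWithin_extChartAt_symm (I := 𝓡 n) hx
  have h2 := mfderivWithin_extChartAt_symm_comp_mfderiv_extChartAt (I := 𝓡 n) hx
  rw [ModelWithCorners.range_eq_univ, mfderivWithin_univ] at h1 h2
  exact ⟨h1, h2⟩

/-- The coordinate vector of a tangent vector in the preferred chart at `p₀`. -/
noncomputable def chartCoord (p₀ : M) (X : ∀ p : M, TangentSpace (𝓡 n) p)
    (x : EuclideanSpace ℝ (Fin n)) : EuclideanSpace ℝ (Fin n) :=
  mfderiv (𝓡 n) 𝓘(ℝ, EuclideanSpace ℝ (Fin n)) (extChartAt (𝓡 n) p₀)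
        ((extChartAt (𝓡 n) p₀).symm x) (X ((extChartAt (𝓡 n) p₀).symm x))

theorem mfderiv_symm_chartCoord (p₀ : M) (X : ∀ p : M, TangentSpace (𝓡 n) p)
    {x : EuclideanSpace ℝ (Fin n)} (hx : x ∈ (extChartAt (𝓡 n) p₀).target) :
    mfderiv 𝓘(ℝ, EuclideanSpace ℝ (Fin n)) (𝓡 n) (extChartAt (𝓡 n) p₀).symm x
      (chartCoord p₀ X x) = X ((extChartAt (𝓡 n) p₀).symm x) :=
  DFunLike.congr_fun (hasInverse_chart_mfderiv p₀ hx).2 (X ((extChartAt (𝓡 n) p₀).symm x))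

omit [IsManifold (𝓡 n) ∞ M] in
theorem mfderiv_symm_eq_sum_chartFrame (p₀ : M) (x v : EuclideanSpace ℝ (Fin n)) :
    mfderiv 𝓘(ℝ, EuclideanSpace ℝ (Fin n)) (𝓡 n) (extChartAt (𝓡 n) p₀).symm x v
      = ∑ k, v k • chartFrame p₀ k x := by
  set L : EuclideanSpace ℝ (Fin n) →L[ℝ] EuclideanSpace ℝ (Fin n) :=
    mfderiv 𝓘(ℝ, EuclideanSpace ℝ (Fin n)) (𝓡 n) (extChartAt (𝓡 n) p₀).symm x with hL
  have hv : v = ∑ k, v k • EuclideanSpace.single k (1 : ℝ) := by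
    simpa using ((EuclideanSpace.basisFun (Fin n) ℝ).sum_repr v).symm
  have h : L v = ∑ k, v k • L (EuclideanSpace.single k (1 : ℝ)) := by
    conv_lhs => rw [hv]
    simp only [map_sum, map_smul]
  exact h

variable [RiemannianBundle (fun p : M => TangentSpace (𝓡 n) p)]
  [IsContMDiffRiemannianBundle (𝓡 n) ∞ (EuclideanSpace ℝ (Fin n))
      (fun p : M => TangentSpace (𝓡 n) p)]

/-- The coefficients of the metric in the preferred chart at `p₀`. -/
noncomputable def chartMetric (p₀ : M) (x : EuclideanSpace ℝ (Fin n)) :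
    Matrix (Fin n) (Fin n) ℝ :=
  Matrix.gram ℝ fun k => chartFrame p₀ k x

/-- The components of the one-form `g(X, ·)` in the preferred chart at `p₀`. -/
noncomputable def chartFlat (p₀ : M) (X : ∀ p : M, TangentSpace (𝓡 n) p) (k : Fin n)
    (x : EuclideanSpace ℝ (Fin n)) : ℝ :=
  inner ℝ (X ((extChartAt (𝓡 n) p₀).symm x)) (chartFrame p₀ k x)

theorem contDiffOn_chartMetric (p₀ : M) (k l : Fin n) :
    ContDiffOn ℝ ∞ (fun x => chartMetric p₀ x k l) (extChartAt (𝓡 n) p₀).target :=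
  ((contMDiffOn_chartFrame p₀ k).inner_bundle (contMDiffOn_chartFrame p₀ l)).contDiffOn

theorem contDiffOn_chartFlat (p₀ : M)
    {X : ∀ p : M, TangentSpace (𝓡 n) p} (hX : IsSmoothField X)
    (k : Fin n) : ContDiffOn ℝ ∞ (chartFlat p₀ X k) (extChartAt (𝓡 n) p₀).target :=
  ((hX.comp_contMDiffOn (contMDiffOn_extChartAt_symm (I := 𝓡 n) (n := ∞) p₀)).inner_bundle
    (contMDiffOn_chartFrame p₀ k)).contDiffOn

end Frames

/-! ### Differential forms in coordinates -/

/-- A family of alternating forms is smooth as soon as its components with respect to the standard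
basis are smooth, because an alternating form is a linear function of its components. -/
theorem contDiffOn_form_of_components {n k : ℕ} {U : Set (EuclideanSpace ℝ (Fin n))}
    {F : EuclideanSpace ℝ (Fin n) → EuclideanSpace ℝ (Fin n) [⋀^Fin k]→L[ℝ] ℝ}
    (h : ∀ i : Fin k → Fin n,
      ContDiffOn ℝ ∞ (fun x => F x fun a => EuclideanSpace.single (i a) (1 : ℝ)) U) :
    ContDiffOn ℝ ∞ F U := by
  let Φ : (EuclideanSpace ℝ (Fin n) [⋀^Fin k]→L[ℝ] ℝ) →ₗ[ℝ] ((Fin k → Fin n) → ℝ) :=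
    LinearMap.pi fun i =>
      (ContinuousAlternatingMap.apply ℝ _ ℝ fun a => EuclideanSpace.single (i a) (1 : ℝ)).toLinearMap
  have hΦ : Function.Injective Φ := by
    intro θ η hθη
    apply ContinuousAlternatingMap.toAlternatingMap_injective
    refine (EuclideanSpace.basisFun (Fin n) ℝ).toBasis.ext_alternating fun i _ => ?_
    simpa [Φ] using congrFun hθη i
  obtain ⟨Ψ, hΨ⟩ := LinearMap.exists_leftInverse_of_injective Φ (LinearMap.ker_eq_bot.2 hΦ)
  have hF : F = fun x => LinearMap.toContinuousLinearMap Ψ (Φ (F x)) := by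
    funext x
    exact (DFunLike.congr_fun hΨ (F x)).symm
  rw [hF]
  exact (LinearMap.toContinuousLinearMap Ψ).contDiff.comp_contDiffOn (contDiffOn_pi.2 fun i => h i)

section Naturality

variable {n k : ℕ} {M : Type*} [TopologicalSpace M] [ChartedSpace (EuclideanSpace ℝ (Fin n)) M]
  [IsManifold (𝓡 n) ∞ M]

/-- The linear maps `d(φ⁻¹)` and `dφ` are inverse to each other, for the chart `φ` at `p₀`. -/
theorem mfderiv_symm_comp_mfderiv (p₀ : M) {q : M} (hq : q ∈ (extChartAt (𝓡 n) p₀).source)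
    (v : EuclideanSpace ℝ (Fin n)) :
    (mfderiv 𝓘(ℝ, EuclideanSpace ℝ (Fin n)) (𝓡 n) (extChartAt (𝓡 n) p₀).symm
      (extChartAt (𝓡 n) p₀ q) : EuclideanSpace ℝ (Fin n) →L[ℝ] EuclideanSpace ℝ (Fin n))
      ((mfderiv (𝓡 n) 𝓘(ℝ, EuclideanSpace ℝ (Fin n)) (extChartAt (𝓡 n) p₀) q :
        EuclideanSpace ℝ (Fin n) →L[ℝ] EuclideanSpace ℝ (Fin n)) v) = v := by
  have h := (hasInverse_chart_mfderiv p₀ ((extChartAt (𝓡 n) p₀).map_source hq)).2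
  have h' := congrArg (fun q' => (mfderiv 𝓘(ℝ, EuclideanSpace ℝ (Fin n)) (𝓡 n)
    (extChartAt (𝓡 n) p₀).symm (extChartAt (𝓡 n) p₀ q) :
      EuclideanSpace ℝ (Fin n) →L[ℝ] EuclideanSpace ℝ (Fin n))
      ((mfderiv (𝓡 n) 𝓘(ℝ, EuclideanSpace ℝ (Fin n)) (extChartAt (𝓡 n) p₀) q' :
        EuclideanSpace ℝ (Fin n) →L[ℝ] EuclideanSpace ℝ (Fin n)) v))
      ((extChartAt (𝓡 n) p₀).left_inv hq)
  exact h'.symm.trans (DFunLike.congr_fun h v)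

omit [IsManifold (𝓡 n) ∞ M] in
theorem chartForm_extChartAt (η : Form n k M) (p₀ : M) {q : M}
    (hq : q ∈ (extChartAt (𝓡 n) p₀).source) :
    chartForm η p₀ (extChartAt (𝓡 n) p₀ q) =
      (show EuclideanSpace ℝ (Fin n) [⋀^Fin k]→L[ℝ] ℝ from η q).compContinuousLinearMap
        (mfderiv 𝓘(ℝ, EuclideanSpace ℝ (Fin n)) (𝓡 n) (extChartAt (𝓡 n) p₀).symm
          (extChartAt (𝓡 n) p₀ q)) :=
  congrArg (fun q' => (show EuclideanSpace ℝ (Fin n) [⋀^Fin k]→L[ℝ] ℝ from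
    η q').compContinuousLinearMap (mfderiv 𝓘(ℝ, EuclideanSpace ℝ (Fin n)) (𝓡 n)
      (extChartAt (𝓡 n) p₀).symm (extChartAt (𝓡 n) p₀ q))) ((extChartAt (𝓡 n) p₀).left_inv hq)

theorem fderiv_transition (p p₀ : M) {z : EuclideanSpace ℝ (Fin n)}
    (hz : z ∈ (extChartAt (𝓡 n) p).target)
    (hz' : (extChartAt (𝓡 n) p).symm z ∈ (extChartAt (𝓡 n) p₀).source) :
    fderiv ℝ (extChartAt (𝓡 n) p₀ ∘ (extChartAt (𝓡 n) p).symm) z =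
      (mfderiv (𝓡 n) 𝓘(ℝ, EuclideanSpace ℝ (Fin n)) (extChartAt (𝓡 n) p₀)
        ((extChartAt (𝓡 n) p).symm z)) ∘L
        (mfderiv 𝓘(ℝ, EuclideanSpace ℝ (Fin n)) (𝓡 n) (extChartAt (𝓡 n) p).symm z) := by
  rw [← mfderiv_eq_fderiv]
  exact mfderiv_comp z (mdifferentiableAt_extChartAt (by simpa using hz'))
    (((contMDiffOn_extChartAt_symm (I := 𝓡 n) (n := ∞) p).contMDiffAt
      ((isOpen_extChartAt_target_euclidean (n := n) p).mem_nhds hz)).mdifferentiableAt (by simp))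

theorem contDiffAt_transition (p p₀ : M) {z : EuclideanSpace ℝ (Fin n)}
    (hz : z ∈ (extChartAt (𝓡 n) p).target)
    (hz' : (extChartAt (𝓡 n) p).symm z ∈ (extChartAt (𝓡 n) p₀).source) :
    ContDiffAt ℝ ∞ (extChartAt (𝓡 n) p₀ ∘ (extChartAt (𝓡 n) p).symm) z := by
  rw [← contMDiffAt_iff_contDiffAt]
  have h1 : ContMDiffAt (𝓡 n) 𝓘(ℝ, EuclideanSpace ℝ (Fin n)) ∞ (extChartAt (𝓡 n) p₀)
      ((extChartAt (𝓡 n) p).symm z) := contMDiffAt_extChartAt' (by simpa using hz')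
  exact h1.comp z ((contMDiffOn_extChartAt_symm (I := 𝓡 n) (n := ∞) p).contMDiffAt
    ((isOpen_extChartAt_target_euclidean (n := n) p).mem_nhds hz))

/-- The expressions of a form in two charts are related by pullback under the transition map. -/
theorem chartForm_transition (η : Form n k M) (p p₀ : M) {z : EuclideanSpace ℝ (Fin n)}
    (hz : z ∈ (extChartAt (𝓡 n) p).target)
    (hz' : (extChartAt (𝓡 n) p).symm z ∈ (extChartAt (𝓡 n) p₀).source) :
    chartForm η p z =
      (chartForm η p₀ ((extChartAt (𝓡 n) p₀ ∘ (extChartAt (𝓡 n) p).symm) z)).compContinuousLinearMap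
        (fderiv ℝ (extChartAt (𝓡 n) p₀ ∘ (extChartAt (𝓡 n) p).symm) z) := by
  rw [fderiv_transition p p₀ hz hz', Function.comp_apply, chartForm_extChartAt η p₀ hz']
  ext v
  refine congrArg (η ((extChartAt (𝓡 n) p).symm z)) ?_
  funext a
  exact (mfderiv_symm_comp_mfderiv p₀ hz' _).symm

/-- The exterior derivative may be computed in any preferred chart. -/
theorem extDeriv_chartForm (η : Form n k M) (p₀ : M) {x : EuclideanSpace ℝ (Fin n)}
    (hx : x ∈ (extChartAt (𝓡 n) p₀).target) (hη : DifferentiableAt ℝ (chartForm η p₀) x) :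
    extDeriv (chartForm η p₀) x =
      (extDerivM η ((extChartAt (𝓡 n) p₀).symm x)).compContinuousLinearMap
        (mfderiv 𝓘(ℝ, EuclideanSpace ℝ (Fin n)) (𝓡 n) (extChartAt (𝓡 n) p₀).symm x) := by
  set p : M := (extChartAt (𝓡 n) p₀).symm x with hp
  set τ : EuclideanSpace ℝ (Fin n) → EuclideanSpace ℝ (Fin n) :=
    extChartAt (𝓡 n) p₀ ∘ (extChartAt (𝓡 n) p).symm with hτ
  set y := extChartAt (𝓡 n) p p with hy
  have hps : p ∈ (extChartAt (𝓡 n) p₀).source := (extChartAt (𝓡 n) p₀).map_target hx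
  have hyt : y ∈ (extChartAt (𝓡 n) p).target := mem_extChartAt_target p
  have hyp : (extChartAt (𝓡 n) p).symm y = p := extChartAt_to_inv p
  have hys : (extChartAt (𝓡 n) p).symm y ∈ (extChartAt (𝓡 n) p₀).source := hyp.symm ▸ hps
  have hτy : τ y = x := by
    simp only [hτ, Function.comp, hyp]
    exact (extChartAt (𝓡 n) p₀).right_inv hx
  have hform : chartForm η p =ᶠ[𝓝 y]
      fun z => (chartForm η p₀ (τ z)).compContinuousLinearMap (fderiv ℝ τ z) := by
    filter_upwards [(isOpen_extChartAt_target_euclidean (n := n) p).mem_nhds hyt,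
      (continuousAt_extChartAt_symm'' hyt).eventually
        ((isOpen_extChartAt_source (I := 𝓡 n) p₀).mem_nhds hys)] with z hz hz'
    exact chartForm_transition η p p₀ hz hz'
  rw [← hτy] at hη
  have hpull := extDeriv_pullback hη (contDiffAt_transition p p₀ hyt hys) (by
    simpa using WithTop.coe_le_coe.2 (le_top : (2 : ℕ∞) ≤ ⊤))
  rw [← hform.extDeriv_eq, hτy] at hpull
  ext v
  have hL : ∀ w : EuclideanSpace ℝ (Fin n), fderiv ℝ τ y
      (mfderiv (𝓡 n) 𝓘(ℝ, EuclideanSpace ℝ (Fin n)) (extChartAt (𝓡 n) p) p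
        (mfderiv 𝓘(ℝ, EuclideanSpace ℝ (Fin n)) (𝓡 n) (extChartAt (𝓡 n) p₀).symm x w)) = w := by
    intro w
    have h1 := mfderiv_symm_comp_mfderiv p (mem_extChartAt_source (I := 𝓡 n) p)
      (mfderiv 𝓘(ℝ, EuclideanSpace ℝ (Fin n)) (𝓡 n) (extChartAt (𝓡 n) p₀).symm x w)
    have h2 := DFunLike.congr_fun (hasInverse_chart_mfderiv p₀ hx).1 w
    let D : M → (EuclideanSpace ℝ (Fin n) →L[ℝ] EuclideanSpace ℝ (Fin n)) := fun q =>
      mfderiv (𝓡 n) 𝓘(ℝ, EuclideanSpace ℝ (Fin n)) (extChartAt (𝓡 n) p₀) q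
    let B : EuclideanSpace ℝ (Fin n) →L[ℝ] EuclideanSpace ℝ (Fin n) :=
      mfderiv 𝓘(ℝ, EuclideanSpace ℝ (Fin n)) (𝓡 n) (extChartAt (𝓡 n) p).symm y
    have h3 : fderiv ℝ τ y = D p ∘L B :=
      (fderiv_transition p p₀ hyt hys).trans (congrArg (fun q => D q ∘L B) hyp)
    rw [h3]
    exact (congrArg (D p) h1).trans h2
  have h2 := congrArg (fun θ => θ fun a => (mfderiv (𝓡 n) 𝓘(ℝ, EuclideanSpace ℝ (Fin n))
    (extChartAt (𝓡 n) p) p (mfderiv 𝓘(ℝ, EuclideanSpace ℝ (Fin n)) (𝓡 n)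
      (extChartAt (𝓡 n) p₀).symm x (v a)) : EuclideanSpace ℝ (Fin n))) hpull
  refine Eq.trans ?_ h2.symm
  refine congrArg (extDeriv (chartForm η p₀) x) ?_
  funext a
  exact (hL (v a)).symm

end Naturality

/-! ### The volume form -/

section Volume

variable {n : ℕ} {V : Type*} [NormedAddCommGroup V] [InnerProductSpace ℝ V]
  [Fact (Module.finrank ℝ V = n)]

/-- The square of the volume of a parallelepiped is its Gram determinant; this makes the coefficient of
the Riemannian volume form a smooth function of the metric, up to sign. -/
theorem volumeForm_sq_eq_det_gram (hn : 0 < n) (o : Orientation ℝ V (Fin n)) (v : Fin n → V) :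
    o.volumeForm v ^ 2 = (Matrix.gram ℝ v).det := by
  have hd : Module.finrank ℝ V = n := Fact.out
  have : FiniteDimensional ℝ V := .of_finrank_pos (hd ▸ hn)
  let b : OrthonormalBasis (Fin n) ℝ V := (stdOrthonormalBasis ℝ V).reindex (finCongr hd)
  have h : Matrix.of (fun i j => b.repr (v j) i) = b.toBasis.toMatrix v := by
    ext i j
    simp [Module.Basis.toMatrix_apply]
  rw [← sq_abs, o.volumeForm_robust' b, sq_abs, Matrix.gram_eq_conjTranspose_mul b v,
    Matrix.det_mul, Matrix.det_conjTranspose, Module.Basis.det_apply]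
  simp [h, sq]

theorem volumeForm_basis_pos_iff (hn : 0 < n) (o : Orientation ℝ V (Fin n))
    (B : Module.Basis (Fin n) ℝ V) : 0 < o.volumeForm B ↔ o = B.orientation := by
  have hd : Module.finrank ℝ V = n := Fact.out
  have ho := o.finOrthonormalBasis_orientation hn hd
  rw [o.volumeForm_robust (o.finOrthonormalBasis hn hd) ho,
    ← Module.Basis.orientation_eq_iff_det_pos, ho]

end Volume

section ChartVolume

variable {n : ℕ} {M : Type*} [TopologicalSpace M] [ChartedSpace (EuclideanSpace ℝ (Fin n)) M]
  [IsManifold (𝓡 n) ∞ M]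

/-- The coordinate vector fields of a chart form a basis of each tangent space. -/
noncomputable def chartBasis (p₀ : M) {x : EuclideanSpace ℝ (Fin n)}
    (hx : x ∈ (extChartAt (𝓡 n) p₀).target) :
    Module.Basis (Fin n) ℝ (TangentSpace (𝓡 n) ((extChartAt (𝓡 n) p₀).symm x)) :=
  (EuclideanSpace.basisFun (Fin n) ℝ).toBasis.map
    (LinearEquiv.ofLinearMap
      (mfderiv 𝓘(ℝ, EuclideanSpace ℝ (Fin n)) (𝓡 n) (extChartAt (𝓡 n) p₀).symm x).toLinearMap
      (mfderiv (𝓡 n) 𝓘(ℝ, EuclideanSpace ℝ (Fin n)) (extChartAt (𝓡 n) p₀)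
        ((extChartAt (𝓡 n) p₀).symm x)).toLinearMap
      (LinearMap.ext fun v => DFunLike.congr_fun (hasInverse_chart_mfderiv p₀ hx).2 v)
      (LinearMap.ext fun v => DFunLike.congr_fun (hasInverse_chart_mfderiv p₀ hx).1 v))

theorem coe_chartBasis (p₀ : M) {x : EuclideanSpace ℝ (Fin n)}
    (hx : x ∈ (extChartAt (𝓡 n) p₀).target) :
    ⇑(chartBasis p₀ hx) = fun k => chartFrame p₀ k x := by
  funext k
  rw [chartBasis, Module.Basis.map_apply, OrthonormalBasis.coe_toBasis,
    EuclideanSpace.basisFun_apply]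
  rfl

variable [RiemannianBundle (fun p : M => TangentSpace (𝓡 n) p)]

theorem posDef_chartMetric (p₀ : M) {x : EuclideanSpace ℝ (Fin n)}
    (hx : x ∈ (extChartAt (𝓡 n) p₀).target) : (chartMetric p₀ x).PosDef := by
  apply Matrix.posDef_gram_of_linearIndependent
  rw [← coe_chartBasis p₀ hx]
  exact (chartBasis p₀ hx).linearIndependent

/-- The value of the volume form on the coordinate vector fields of a chart. -/
noncomputable def chartVol (o : ∀ p : M, Orientation ℝ (TangentSpace (𝓡 n) p) (Fin n)) (p₀ : M)
    (x : EuclideanSpace ℝ (Fin n)) : ℝ :=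
  (o ((extChartAt (𝓡 n) p₀).symm x)).volumeForm fun k => chartFrame p₀ k x

omit [IsManifold (𝓡 n) ∞ M] in
theorem chartForm_volForm (o : ∀ p : M, Orientation ℝ (TangentSpace (𝓡 n) p) (Fin n)) (p₀ : M)
    (x : EuclideanSpace ℝ (Fin n)) (v : Fin n → EuclideanSpace ℝ (Fin n)) :
    chartForm (volForm o) p₀ x v =
      chartVol o p₀ x * (EuclideanSpace.basisFun (Fin n) ℝ).toBasis.det v := by
  have h := (chartForm (volForm o) p₀ x).toAlternatingMap.eq_smul_basis_det
    (EuclideanSpace.basisFun (Fin n) ℝ).toBasis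
  have h2 : chartForm (volForm o) p₀ x v = (chartForm (volForm o) p₀ x).toAlternatingMap v := rfl
  rw [h2, h]
  simp only [AlternatingMap.smul_apply, smul_eq_mul]
  congr 1
  rw [OrthonormalBasis.coe_toBasis]
  have : (⇑(EuclideanSpace.basisFun (Fin n) ℝ) : Fin n → EuclideanSpace ℝ (Fin n)) =
    fun k => EuclideanSpace.single k 1 := by
    funext k; simp
  rw [this]
  rfl

/-- In a chart the Riemannian volume form is `±√(det g) dx¹ ∧ ⋯ ∧ dxⁿ`; the sign is constant near
the base point because the orientation is locally constant. -/
theorem exists_sign_chartVol (hn : 0 < n)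
    (o : ∀ p : M, Orientation ℝ (TangentSpace (𝓡 n) p) (Fin n))
    (ho : IsManifoldOrientation o) (p₀ : M) :
    ∃ s : ℝ, s * s = 1 ∧ ∀ᶠ x in 𝓝 (extChartAt (𝓡 n) p₀ p₀),
      chartVol o p₀ x = s * √(chartMetric p₀ x).det := by
  obtain ⟨o₀, h₀⟩ := ho p₀
  have hev : ∀ᶠ x in 𝓝 (extChartAt (𝓡 n) p₀ p₀), x ∈ (extChartAt (𝓡 n) p₀).target ∧
      (0 < chartVol o p₀ x ↔ o₀ = (EuclideanSpace.basisFun (Fin n) ℝ).toBasis.orientation) := by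
    have hc := continuousAt_extChartAt_symm (I := 𝓡 n) p₀
    rw [ContinuousAt, extChartAt_to_inv] at hc
    filter_upwards [hc.eventually h₀, (isOpen_extChartAt_target_euclidean (n := n) p₀).mem_nhds
      (mem_extChartAt_target p₀)] with x hx hxt
    refine ⟨hxt, ?_⟩
    have hqs : (extChartAt (𝓡 n) p₀).symm x ∈ (chartAt (EuclideanSpace ℝ (Fin n)) p₀).source := by
      simpa using (extChartAt (𝓡 n) p₀).map_target hxt
    have hq : (extChartAt (𝓡 n) p₀).symm x ∈ (trivializationAt (EuclideanSpace ℝ (Fin n))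
        (TangentSpace (𝓡 n)) p₀).baseSet := by
      simpa [TangentBundle.trivializationAt_baseSet] using hqs
    set T := (trivializationAt (EuclideanSpace ℝ (Fin n)) (TangentSpace (𝓡 n)) p₀).linearEquivAt
      ℝ _ hq with hT
    have hTB : (chartBasis p₀ hxt).map T = (EuclideanSpace.basisFun (Fin n) ℝ).toBasis := by
      refine Module.Basis.eq_of_apply_eq fun k => ?_
      rw [Module.Basis.map_apply, coe_chartBasis, OrthonormalBasis.coe_toBasis,
        EuclideanSpace.basisFun_apply]
      have h1 := TangentBundle.continuousLinearMapAt_trivializationAt (I := 𝓡 n) hqs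
      have h2 : T (chartFrame p₀ k x) = (trivializationAt (EuclideanSpace ℝ (Fin n))
          (TangentSpace (𝓡 n)) p₀).continuousLinearMapAt ℝ _ (chartFrame p₀ k x) := by
        rw [Trivialization.continuousLinearMapAt_apply, Trivialization.linearMapAt_apply,
          if_pos hq]
        rfl
      rw [h2, h1]
      exact DFunLike.congr_fun (hasInverse_chart_mfderiv p₀ hxt).1 (EuclideanSpace.single k (1 : ℝ))
    have h3 := volumeForm_basis_pos_iff hn (o ((extChartAt (𝓡 n) p₀).symm x)) (chartBasis p₀ hxt)
    rw [coe_chartBasis] at h3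
    rw [chartVol, h3, ← hx hq, ← hTB, Module.Basis.orientation_map]
    exact (Equiv.apply_eq_iff_eq _).symm
  have hsq : ∀ x, chartVol o p₀ x ^ 2 = (chartMetric p₀ x).det := fun x =>
    volumeForm_sq_eq_det_gram hn _ _
  by_cases h : o₀ = (EuclideanSpace.basisFun (Fin n) ℝ).toBasis.orientation
  · refine ⟨1, by norm_num, ?_⟩
    filter_upwards [hev] with x ⟨_, hx⟩
    rw [one_mul, ← hsq, Real.sqrt_sq (hx.2 h).le]
  · refine ⟨-1, by norm_num, ?_⟩
    filter_upwards [hev] with x ⟨_, hx⟩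
    have : chartVol o p₀ x ≤ 0 := not_lt.1 fun h' => h (hx.1 h')
    rw [← hsq, Real.sqrt_sq_eq_abs, abs_of_nonpos this]
    ring

end ChartVolume

/-! ### Beltrami fields solve a div-curl system in coordinates -/

section SmoothMatrix

variable {n : ℕ} {E : Type*} [NormedAddCommGroup E] [NormedSpace ℝ E] {U : Set E}

theorem contDiffOn_det {G : E → Matrix (Fin n) (Fin n) ℝ}
    (hG : ∀ i j, ContDiffOn ℝ ∞ (fun x => G x i j) U) :
    ContDiffOn ℝ ∞ (fun x => (G x).det) U := by
  simp only [Matrix.det_apply']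
  exact ContDiffOn.sum fun σ _ => contDiffOn_const.mul (contDiffOn_prod fun i _ => hG (σ i) i)

theorem contDiffOn_inv_apply {G : E → Matrix (Fin n) (Fin n) ℝ}
    (hG : ∀ i j, ContDiffOn ℝ ∞ (fun x => G x i j) U) (h0 : ∀ x ∈ U, (G x).det ≠ 0)
    (k l : Fin n) : ContDiffOn ℝ ∞ (fun x => (G x)⁻¹ k l) U := by
  have : ∀ x, (G x)⁻¹ k l = (G x).det⁻¹ * ((G x).updateRow l (Pi.single k 1)).det := by
    intro x
    rw [Matrix.inv_def, Matrix.smul_apply, Matrix.adjugate_apply, Ring.inverse_eq_inv', smul_eq_mul]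
  simp only [this]
  refine ((contDiffOn_det hG).inv h0).mul (contDiffOn_det fun i j => ?_)
  by_cases hi : i = l
  · subst hi
    simpa using contDiffOn_const
  · simpa [Matrix.updateRow_ne hi] using hG i j

end SmoothMatrix

theorem det_basisFun_three (u v w : EuclideanSpace ℝ (Fin 3)) :
    (EuclideanSpace.basisFun (Fin 3) ℝ).toBasis.det ![u, v, w] =
      u 0 * (v 1 * w 2 - v 2 * w 1) - u 1 * (v 0 * w 2 - v 2 * w 0)
        + u 2 * (v 0 * w 1 - v 1 * w 0) := by
  rw [Module.Basis.det_apply, Matrix.det_fin_three]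
  simp [Module.Basis.toMatrix_apply]
  ring

section Beltrami

variable {M : Type*} [TopologicalSpace M]
    [ChartedSpace (EuclideanSpace ℝ (Fin 3)) M] [IsManifold (𝓡 3) ∞ M]
    [RiemannianBundle (fun p : M => TangentSpace (𝓡 3) p)]
    [IsContMDiffRiemannianBundle (𝓡 3) ∞ (EuclideanSpace ℝ (Fin 3))
      (fun p : M => TangentSpace (𝓡 3) p)]

omit [IsContMDiffRiemannianBundle (𝓡 3) ∞ (EuclideanSpace ℝ (Fin 3))
      (fun p : M => TangentSpace (𝓡 3) p)] in
theorem chartFlat_eq_mulVec {p₀ : M} (X : ∀ p : M, TangentSpace (𝓡 3) p)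
    {x : EuclideanSpace ℝ (Fin 3)} (hx : x ∈ (extChartAt (𝓡 3) p₀).target) :
    (fun k => chartFlat p₀ X k x) = (chartMetric p₀ x).mulVec (chartCoord p₀ X x) := by
  funext k
  rw [chartFlat, ← mfderiv_symm_chartCoord p₀ X hx, mfderiv_symm_eq_sum_chartFrame, sum_inner]
  simp only [Matrix.mulVec, dotProduct, chartMetric, Matrix.gram_apply]
  refine Finset.sum_congr rfl fun l _ => ?_
  rw [real_inner_smul_left, real_inner_comm, mul_comm]

omit [IsContMDiffRiemannianBundle (𝓡 3) ∞ (EuclideanSpace ℝ (Fin 3))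
      (fun p : M => TangentSpace (𝓡 3) p)] in
theorem chartCoord_eq_sum {p₀ : M} (X : ∀ p : M, TangentSpace (𝓡 3) p)
    {x : EuclideanSpace ℝ (Fin 3)} (hx : x ∈ (extChartAt (𝓡 3) p₀).target) (l : Fin 3) :
    chartCoord p₀ X x l = ∑ k, (chartMetric p₀ x)⁻¹ l k * chartFlat p₀ X k x := by
  have h := congrArg ((chartMetric p₀ x)⁻¹.mulVec) (chartFlat_eq_mulVec X hx)
  rw [Matrix.mulVec_mulVec, Matrix.nonsing_inv_mul _
    ((Matrix.isUnit_iff_isUnit_det _).1 (posDef_chartMetric p₀ hx).isUnit),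
    Matrix.one_mulVec] at h
  exact (congrFun h l).symm

omit [IsContMDiffRiemannianBundle (𝓡 3) ∞ (EuclideanSpace ℝ (Fin 3))
      (fun p : M => TangentSpace (𝓡 3) p)] [IsManifold (𝓡 3) ∞ M] in
theorem chartForm_flat_apply (p₀ : M) (X : ∀ p : M, TangentSpace (𝓡 3) p)
    (x v : EuclideanSpace ℝ (Fin 3)) :
    chartForm (flat X) p₀ x (fun _ => v) = ∑ k, v k * chartFlat p₀ X k x := by
  have h : chartForm (flat X) p₀ x (fun _ => v) = inner ℝ (X ((extChartAt (𝓡 3) p₀).symm x))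
    (mfderiv 𝓘(ℝ, EuclideanSpace ℝ (Fin 3)) (𝓡 3) (extChartAt (𝓡 3) p₀).symm x v) := rfl
  rw [h, mfderiv_symm_eq_sum_chartFrame, inner_sum]
  simp only [real_inner_smul_right, chartFlat]

omit [IsContMDiffRiemannianBundle (𝓡 3) ∞ (EuclideanSpace ℝ (Fin 3))
      (fun p : M => TangentSpace (𝓡 3) p)] in
theorem chartForm_contract_volForm (o : ∀ p : M, Orientation ℝ (TangentSpace (𝓡 3) p) (Fin 3))
    (p₀ : M) (X : ∀ p : M, TangentSpace (𝓡 3) p)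
    {x : EuclideanSpace ℝ (Fin 3)} (hx : x ∈ (extChartAt (𝓡 3) p₀).target)
    (v w : EuclideanSpace ℝ (Fin 3)) :
    chartForm (contract X (volForm o)) p₀ x ![v, w] = chartVol o p₀ x *
      (EuclideanSpace.basisFun (Fin 3) ℝ).toBasis.det ![chartCoord p₀ X x, v, w] := by
  rw [← chartForm_volForm]
  refine congrArg (volForm o ((extChartAt (𝓡 3) p₀).symm x)) ?_
  funext a
  refine Fin.cases ?_ (fun a => rfl) a
  exact (mfderiv_symm_chartCoord p₀ X hx).symm

theorem isSmoothForm_flat {X : ∀ p : M, TangentSpace (𝓡 3) p} (hX : IsSmoothField X) :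
    IsSmoothForm (flat X) := by
  intro p₀
  refine contDiffOn_form_of_components fun i => ?_
  have : ∀ x, (chartForm (flat X) p₀ x fun a => EuclideanSpace.single (i a) (1 : ℝ)) =
      ∑ k, (EuclideanSpace.single (i 0) (1 : ℝ) : EuclideanSpace ℝ (Fin 3)) k *
        chartFlat p₀ X k x := by
    intro x
    rw [← chartForm_flat_apply]
    congr 1
    funext a
    fin_cases a; rfl
  simp only [this]
  exact ContDiffOn.sum fun k _ => contDiffOn_const.mul (contDiffOn_chartFlat p₀ hX k)

/-- In the preferred chart at a point the one-form `g(X, ·)` of a rotational Beltrami field solves a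
div-curl system. The equation `curl X = f X` is the curl equation, after expressing the components of
`X` through those of `g(X, ·)`, and `div X = 0` is the divergence equation for `A = √(det g) g⁻¹`. -/
theorem exists_isDivCurlSolution {o : ∀ p : M, Orientation ℝ (TangentSpace (𝓡 3) p) (Fin 3)}
    (ho : IsManifoldOrientation o) {X : ∀ p : M, TangentSpace (𝓡 3) p}
    (hX : IsRotationalBeltrami o X) (p₀ : M) :
    ∃ U A c, extChartAt (𝓡 3) p₀ p₀ ∈ U ∧ U ⊆ (extChartAt (𝓡 3) p₀).target ∧
      IsDivCurlSolution U A c (chartFlat p₀ X) := by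
  obtain ⟨hXs, hdiv, f, hf, -, hcurl⟩ := hX
  obtain ⟨s, hs, hsign⟩ := exists_sign_chartVol (by norm_num) o ho p₀
  obtain ⟨V, hV, hVo, hpV⟩ := eventually_nhds_iff.1 hsign
  set φ := extChartAt (𝓡 3) p₀ with hφ
  set U : Set (EuclideanSpace ℝ (Fin 3)) := φ.target ∩ V with hU
  have hTo : IsOpen φ.target := isOpen_extChartAt_target_euclidean (n := 3) p₀
  have hUo : IsOpen U := hTo.inter hVo
  have hUT : U ⊆ φ.target := inter_subset_left
  have hG : ∀ i j, ContDiffOn ℝ ∞ (fun x => chartMetric p₀ x i j) U := fun i j =>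
    (contDiffOn_chartMetric p₀ i j).mono hUT
  have hpos : ∀ x ∈ U, 0 < (chartMetric p₀ x).det := fun x hx =>
    (posDef_chartMetric p₀ (hUT hx)).det_pos
  have hinv := contDiffOn_inv_apply hG fun x hx => (hpos x hx).ne'
  have hsqrt : ContDiffOn ℝ ∞ (fun x => √(chartMetric p₀ x).det) U :=
    (contDiffOn_det hG).sqrt fun x hx => (hpos x hx).ne'
  have hα : ∀ k, ContDiffOn ℝ ∞ (chartFlat p₀ X k) U := fun k =>
    (contDiffOn_chartFlat p₀ hXs k).mono hUT
  have hcoord : ∀ l, ContDiffOn ℝ ∞ (fun x => chartCoord p₀ X x l) U := fun l =>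
    (ContDiffOn.sum fun k _ => (hinv l k).mul (hα k)).congr fun x hx =>
      chartCoord_eq_sum X (hUT hx) l
  have hfφ : ContDiffOn ℝ ∞ (fun x => f (φ.symm x)) U :=
    (hf.comp_contMDiffOn ((contMDiffOn_extChartAt_symm (I := 𝓡 3) (n := ∞) p₀).mono
      hUT)).contDiffOn
  let e : Fin 3 → EuclideanSpace ℝ (Fin 3) := fun i => EuclideanSpace.single i 1
  -- The flux form of `X` and its components.
  set θ := chartForm (contract X (volForm o)) p₀ with hθ
  have hθv : ∀ x ∈ U, ∀ v w, θ x ![v, w] = s * √(chartMetric p₀ x).det *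
      (chartCoord p₀ X x 0 * (v 1 * w 2 - v 2 * w 1) - chartCoord p₀ X x 1 *
        (v 0 * w 2 - v 2 * w 0) + chartCoord p₀ X x 2 * (v 0 * w 1 - v 1 * w 0)) := by
    intro x hx v w
    rw [hθ, chartForm_contract_volForm o p₀ X (hUT hx), hV x hx.2, det_basisFun_three]
  have hθs : ContDiffOn ℝ ∞ θ U := by
    refine contDiffOn_form_of_components fun i => ?_
    have : ∀ x, (θ x fun a => EuclideanSpace.single (i a) (1 : ℝ)) = θ x ![e (i 0), e (i 1)] := by
      intro x
      congr 1
      funext a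
      fin_cases a <;> rfl
    simp only [this]
    refine ContDiffOn.congr ?_ fun x hx => hθv x hx _ _
    exact (contDiffOn_const.mul hsqrt).mul ((((hcoord 0).mul contDiffOn_const).sub
      ((hcoord 1).mul contDiffOn_const)).add ((hcoord 2).mul contDiffOn_const))
  have hηs : ContDiffOn ℝ ∞ (chartForm (flat X) p₀) U := (isSmoothForm_flat hXs p₀).mono hUT
  refine ⟨U, fun k l x => √(chartMetric p₀ x).det * (chartMetric p₀ x)⁻¹ k l,
    fun i j k x => f (φ.symm x) * (s * √(chartMetric p₀ x).det) *
      ∑ m, (chartMetric p₀ x)⁻¹ m k * (EuclideanSpace.basisFun (Fin 3) ℝ).toBasis.det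
        ![e m, e i, e j], ⟨mem_extChartAt_target p₀, hpV⟩, hUT,
    ⟨hUo, ?_, ?_, ?_, ?_, hα, ?_, ?_⟩⟩
  · exact fun k l => hsqrt.mul (hinv k l)
  · intro k l x hx
    have := (posDef_chartMetric p₀ (hUT hx)).inv.isHermitian.apply k l
    simp only [star_trivial] at this
    rw [this]
  · intro x hx ξ hξ
    have h1 := (posDef_chartMetric p₀ (hUT hx)).inv.dotProduct_mulVec_pos hξ
    have h2 := mul_pos (Real.sqrt_pos.2 (hpos x hx)) h1
    refine h2.trans_eq ?_
    simp only [dotProduct, Matrix.mulVec, Finset.mul_sum, star_trivial, Pi.star_apply]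
    refine Finset.sum_congr rfl fun k _ => Finset.sum_congr rfl fun l _ => ?_
    ring
  · intro i j k
    exact (hfφ.mul (contDiffOn_const.mul hsqrt)).mul
      (ContDiffOn.sum fun m _ => (hinv m k).mul contDiffOn_const)
  · intro i j x hx
    have hd := (hηs.contDiffAt (hUo.mem_nhds hx)).differentiableAt (by simp)
    have hα' : ∀ k, (fun y => chartForm (flat X) p₀ y fun _ => e k) = chartFlat p₀ X k := by
      intro k
      funext y
      rw [chartForm_flat_apply, Finset.sum_eq_single k (by simp +contextual [e]) (by simp)]
      simp [e]
    have h1 : extDeriv (chartForm (flat X) p₀) x ![e i, e j] =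
        pd i (chartFlat p₀ X j) x - pd j (chartFlat p₀ X i) x := by
      have hj : Fin.removeNth 0 ![e i, e j] = fun _ => e j := by
        funext a; fin_cases a; rfl
      have hi : Fin.removeNth 1 ![e i, e j] = fun _ => e i := by
        funext a; fin_cases a; rfl
      rw [extDeriv_apply hd, Fin.sum_univ_two, hi, hj, hα', hα']
      simp [pd, e, sub_eq_add_neg]
    have h2 := congrArg (fun η => η ![e i, e j]) (extDeriv_chartForm (flat X) p₀ (hUT hx) hd)
    rw [← hcurl] at h2
    have h3 : extDeriv (chartForm (flat X) p₀) x ![e i, e j] =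
        f (φ.symm x) * θ x ![e i, e j] := by
      refine h2.trans ?_
      have h4 := ((volForm o (φ.symm x)).toAlternatingMap.curryLeft).map_smul
        (f (φ.symm x)) (X (φ.symm x))
      exact DFunLike.congr_fun h4 fun a => mfderiv 𝓘(ℝ, EuclideanSpace ℝ (Fin 3)) (𝓡 3)
        φ.symm x (![e i, e j] a)
    rw [← h1, h3, hθv x hx]
    simp only [chartCoord_eq_sum X (hUT hx), det_basisFun_three]
    simp only [Fin.sum_univ_three, e, PiLp.single_apply]
    simp
    ring
  · intro x hx
    have hd := (hθs.contDiffAt (hUo.mem_nhds hx)).differentiableAt (by simp)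
    have hρ : ∀ k, (fun y => ∑ l, √(chartMetric p₀ y).det * (chartMetric p₀ y)⁻¹ k l *
        chartFlat p₀ X l y) =ᶠ[𝓝 x] fun y => √(chartMetric p₀ y).det * chartCoord p₀ X y k := by
      intro k
      filter_upwards [hUo.mem_nhds hx] with y hy
      rw [chartCoord_eq_sum X (hUT hy), Finset.mul_sum]
      exact Finset.sum_congr rfl fun l _ => by ring
    have hdk : ∀ (k : Fin 3) (c : ℝ) (v w : EuclideanSpace ℝ (Fin 3)),
        (∀ y ∈ U, θ y ![v, w] = c * (√(chartMetric p₀ y).det * chartCoord p₀ X y k)) →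
        fderiv ℝ (fun y => θ y ![v, w]) x (e k) =
          c * pd k (fun y => √(chartMetric p₀ y).det * chartCoord p₀ X y k) x := by
      intro k c v w h
      have h' : (fun y => θ y ![v, w]) =ᶠ[𝓝 x]
          fun y => c * (√(chartMetric p₀ y).det * chartCoord p₀ X y k) := by
        filter_upwards [hUo.mem_nhds hx] with y hy using h y hy
      rw [← pd_const_mul k c (differentiableAt_of_contDiffOn_infty hUo (hsqrt.mul (hcoord k)) hx),
        ← pd_eq_of_eventuallyEq k h']
      rfl
    have d0 := hdk 0 s (e 1) (e 2) fun y hy => by rw [hθv y hy]; simp [e]; ring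
    have d1 := hdk 1 (-s) (e 0) (e 2) fun y hy => by rw [hθv y hy]; simp [e]; ring
    have d2 := hdk 2 s (e 0) (e 1) fun y hy => by rw [hθv y hy]; simp [e]; ring
    have h2 := congrArg (fun η => η ![e 0, e 1, e 2]) (extDeriv_chartForm _ p₀ (hUT hx) hd)
    have h3 : extDeriv θ x ![e 0, e 1, e 2] = 0 := by
      refine h2.trans ?_
      rw [hdiv]
      rfl
    rw [extDeriv_apply hd, Fin.sum_univ_three] at h3
    have r0 : Fin.removeNth 0 ![e 0, e 1, e 2] = ![e 1, e 2] := by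
      funext a; fin_cases a <;> rfl
    have r1 : Fin.removeNth 1 ![e 0, e 1, e 2] = ![e 0, e 2] := by
      funext a; fin_cases a <;> rfl
    have r2 : Fin.removeNth 2 ![e 0, e 1, e 2] = ![e 0, e 1] := by
      funext a; fin_cases a <;> rfl
    rw [r0, r1, r2] at h3
    simp only [Matrix.cons_val] at h3
    rw [d0, d1, d2] at h3
    rw [Finset.sum_congr rfl fun k _ => pd_eq_of_eventuallyEq k (hρ k), Fin.sum_univ_three]
    simp only [Fin.val_zero, Fin.val_one, Fin.val_two] at h3
    linear_combination s * h3 - (pd 0 (fun y => √(chartMetric p₀ y).det * chartCoord p₀ X y 0) x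
      + pd 1 (fun y => √(chartMetric p₀ y).det * chartCoord p₀ X y 1) x
      + pd 2 (fun y => √(chartMetric p₀ y).det * chartCoord p₀ X y 2) x) * hs

end Beltrami

/-! ### Defining functions of embedded surfaces -/

section Slice

theorem mdifferentiable_of_mem_maximalAtlas_euclidean {n : ℕ} {M : Type*} [TopologicalSpace M]
    [ChartedSpace (EuclideanSpace ℝ (Fin n)) M] [IsManifold (𝓡 n) ∞ M]
    {e : OpenPartialHomeomorph M (EuclideanSpace ℝ (Fin n))}
    (he : e ∈ IsManifold.maximalAtlas (𝓡 n) ∞ M) :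
    e.MDifferentiable (𝓡 n) 𝓘(ℝ, EuclideanSpace ℝ (Fin n)) :=
  ⟨(contMDiffOn_of_mem_maximalAtlas he).mdifferentiableOn (by simp),
    (contMDiffOn_symm_of_mem_maximalAtlas he).mdifferentiableOn (by simp)⟩

variable {M : Type*} [TopologicalSpace M]
    [ChartedSpace (EuclideanSpace ℝ (Fin 3)) M] [IsManifold (𝓡 3) ∞ M]
    {S : Type*} [TopologicalSpace S]
    [ChartedSpace (EuclideanSpace ℝ (Fin 2)) S] [IsManifold (𝓡 2) ∞ S]

/-- `r` is a local defining function on the open set `O` of the surface `j : S → M`. -/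
structure IsDefiningFunction (j : S → M) (O : Set M) (r : M → ℝ) : Prop where
  isOpen : IsOpen O
  contMDiffOn : ContMDiffOn (𝓡 3) 𝓘(ℝ, ℝ) ∞ r O
  eq_zero_iff : ∀ q ∈ O, r q = 0 ↔ q ∈ range j
  mfderiv_ne_zero : ∀ q ∈ O, mfderiv (𝓡 3) 𝓘(ℝ, ℝ) r q ≠ 0
  mem_range_mfderiv : ∀ s : S, j s ∈ O → ∀ v : TangentSpace (𝓡 3) (j s),
    mfderiv (𝓡 3) 𝓘(ℝ, ℝ) r (j s) v = 0 → ∃ w, mfderiv (𝓡 2) (𝓡 3) j s w = v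

/-- A linear functional vanishing exactly on the first factor of a splitting. -/
theorem exists_functional_of_splitting {F : Type*} [NormedAddCommGroup F] [NormedSpace ℝ F]
    (T : (EuclideanSpace ℝ (Fin 2) × F) ≃L[ℝ] EuclideanSpace ℝ (Fin 3)) :
    ∃ L : EuclideanSpace ℝ (Fin 3) →L[ℝ] ℝ, L ≠ 0 ∧ ∀ z, L z = 0 ↔ (T.symm z).2 = 0 := by
  have : FiniteDimensional ℝ (EuclideanSpace ℝ (Fin 2) × F) :=
    T.symm.toLinearEquiv.finiteDimensional
  have hF : FiniteDimensional ℝ F :=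
    Module.Finite.of_surjective (LinearMap.snd ℝ (EuclideanSpace ℝ (Fin 2)) F)
      LinearMap.snd_surjective
  have h1 : Module.finrank ℝ F = Module.finrank ℝ ℝ := by
    have := T.toLinearEquiv.finrank_eq
    rw [Module.finrank_prod, finrank_euclideanSpace_fin, finrank_euclideanSpace_fin] at this
    rw [Module.finrank_self]
    omega
  let ℓ : F ≃L[ℝ] ℝ := ContinuousLinearEquiv.ofFinrankEq h1
  refine ⟨ℓ.toContinuousLinearMap ∘L ContinuousLinearMap.snd ℝ _ F ∘L
    T.symm.toContinuousLinearMap, ?_, fun z => ?_⟩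
  · intro h
    have := DFunLike.congr_fun h (T (0, ℓ.symm 1))
    simp at this
  · simp

/-- An embedded surface is locally the zero set of a regular function: the transversal coordinate of a
chart in which the immersion is linear. Since `j` is an embedding, the domain can be shrunk until no
other sheet of the surface meets it. -/
theorem exists_isDefiningFunction {j : S → M} (hj : IsSmoothEmbedding (𝓡 2) (𝓡 3) ∞ j) (s₀ : S) :
    ∃ O r, j s₀ ∈ O ∧ IsDefiningFunction j O r := by
  have hi := hj.isImmersion.isImmersionAt s₀
  set d := hi.domChart with hd
  set c := hi.codChart with hc
  set T := hi.equiv with hT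
  have hdm := mdifferentiable_of_mem_maximalAtlas_euclidean hi.domChart_mem_maximalAtlas
  have hcm := mdifferentiable_of_mem_maximalAtlas_euclidean hi.codChart_mem_maximalAtlas
  have hjm : ContMDiff (𝓡 2) (𝓡 3) ∞ j := hj.contMDiff
  have hsource : ∀ s ∈ d.source, j s ∈ c.source := hi.source_subset_preimage_source
  have hw : ∀ s ∈ d.source, c (j s) = T (d s, 0) := by
    intro s hs
    have hmem : d s ∈ (hi.domChart.extend (𝓡 2)).target := by simpa [← hd] using d.map_source hs
    have := hi.writtenInCharts hmem
    simpa [← hd, ← hc, ← hT, d.left_inv hs] using this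
  obtain ⟨L, hL0, hL⟩ := exists_functional_of_splitting T
  obtain ⟨O', hO', hO'd⟩ := hj.isEmbedding.isOpen_iff.1 d.open_source
  have hO2 : IsOpen (c.source ∩ c ⁻¹' {z | (T.symm z).1 ∈ d.target}) :=
    c.isOpen_inter_preimage (d.open_target.preimage (continuous_fst.comp T.symm.continuous))
  have hs₀ : s₀ ∈ d.source := hi.mem_domChart_source
  have hrm : ∀ q ∈ c.source, MDifferentiableAt (𝓡 3) 𝓘(ℝ, EuclideanSpace ℝ (Fin 3)) c q :=
    fun q hq => hcm.mdifferentiableAt hq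
  have hdr : ∀ q ∈ c.source, ∀ v : TangentSpace (𝓡 3) q,
      mfderiv (𝓡 3) 𝓘(ℝ, ℝ) (fun q => L (c q)) q v = L (mfderiv (𝓡 3) (𝓡 3) c q v) := by
    intro q hq v
    have := mfderiv_comp q (g := L) (L.mdifferentiableAt) (hrm q hq)
    rw [L.mfderiv_eq] at this
    exact DFunLike.congr_fun this v
  refine ⟨O' ∩ (c.source ∩ c ⁻¹' {z | (T.symm z).1 ∈ d.target}), fun q => L (c q),
    ⟨by rw [← hO'd] at hs₀; exact hs₀, hsource _ hs₀, ?_⟩, hO'.inter hO2, ?_, ?_, ?_, ?_⟩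
  · simp only [mem_preimage, mem_ofPred_eq, hw s₀ hs₀, T.symm_apply_apply]
    exact d.map_source hs₀
  · exact L.contMDiff.comp_contMDiffOn ((contMDiffOn_of_mem_maximalAtlas
      hi.codChart_mem_maximalAtlas).mono fun q hq => hq.2.1)
  · rintro q ⟨hqO, hqc, hqd⟩
    rw [hL]
    constructor
    · intro h
      refine ⟨d.symm (T.symm (c q)).1, ?_⟩
      have hs : d.symm (T.symm (c q)).1 ∈ d.source := d.map_target hqd
      refine c.injOn (hsource _ hs) hqc ?_
      rw [hw _ hs, d.right_inv hqd, ← h, Prod.mk.eta, T.apply_symm_apply]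
    · rintro ⟨s, rfl⟩
      have hs : s ∈ d.source := by rw [← hO'd]; exact hqO
      rw [hw s hs, T.symm_apply_apply]
  · rintro q ⟨hqO, hqc, hqd⟩ h
    apply hL0
    ext z
    obtain ⟨v, hv⟩ := hcm.mfderiv_surjective hqc z
    have h2 := hdr q hqc v
    rw [h, hv] at h2
    exact h2.symm
  · rintro s ⟨hqO, hqc, hqd⟩ v hv
    have hs : s ∈ d.source := by rw [← hO'd]; exact hqO
    have hv' : L (mfderiv (𝓡 3) (𝓡 3) c (j s) v) = 0 := (hdr _ hqc v).symm.trans hv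
    obtain ⟨z, hz⟩ : ∃ z : EuclideanSpace ℝ (Fin 3), z = mfderiv (𝓡 3) (𝓡 3) c (j s) v := ⟨_, rfl⟩
    have hz2 : (T.symm z).2 = 0 := (hL z).1 (hz ▸ hv')
    obtain ⟨w, hw'⟩ := hdm.mfderiv_surjective hs (T.symm z).1
    refine ⟨w, hcm.mfderiv_injective hqc ?_⟩
    have hev : (c ∘ j) =ᶠ[𝓝 s] fun s => T (d s, 0) := by
      filter_upwards [d.open_source.mem_nhds hs] with s' hs' using hw s' hs'
    have h1 := mfderiv_comp s (hrm _ hqc) (hjm.mdifferentiableAt (by simp) (x := s))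
    rw [hev.mfderiv_eq] at h1
    have h2 := mfderiv_comp s (g := T.toContinuousLinearMap ∘L ContinuousLinearMap.inl ℝ _ _)
      (ContinuousLinearMap.mdifferentiableAt _) (hdm.mdifferentiableAt hs)
    rw [ContinuousLinearMap.mfderiv_eq] at h2
    have h3 := DFunLike.congr_fun (h1.symm.trans h2) w
    refine h3.trans (Eq.trans ?_ hz)
    have h4 : T ((T.symm z).1, 0) = z := by
      rw [← hz2, Prod.mk.eta, T.apply_symm_apply]
    refine Eq.trans ?_ h4
    exact congrArg (fun u : EuclideanSpace ℝ (Fin 2) => T (u, 0)) hw'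

end Slice

/-! ### Tangency to an invariant surface -/

section Tangency

variable {M : Type*} [TopologicalSpace M]
    [ChartedSpace (EuclideanSpace ℝ (Fin 3)) M] [IsManifold (𝓡 3) ∞ M]
    {S : Type*} [TopologicalSpace S]
    [ChartedSpace (EuclideanSpace ℝ (Fin 2)) S] [IsManifold (𝓡 2) ∞ S]

/-- A vector field is tangent to an invariant embedded surface: a local defining function of the
surface vanishes along the integral curves that start on it. -/
theorem mfderiv_restrictField {X : ∀ p : M, TangentSpace (𝓡 3) p} (hX : IsSmoothField X)
    {j : S → M} (hj : IsSmoothEmbedding (𝓡 2) (𝓡 3) ∞ j) (hinv : IsInvariantUnder X (range j))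
    (s : S) : mfderiv (𝓡 2) (𝓡 3) j s (restrictField (m := 2) j X s) = X (j s) := by
  obtain ⟨O, r, hsO, hr⟩ := exists_isDefiningFunction hj s
  obtain ⟨γ, hγ0, hγ⟩ := exists_isMIntegralCurveAt_of_contMDiffAt_boundaryless (I := 𝓡 3) 0
    (v := X) (x₀ := j s) ((hX.of_le (by simp)).contMDiffAt)
  obtain ⟨ε, hε, hγε⟩ := isMIntegralCurveAt_iff'.1 hγ
  rw [Real.ball_eq_Ioo] at hγε
  have h0 : (0 : ℝ) ∈ Ioo (0 - ε) (0 + ε) := ⟨by linarith, by linarith⟩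
  have hrange := hinv γ _ _ hγε ⟨0, h0, hγ0 ▸ mem_range_self s⟩
  have hev : r ∘ γ =ᶠ[𝓝 0] fun _ => 0 := by
    have hO : ∀ᶠ t in 𝓝 (0 : ℝ), γ t ∈ O :=
      hγ.continuousAt.eventually (hr.isOpen.mem_nhds (hγ0 ▸ hsO))
    filter_upwards [Ioo_mem_nhds h0.1 h0.2, hO] with t ht htO
    exact (hr.eq_zero_iff _ htO).2 (hrange t ht)
  have hd := hγ.hasMFDerivAt
  have hrd : MDifferentiableAt (𝓡 3) 𝓘(ℝ, ℝ) r (γ 0) := by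
    rw [hγ0]
    exact (hr.contMDiffOn.contMDiffAt (hr.isOpen.mem_nhds hsO)).mdifferentiableAt (by simp)
  have h1 := (hrd.hasMFDerivAt.comp 0 hd).mfderiv
  rw [hev.mfderiv_eq, mfderiv_const] at h1
  have h2 := DFunLike.congr_fun h1.symm (1 : ℝ)
  have h3 : mfderiv (𝓡 3) 𝓘(ℝ, ℝ) r (γ 0) (X (γ 0)) = 0 := by
    refine Eq.trans ?_ h2
    refine congrArg (mfderiv (𝓡 3) 𝓘(ℝ, ℝ) r (γ 0)) ?_
    exact (one_smul ℝ (X (γ 0))).symm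
  rw [hγ0] at h3
  exact Function.invFun_eq (hr.mem_range_mfderiv s hsO _ h3)

end Tangency

/-! ### Unique continuation on the manifold -/

section UniqueContinuation

theorem IsDivCurlSolution.mono {n : ℕ} {U V : Set (EuclideanSpace ℝ (Fin n))}
    {A : Fin n → Fin n → EuclideanSpace ℝ (Fin n) → ℝ}
    {c : Fin n → Fin n → Fin n → EuclideanSpace ℝ (Fin n) → ℝ}
    {α : Fin n → EuclideanSpace ℝ (Fin n) → ℝ} (h : IsDivCurlSolution U A c α) (hV : IsOpen V)
    (hVU : V ⊆ U) : IsDivCurlSolution V A c α where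
  isOpen := hV
  smooth_A k l := (h.smooth_A k l).mono hVU
  symm_A k l x hx := h.symm_A k l x (hVU hx)
  pos_A x hx := h.pos_A x (hVU hx)
  smooth_c i j k := (h.smooth_c i j k).mono hVU
  smooth_α i := (h.smooth_α i).mono hVU
  curl_eq i j x hx := h.curl_eq i j x (hVU hx)
  div_eq x hx := h.div_eq x (hVU hx)

variable {M : Type*} [TopologicalSpace M]
    [ChartedSpace (EuclideanSpace ℝ (Fin 3)) M] [IsManifold (𝓡 3) ∞ M]
    [RiemannianBundle (fun p : M => TangentSpace (𝓡 3) p)]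

theorem chartFlat_eq_zero_iff (p₀ : M) (X : ∀ p : M, TangentSpace (𝓡 3) p)
    {x : EuclideanSpace ℝ (Fin 3)} (hx : x ∈ (extChartAt (𝓡 3) p₀).target) :
    (∀ i, chartFlat p₀ X i x = 0) ↔ X ((extChartAt (𝓡 3) p₀).symm x) = 0 := by
  constructor
  · intro h
    have hc : chartCoord p₀ X x = 0 := by
      ext l
      rw [chartCoord_eq_sum X hx]
      simp [h]
    rw [← mfderiv_symm_chartCoord p₀ X hx, hc]
    exact map_zero _
  · intro h i
    rw [chartFlat, h, inner_zero_left]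

theorem eventually_chartFlat_eq_zero_iff (p₀ : M) (X : ∀ p : M, TangentSpace (𝓡 3) p)
    {p : M} (hp : p ∈ (extChartAt (𝓡 3) p₀).source) :
    (∀ᶠ x in 𝓝 (extChartAt (𝓡 3) p₀ p), ∀ i, chartFlat p₀ X i x = 0) ↔
      ∀ᶠ q in 𝓝 p, X q = 0 := by
  have hxt := (extChartAt (𝓡 3) p₀).map_source hp
  have hc1 : Tendsto (extChartAt (𝓡 3) p₀) (𝓝 p) (𝓝 (extChartAt (𝓡 3) p₀ p)) :=
    continuousAt_extChartAt' hp
  have hc2 := continuousAt_extChartAt_symm'' hxt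
  rw [ContinuousAt, (extChartAt (𝓡 3) p₀).left_inv hp] at hc2
  constructor
  · intro h
    filter_upwards [hc1.eventually h, (isOpen_extChartAt_source (I := 𝓡 3) p₀).mem_nhds hp]
      with q hq hqs
    have := (chartFlat_eq_zero_iff p₀ X ((extChartAt (𝓡 3) p₀).map_source hqs)).1 hq
    rwa [(extChartAt (𝓡 3) p₀).left_inv hqs] at this
  · intro h
    filter_upwards [hc2.eventually h,
      (isOpen_extChartAt_target_euclidean (n := 3) p₀).mem_nhds hxt] with x hx hxt
    exact (chartFlat_eq_zero_iff p₀ X hxt).2 hx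

variable [IsContMDiffRiemannianBundle (𝓡 3) ∞ (EuclideanSpace ℝ (Fin 3))
      (fun p : M => TangentSpace (𝓡 3) p)]
  {o : ∀ p : M, Orientation ℝ (TangentSpace (𝓡 3) p) (Fin 3)}
  {X : ∀ p : M, TangentSpace (𝓡 3) p}

/-- The interior of the zero set of a rotational Beltrami field is closed. -/
theorem isClosed_setOf_eventually_eq_zero (ho : IsManifoldOrientation o)
    (hX : IsRotationalBeltrami o X) : IsClosed {p : M | ∀ᶠ q in 𝓝 p, X q = 0} := by
  refine isClosed_of_closure_subset fun p hp => ?_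
  obtain ⟨U, A, c, hpU, -, h⟩ := exists_isDivCurlSolution ho hX p
  have hps := mem_extChartAt_source (I := 𝓡 3) p
  refine (eventually_chartFlat_eq_zero_iff p X hps).1
    (h.eventually_eq_zero_of_mem_closure hpU ?_)
  rw [mem_closure_iff_frequently] at hp ⊢
  have hc1 : Tendsto (extChartAt (𝓡 3) p) (𝓝 p) (𝓝 (extChartAt (𝓡 3) p p)) :=
    continuousAt_extChartAt p
  refine hc1.frequently ((hp.and_eventually
    ((isOpen_extChartAt_source (I := 𝓡 3) p).mem_nhds hps)).mono fun q hq => ?_)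
  exact (eventually_chartFlat_eq_zero_iff p X hq.2).2 hq.1

variable {S : Type*} [TopologicalSpace S]
    [ChartedSpace (EuclideanSpace ℝ (Fin 2)) S] [IsManifold (𝓡 2) ∞ S]

/-- A rotational Beltrami field that vanishes on an embedded surface vanishes near it. -/
theorem eventually_eq_zero_of_eq_zero_on_surface (ho : IsManifoldOrientation o)
    (hX : IsRotationalBeltrami o X) {j : S → M} (hj : IsSmoothEmbedding (𝓡 2) (𝓡 3) ∞ j)
    (hz : ∀ s, X (j s) = 0) (s : S) : ∀ᶠ q in 𝓝 (j s), X q = 0 := by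
  obtain ⟨O, r, hsO, hr⟩ := exists_isDefiningFunction hj s
  obtain ⟨U, A, c, hpU, hUT, h⟩ := exists_isDivCurlSolution ho hX (j s)
  set φ := extChartAt (𝓡 3) (j s) with hφ
  have hsym : ContMDiffOn 𝓘(ℝ, EuclideanSpace ℝ (Fin 3)) (𝓡 3) ∞ φ.symm U :=
    (contMDiffOn_extChartAt_symm (I := 𝓡 3) (n := ∞) (j s)).mono hUT
  set V : Set (EuclideanSpace ℝ (Fin 3)) := U ∩ φ.symm ⁻¹' O with hV
  have hVo : IsOpen V := hsym.continuousOn.isOpen_inter_preimage h.isOpen hr.isOpen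
  have hVU : V ⊆ U := inter_subset_left
  have hpV : φ (j s) ∈ V := ⟨hpU, by
    simp only [mem_preimage, hφ, extChartAt_to_inv]
    exact hsO⟩
  have hρ : ContMDiffOn 𝓘(ℝ, EuclideanSpace ℝ (Fin 3)) 𝓘(ℝ, ℝ) ∞ (fun x => r (φ.symm x)) V :=
    hr.contMDiffOn.comp (hsym.mono hVU) fun x hx => hx.2
  refine (eventually_chartFlat_eq_zero_iff (j s) X (mem_extChartAt_source (j s))).1
    ((h.mono hVo hVU).eventually_eq_zero_of_eq_zero_on_hypersurface hρ.contDiffOn ?_ ?_ hpV ?_)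
  · intro x hx _
    by_contra! hk
    refine hr.mfderiv_ne_zero _ hx.2 ?_
    have h1 : fderiv ℝ (fun x => r (φ.symm x)) x = 0 := by
      ext v
      rw [fderiv_apply_eq_sum_pd]
      simp [hk]
    have h2 := mfderiv_comp x (((hr.contMDiffOn.contMDiffAt (hr.isOpen.mem_nhds
      hx.2))).mdifferentiableAt (by simp)) ((hsym.contMDiffAt
        (h.isOpen.mem_nhds hx.1)).mdifferentiableAt (by simp))
    have h3 := (mfderiv_eq_fderiv (f := r ∘ φ.symm)).symm.trans h2
    ext v
    have h4 := DFunLike.congr_fun (hasInverse_chart_mfderiv (j s) (hUT hx.1)).2 v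
    have h5 := DFunLike.congr_fun (h3.symm.trans h1) (mfderiv (𝓡 3) (𝓡 3) φ (φ.symm x) v)
    exact (congrArg (mfderiv (𝓡 3) 𝓘(ℝ, ℝ) r (φ.symm x)) h4).symm.trans h5
  · intro x hx hx0
    obtain ⟨s', hs'⟩ := (hr.eq_zero_iff _ hx.2).1 hx0
    refine (chartFlat_eq_zero_iff (j s) X (hUT hx.1)).2 ?_
    rw [← hφ, ← hs']
    exact hz s'
  · simp only [hφ, extChartAt_to_inv]
    exact (hr.eq_zero_iff _ hsO).2 (mem_range_self s)

/-- A rotational Beltrami field that vanishes on an embedded surface vanishes on the connected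
components of the manifold that the surface meets. -/
theorem eq_zero_on_connectedComponent_of_eq_zero_on_surface (ho : IsManifoldOrientation o)
    (hX : IsRotationalBeltrami o X) {j : S → M} (hj : IsSmoothEmbedding (𝓡 2) (𝓡 3) ∞ j)
    (hz : ∀ s, X (j s) = 0) (s : S) {q : M} (hq : q ∈ connectedComponent (j s)) : X q = 0 := by
  have hclopen : IsClopen {p : M | ∀ᶠ q in 𝓝 p, X q = 0} :=
    ⟨isClosed_setOf_eventually_eq_zero ho hX, isOpen_setOfPred_eventually_nhds⟩
  exact (hclopen.connectedComponent_subset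
    (eventually_eq_zero_of_eq_zero_on_surface ho hX hj hz s) hq).self_of_nhds

end UniqueContinuation

/-! ### Stokes' theorem for `dF ∧ β` on a compact surface -/

section Stokes

theorem linearMap_apply_two (L : EuclideanSpace ℝ (Fin 2) →L[ℝ] ℝ) (v : EuclideanSpace ℝ (Fin 2)) :
    L v = v 0 * L (EuclideanSpace.single 0 1) + v 1 * L (EuclideanSpace.single 1 1) := by
  have hv : v = v 0 • EuclideanSpace.single 0 (1 : ℝ) + v 1 • EuclideanSpace.single 1 (1 : ℝ) := by
    ext i
    fin_cases i <;> simp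
  conv_lhs => rw [hv]
  simp

theorem det_basisFun_two (v w : EuclideanSpace ℝ (Fin 2)) :
    (EuclideanSpace.basisFun (Fin 2) ℝ).toBasis.det ![v, w] = v 0 * w 1 - v 1 * w 0 := by
  rw [Module.Basis.det_apply, Matrix.det_fin_two]
  simp [Module.Basis.toMatrix_apply]
  ring

theorem alternating_apply_two (θ : EuclideanSpace ℝ (Fin 2) [⋀^Fin 2]→L[ℝ] ℝ)
    (v w : EuclideanSpace ℝ (Fin 2)) :
    θ ![v, w] = θ ![EuclideanSpace.single 0 1, EuclideanSpace.single 1 1] *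
      (v 0 * w 1 - v 1 * w 0) := by
  have h := θ.toAlternatingMap.eq_smul_basis_det (EuclideanSpace.basisFun (Fin 2) ℝ).toBasis
  have h2 : θ ![v, w] = θ.toAlternatingMap ![v, w] := rfl
  have h3 : (⇑(EuclideanSpace.basisFun (Fin 2) ℝ).toBasis : Fin 2 → EuclideanSpace ℝ (Fin 2)) =
      ![EuclideanSpace.single 0 1, EuclideanSpace.single 1 1] := by
    funext k; fin_cases k <;> simp
  rw [h2, h, AlternatingMap.smul_apply, det_basisFun_two, smul_eq_mul, h3]
  rfl

theorem det_clm_two (L : EuclideanSpace ℝ (Fin 2) →L[ℝ] EuclideanSpace ℝ (Fin 2)) :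
    L.det = L (EuclideanSpace.single 0 1) 0 * L (EuclideanSpace.single 1 1) 1 -
      L (EuclideanSpace.single 0 1) 1 * L (EuclideanSpace.single 1 1) 0 := by
  have h3 : (⇑(EuclideanSpace.basisFun (Fin 2) ℝ).toBasis : Fin 2 → EuclideanSpace ℝ (Fin 2)) =
      ![EuclideanSpace.single 0 1, EuclideanSpace.single 1 1] := by
    funext k; fin_cases k <;> simp
  have h := (EuclideanSpace.basisFun (Fin 2) ℝ).toBasis.det_comp L.toLinearMap
    (EuclideanSpace.basisFun (Fin 2) ℝ).toBasis
  rw [Module.Basis.det_self, mul_one] at h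
  rw [← det_basisFun_two]
  refine h.symm.trans ?_
  rw [h3]
  congr 1
  funext k; fin_cases k <;> rfl

variable {S : Type*} [TopologicalSpace S]
    [ChartedSpace (EuclideanSpace ℝ (Fin 2)) S]

/-- The coefficient of a two-form in the preferred chart at `p`. -/
noncomputable def chartArea (σ : Form 2 2 S) (p : S) (x : EuclideanSpace ℝ (Fin 2)) : ℝ :=
  chartForm σ p x ![EuclideanSpace.single 0 1, EuclideanSpace.single 1 1]

/-- The components of a one-form in the preferred chart at `p`. -/
noncomputable def chartCovec (β : Form 2 1 S) (p : S) (k : Fin 2)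
    (x : EuclideanSpace ℝ (Fin 2)) : ℝ :=
  chartForm β p x fun _ => EuclideanSpace.single k 1

/-- The differential of a real function, with the tangent spaces of `ℝ` identified with `ℝ`. -/
noncomputable def differential (F : S → ℝ) (q : S) : TangentSpace (𝓡 2) q →L[ℝ] ℝ :=
  mfderiv (𝓡 2) 𝓘(ℝ, ℝ) F q

/-- The function `g` with `dF ∧ β = g σ`, computed on the standard basis of the model space. It does
not depend on the basis and is determined by the equation where `σ ≠ 0`. -/
noncomputable def wedgeQuotient (σ : Form 2 2 S) (β : Form 2 1 S) (F : S → ℝ) (q : S) : ℝ :=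
  letI e : Fin 2 → TangentSpace (𝓡 2) q := fun k =>
    (EuclideanSpace.single k 1 : EuclideanSpace ℝ (Fin 2))
  (differential F q (e 0) * β q (fun _ => e 1) -
    differential F q (e 1) * β q (fun _ => e 0)) / σ q ![e 0, e 1]

theorem wedgeQuotient_mul {σ : Form 2 2 S} (β : Form 2 1 S) (F : S → ℝ) (q : S)
    (hσ : ∃ v w, σ q ![v, w] ≠ 0) (v w : TangentSpace (𝓡 2) q) :
    wedgeQuotient σ β F q * σ q ![v, w] =
      differential F q v * β q (fun _ => w) -
        differential F q w * β q (fun _ => v) := by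
  let θ : EuclideanSpace ℝ (Fin 2) [⋀^Fin 2]→L[ℝ] ℝ := σ q
  let D : EuclideanSpace ℝ (Fin 2) →L[ℝ] ℝ := differential F q
  let b : EuclideanSpace ℝ (Fin 2) →L[ℝ] ℝ :=
    (ContinuousAlternatingMap.ofSubsingleton ℝ (EuclideanSpace ℝ (Fin 2)) ℝ (0 : Fin 1)).symm (β q)
  have hb : ∀ u, b u = β q fun _ => u := fun u => rfl
  have h0 : θ ![EuclideanSpace.single 0 1, EuclideanSpace.single 1 1] ≠ 0 := by
    intro h
    obtain ⟨v, w, hvw⟩ := hσ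
    apply hvw
    refine (alternating_apply_two θ v w).trans ?_
    rw [h, zero_mul]
  change (D (EuclideanSpace.single 0 1) * b (EuclideanSpace.single 1 1) -
    D (EuclideanSpace.single 1 1) * b (EuclideanSpace.single 0 1)) /
      θ ![EuclideanSpace.single 0 1, EuclideanSpace.single 1 1] * θ ![v, w] =
    D v * b w - D w * b v
  rw [alternating_apply_two θ v w, linearMap_apply_two D v, linearMap_apply_two D w,
    linearMap_apply_two b v, linearMap_apply_two b w]
  field_simp
  ring

theorem wedgeQuotient_eq_of_forall {σ : Form 2 2 S} (β : Form 2 1 S) (F : S → ℝ) (q : S)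
    (hσ : ∃ v w, σ q ![v, w] ≠ 0) {g : ℝ} (h : ∀ v w, g * σ q ![v, w] =
      differential F q v * β q (fun _ => w) -
        differential F q w * β q (fun _ => v)) : wedgeQuotient σ β F q = g := by
  obtain ⟨v, w, hvw⟩ := hσ
  exact mul_right_cancel₀ hvw ((wedgeQuotient_mul β F q ⟨v, w, hvw⟩ v w).trans (h v w).symm)

theorem wedgeQuotient_sum {ι : Type} [Fintype ι] {σ : Form 2 2 S} (β : Form 2 1 S)
    (F : ι → S → ℝ) (q : S) (hσ : ∃ v w, σ q ![v, w] ≠ 0)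
    (hF : ∀ i, MDifferentiableAt (𝓡 2) 𝓘(ℝ, ℝ) (F i) q) :
    wedgeQuotient σ β (fun s => ∑ i, F i s) q = ∑ i, wedgeQuotient σ β (F i) q := by
  refine wedgeQuotient_eq_of_forall β _ q hσ fun v w => ?_
  have h : ∀ v, differential (fun s => ∑ i, F i s) q v =
      ∑ i, differential (F i) q v := by
    intro v
    have h1 := (HasMFDerivAt.sum (t := Finset.univ) (f := F)
      (f' := fun i => differential (F i) q) fun i _ => (hF i).hasMFDerivAt).mfderiv
    have h2 : (∑ i, F i) = fun s => ∑ i, F i s := by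
      funext s; simp
    rw [h2] at h1
    refine (DFunLike.congr_fun h1 v).trans ?_
    exact sum_apply (F := EuclideanSpace ℝ (Fin 2) →L[ℝ] ℝ) Finset.univ
      (fun i => differential (F i) q) v
  rw [h, h, Finset.sum_mul, Finset.sum_mul, Finset.sum_mul, ← Finset.sum_sub_distrib]
  exact Finset.sum_congr rfl fun i _ => wedgeQuotient_mul β (F i) q hσ v w

variable [IsManifold (𝓡 2) ∞ S]

/-- The coefficient of a two-form changes by the Jacobian determinant of the transition map. -/
theorem chartArea_transition (σ : Form 2 2 S) (p p' : S) {x : EuclideanSpace ℝ (Fin 2)}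
    (hx : x ∈ (extChartAt (𝓡 2) p).target)
    (hx' : (extChartAt (𝓡 2) p).symm x ∈ (extChartAt (𝓡 2) p').source) :
    chartArea σ p x = (fderiv ℝ (extChartAt (𝓡 2) p' ∘ (extChartAt (𝓡 2) p).symm) x).det *
      chartArea σ p' ((extChartAt (𝓡 2) p' ∘ (extChartAt (𝓡 2) p).symm) x) := by
  rw [chartArea, chartForm_transition σ p p' hx hx', det_clm_two, chartArea, mul_comm,
    ← alternating_apply_two, ContinuousAlternatingMap.compContinuousLinearMap_apply]
  congr 1
  funext k; fin_cases k <;> rfl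

omit [IsManifold (𝓡 2) ∞ S] in
theorem exists_area_ne_zero {σ : Form 2 2 S} (hσ : IsSymplecticForm σ) (q : S) :
    ∃ v w, σ q ![v, w] ≠ 0 := by
  by_contra! h
  have := hσ.nondegenerate q (EuclideanSpace.single 0 1 : EuclideanSpace ℝ (Fin 2)) fun w => h _ w
  have h2 : (EuclideanSpace.single 0 1 : EuclideanSpace ℝ (Fin 2)) = 0 := this
  simpa using congrFun (congrArg (fun v : EuclideanSpace ℝ (Fin 2) => v.ofLp) h2) 0

theorem chartArea_ne_zero {σ : Form 2 2 S} (hσ : IsSymplecticForm σ) (p : S)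
    {x : EuclideanSpace ℝ (Fin 2)} (hx : x ∈ (extChartAt (𝓡 2) p).target) :
    chartArea σ p x ≠ 0 := by
  intro h
  obtain ⟨v, w, hvw⟩ := exists_area_ne_zero hσ ((extChartAt (𝓡 2) p).symm x)
  apply hvw
  have hi := (hasInverse_chart_mfderiv p hx).2
  have h1 := alternating_apply_two (chartForm σ p x)
    (mfderiv (𝓡 2) (𝓡 2) (extChartAt (𝓡 2) p) ((extChartAt (𝓡 2) p).symm x) v)
    (mfderiv (𝓡 2) (𝓡 2) (extChartAt (𝓡 2) p) ((extChartAt (𝓡 2) p).symm x) w)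
  rw [chartArea] at h
  rw [h, zero_mul] at h1
  refine Eq.trans ?_ h1
  refine congrArg (σ ((extChartAt (𝓡 2) p).symm x)) ?_
  funext k
  fin_cases k
  · exact (DFunLike.congr_fun hi v).symm
  · exact (DFunLike.congr_fun hi w).symm

omit [IsManifold (𝓡 2) ∞ S] in
theorem contDiffOn_chartArea {σ : Form 2 2 S} (hσ : IsSmoothForm σ) (p : S) :
    ContDiffOn ℝ ∞ (chartArea σ p) (extChartAt (𝓡 2) p).target :=
  (ContinuousAlternatingMap.apply ℝ (EuclideanSpace ℝ (Fin 2)) ℝ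
    ![EuclideanSpace.single 0 1, EuclideanSpace.single 1 1]).contDiff.comp_contDiffOn (hσ p)

omit [IsManifold (𝓡 2) ∞ S] in
theorem contDiffOn_chartCovec {β : Form 2 1 S} (hβ : IsSmoothForm β) (p : S) (k : Fin 2) :
    ContDiffOn ℝ ∞ (chartCovec β p k) (extChartAt (𝓡 2) p).target :=
  (ContinuousAlternatingMap.apply ℝ (EuclideanSpace ℝ (Fin 2)) ℝ
    fun _ : Fin 1 => EuclideanSpace.single k 1).contDiff.comp_contDiffOn (hβ p)

theorem pd_chartCovec_comm {β : Form 2 1 S} (hβ : IsSmoothForm β) (hβc : ∀ q, extDerivM β q = 0)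
    (p : S) {x : EuclideanSpace ℝ (Fin 2)} (hx : x ∈ (extChartAt (𝓡 2) p).target) :
    pd 0 (chartCovec β p 1) x = pd 1 (chartCovec β p 0) x := by
  let e : Fin 2 → EuclideanSpace ℝ (Fin 2) := fun k => EuclideanSpace.single k 1
  have hd : DifferentiableAt ℝ (chartForm β p) x := ((hβ p).contDiffAt
    ((isOpen_extChartAt_target_euclidean (n := 2) p).mem_nhds hx)).differentiableAt (by simp)
  have h1 := congrArg (fun η => η ![e 0, e 1]) (extDeriv_chartForm β p hx hd)
  rw [hβc] at h1
  have h2 : extDeriv (chartForm β p) x ![e 0, e 1] = 0 := h1.trans rfl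
  have hj : Fin.removeNth 0 ![e 0, e 1] = fun _ => e 1 := by
    funext a; fin_cases a; rfl
  have hi : Fin.removeNth 1 ![e 0, e 1] = fun _ => e 0 := by
    funext a; fin_cases a; rfl
  rw [extDeriv_apply hd, Fin.sum_univ_two, hi, hj] at h2
  have h3 : (-1 : ℤ) ^ (0 : Fin 2).val • pd 0 (chartCovec β p 1) x +
      (-1 : ℤ) ^ (1 : Fin 2).val • pd 1 (chartCovec β p 0) x = 0 := h2
  simp at h3
  linarith

theorem pd_comp_symm {F : S → ℝ} (p : S) (k : Fin 2) {x : EuclideanSpace ℝ (Fin 2)}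
    (hx : x ∈ (extChartAt (𝓡 2) p).target)
    (hF : MDifferentiableAt (𝓡 2) 𝓘(ℝ, ℝ) F ((extChartAt (𝓡 2) p).symm x)) :
    pd k (fun y => F ((extChartAt (𝓡 2) p).symm y)) x =
      differential F ((extChartAt (𝓡 2) p).symm x) (chartFrame p k x) := by
  have h2 := mfderiv_comp x hF
    (((contMDiffOn_extChartAt_symm (I := 𝓡 2) (n := ∞) p).contMDiffAt
      ((isOpen_extChartAt_target_euclidean (n := 2) p).mem_nhds hx)).mdifferentiableAt (by simp))
  have h3 := (mfderiv_eq_fderiv (f := F ∘ (extChartAt (𝓡 2) p).symm)).symm.trans h2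
  exact DFunLike.congr_fun h3 (EuclideanSpace.single k (1 : ℝ))

theorem wedgeQuotient_mul_chartArea {σ : Form 2 2 S} (hσ : IsSymplecticForm σ) (β : Form 2 1 S)
    {F : S → ℝ} (p : S) {x : EuclideanSpace ℝ (Fin 2)} (hx : x ∈ (extChartAt (𝓡 2) p).target)
    (hF : MDifferentiableAt (𝓡 2) 𝓘(ℝ, ℝ) F ((extChartAt (𝓡 2) p).symm x)) :
    wedgeQuotient σ β F ((extChartAt (𝓡 2) p).symm x) * chartArea σ p x =
      pd 0 (fun y => F ((extChartAt (𝓡 2) p).symm y)) x * chartCovec β p 1 x -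
      pd 1 (fun y => F ((extChartAt (𝓡 2) p).symm y)) x * chartCovec β p 0 x := by
  rw [pd_comp_symm p 0 hx hF, pd_comp_symm p 1 hx hF]
  refine Eq.trans ?_ (wedgeQuotient_mul β F _ (exists_area_ne_zero hσ _) (chartFrame p 0 x)
    (chartFrame p 1 x))
  refine congrArg (fun c => wedgeQuotient σ β F ((extChartAt (𝓡 2) p).symm x) * c) ?_
  refine congrArg (σ ((extChartAt (𝓡 2) p).symm x)) ?_
  funext k; fin_cases k <;> rfl

end Stokes

section StokesIntegral

variable {S : Type*} [TopologicalSpace S] [ChartedSpace (EuclideanSpace ℝ (Fin 2)) S]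

/-- The integral of `g |σ|` over the preferred chart at `p`. -/
noncomputable def chartIntegral (σ : Form 2 2 S) (p : S) (g : S → ℝ) : ℝ :=
  ∫ x in (extChartAt (𝓡 2) p).target, g ((extChartAt (𝓡 2) p).symm x) * |chartArea σ p x|

variable [IsManifold (𝓡 2) ∞ S] {σ : Form 2 2 S} {β : Form 2 1 S}

theorem continuous_wedgeQuotient (hσ : IsSymplecticForm σ) (hβ : IsSmoothForm β) {F : S → ℝ}
    (hF : ContMDiff (𝓡 2) 𝓘(ℝ, ℝ) ∞ F) : Continuous (wedgeQuotient σ β F) := by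
  rw [continuous_iff_continuousAt]
  intro p
  have hT := isOpen_extChartAt_target_euclidean (n := 2) p
  have hf : ContDiffOn ℝ ∞ (fun y => F ((extChartAt (𝓡 2) p).symm y))
      (extChartAt (𝓡 2) p).target :=
    (hF.comp_contMDiffOn (contMDiffOn_extChartAt_symm (I := 𝓡 2) (n := ∞) p)).contDiffOn
  have h1 : ContinuousOn (fun x => (pd 0 (fun y => F ((extChartAt (𝓡 2) p).symm y)) x *
      chartCovec β p 1 x - pd 1 (fun y => F ((extChartAt (𝓡 2) p).symm y)) x *
        chartCovec β p 0 x) / chartArea σ p x) (extChartAt (𝓡 2) p).target := by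
    have hpd : ∀ k, ContinuousOn (pd k (fun y => F ((extChartAt (𝓡 2) p).symm y)))
        (extChartAt (𝓡 2) p).target := fun k =>
      (contDiffOn_pd (m' := 0) hT k hf (by simp)).continuousOn
    have hb := fun k => (contDiffOn_chartCovec hβ p k).continuousOn
    exact (((hpd 0).mul (hb 1)).sub ((hpd 1).mul (hb 0))).div
      (contDiffOn_chartArea hσ.smooth p).continuousOn fun x hx => chartArea_ne_zero hσ p hx
  have h2 := (h1.continuousAt (hT.mem_nhds (mem_extChartAt_target p))).comp
    (continuousAt_extChartAt (I := 𝓡 2) p)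
  refine h2.congr ?_
  filter_upwards [(isOpen_extChartAt_source (I := 𝓡 2) p).mem_nhds (mem_extChartAt_source p)]
    with q hq
  have hqt := (extChartAt (𝓡 2) p).map_source hq
  have h3 := wedgeQuotient_mul_chartArea hσ β (F := F) p hqt (hF.mdifferentiableAt (by simp))
  rw [(extChartAt (𝓡 2) p).left_inv hq] at h3
  rw [Function.comp_apply, ← h3, mul_div_assoc, div_self (chartArea_ne_zero hσ p hqt), mul_one]

omit [IsManifold (𝓡 2) ∞ S] in
theorem isCompact_image_tsupport [CompactSpace S] {p : S} {g : S → ℝ}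
    (hg : tsupport g ⊆ (extChartAt (𝓡 2) p).source) :
    IsCompact (extChartAt (𝓡 2) p '' tsupport g) :=
  (isClosed_tsupport g).isCompact.image_of_continuousOn ((continuousOn_extChartAt p).mono hg)

omit [IsManifold (𝓡 2) ∞ S] in
theorem eq_zero_of_notMem_image_tsupport {p : S} {g : S → ℝ} {x : EuclideanSpace ℝ (Fin 2)}
    (hx : x ∈ (extChartAt (𝓡 2) p).target) (hxK : x ∉ extChartAt (𝓡 2) p '' tsupport g) :
    g ((extChartAt (𝓡 2) p).symm x) = 0 := by
  by_contra h
  exact hxK ⟨_, subset_tsupport g h, (extChartAt (𝓡 2) p).right_inv hx⟩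

omit [IsManifold (𝓡 2) ∞ S] in
theorem integrableOn_chart [CompactSpace S] (hσ : IsSmoothForm σ) {p : S} {g : S → ℝ}
    (hg : Continuous g) (hgs : tsupport g ⊆ (extChartAt (𝓡 2) p).source) :
    IntegrableOn (fun x => g ((extChartAt (𝓡 2) p).symm x) * |chartArea σ p x|)
      (extChartAt (𝓡 2) p).target := by
  have hT := isOpen_extChartAt_target_euclidean (n := 2) p
  have hKT : extChartAt (𝓡 2) p '' tsupport g ⊆ (extChartAt (𝓡 2) p).target := by
    rintro _ ⟨q, hq, rfl⟩
    exact (extChartAt (𝓡 2) p).map_source (hgs hq)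
  have hc : ContinuousOn (fun x => g ((extChartAt (𝓡 2) p).symm x) * |chartArea σ p x|)
      (extChartAt (𝓡 2) p).target :=
    (hg.comp_continuousOn (continuousOn_extChartAt_symm p)).mul
      (contDiffOn_chartArea hσ p).continuousOn.abs
  refine ((hc.mono hKT).integrableOn_compact
    (isCompact_image_tsupport hgs)).of_forall_sdiff_eq_zero hT.measurableSet fun x hx => ?_
  rw [eq_zero_of_notMem_image_tsupport hx.1 hx.2, zero_mul]

omit [IsManifold (𝓡 2) ∞ S] in
theorem chartIntegral_sum [CompactSpace S] (hσ : IsSmoothForm σ) {p : S} {ι : Type*} [Fintype ι]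
    {g : ι → S → ℝ} (hg : ∀ i, Continuous (g i))
    (hgs : ∀ i, tsupport (g i) ⊆ (extChartAt (𝓡 2) p).source) :
    chartIntegral σ p (fun q => ∑ i, g i q) = ∑ i, chartIntegral σ p (g i) := by
  simp only [chartIntegral, Finset.sum_mul]
  exact integral_finsetSum _ fun i _ => integrableOn_chart hσ (hg i) (hgs i)

/-- Stokes' theorem in a chart: `∫ dF ∧ β = 0` if `β` is closed and `F` is supported in the
chart. -/
theorem chartIntegral_wedgeQuotient_eq_zero [CompactSpace S] (hσ : IsSymplecticForm σ)
    (hβ : IsSmoothForm β) (hβc : ∀ q, extDerivM β q = 0) {p : S} {F : S → ℝ}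
    (hF : ContMDiff (𝓡 2) 𝓘(ℝ, ℝ) ∞ F) (hFs : tsupport F ⊆ (extChartAt (𝓡 2) p).source) :
    chartIntegral σ p (wedgeQuotient σ β F) = 0 := by
  set T := (extChartAt (𝓡 2) p).target with hTdef
  have hT : IsOpen T := isOpen_extChartAt_target_euclidean (n := 2) p
  set K := extChartAt (𝓡 2) p '' tsupport F with hKdef
  have hK : IsCompact K := isCompact_image_tsupport hFs
  have hKT : K ⊆ T := by
    rintro _ ⟨q, hq, rfl⟩
    exact (extChartAt (𝓡 2) p).map_source (hFs hq)
  set f : EuclideanSpace ℝ (Fin 2) → ℝ := fun y => F ((extChartAt (𝓡 2) p).symm y) with hfdef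
  have hf : ContDiffOn ℝ ∞ f T :=
    (hF.comp_contMDiffOn (contMDiffOn_extChartAt_symm (I := 𝓡 2) (n := ∞) p)).contDiffOn
  have hb := fun k => contDiffOn_chartCovec hβ p k
  have ha := contDiffOn_chartArea hσ.smooth p
  -- The one-form `± F β`, with the sign making the orientation of the chart agree with `σ`.
  set u : Fin 2 → EuclideanSpace ℝ (Fin 2) → ℝ := fun k =>
    T.indicator fun y => (if 0 < chartArea σ p y then 1 else -1) * (f y * chartCovec β p k y)
    with hu
  have hloc : ∀ x ∈ T, ∃ c : ℝ, |chartArea σ p x| = c * chartArea σ p x ∧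
      ∀ k, u k =ᶠ[𝓝 x] fun y => c * (f y * chartCovec β p k y) := by
    intro x hx
    have hac := ha.continuousOn.continuousAt (hT.mem_nhds hx)
    rcases lt_or_gt_of_ne (chartArea_ne_zero hσ p hx) with h | h
    · refine ⟨-1, by rw [abs_of_neg h]; ring, fun k => ?_⟩
      filter_upwards [hT.mem_nhds hx, hac.eventually (gt_mem_nhds h)] with y hy hy'
      simp only [hu, indicator_of_mem hy, if_neg hy'.not_gt]
    · refine ⟨1, by rw [abs_of_pos h]; ring, fun k => ?_⟩
      filter_upwards [hT.mem_nhds hx, hac.eventually (lt_mem_nhds h)] with y hy hy'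
      simp only [hu, indicator_of_mem hy, if_pos hy']
  have hu0 : ∀ k, ∀ y, y ∉ K → u k y = 0 := by
    intro k y hy
    by_cases hyT : y ∈ T
    · simp only [hu, indicator_of_mem hyT, hfdef, eq_zero_of_notMem_image_tsupport hyT hy,
        zero_mul, mul_zero]
    · simp only [hu, indicator_of_notMem hyT]
  have hu0' : ∀ k, ∀ x, x ∉ K → u k =ᶠ[𝓝 x] fun _ => 0 := by
    intro k x hx
    filter_upwards [hK.isClosed.isOpen_compl.mem_nhds hx] with y hy using hu0 k y hy
  have hus : ∀ k, ContDiff ℝ 1 (u k) := by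
    intro k
    rw [contDiff_iff_contDiffAt]
    intro x
    by_cases hx : x ∈ T
    · obtain ⟨c, -, hc⟩ := hloc x hx
      refine ContDiffAt.congr_of_eventuallyEq ?_ (hc k)
      exact contDiffAt_const.mul (((hf.contDiffAt (hT.mem_nhds hx)).of_le (by simp)).mul
        (((hb k).contDiffAt (hT.mem_nhds hx)).of_le (by simp)))
    · exact contDiffAt_const.congr_of_eventuallyEq (hu0' k x fun h => hx (hKT h))
  have huc : ∀ k, HasCompactSupport (u k) := fun k => HasCompactSupport.intro hK (hu0 k)
  have hpd0 : ∀ k l, ∀ x, x ∉ K → pd l (u k) x = 0 := by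
    intro k l x hx
    rw [pd_eq_of_eventuallyEq l (hu0' k x hx)]
    simp [pd]
  have hpdi : ∀ k l, Integrable (pd l (u k)) := fun k l =>
    (contDiff_pd (m' := 0) l (hus k) (by norm_num)).continuous.integrable_of_hasCompactSupport
      (HasCompactSupport.intro hK (hpd0 k l))
  have hkey : ∀ x ∈ T, wedgeQuotient σ β F ((extChartAt (𝓡 2) p).symm x) * |chartArea σ p x| =
      pd 0 (u 1) x - pd 1 (u 0) x := by
    intro x hx
    obtain ⟨c, hac, hc⟩ := hloc x hx
    have hfd := differentiableAt_of_contDiffOn_infty hT hf hx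
    have hbd := fun k => differentiableAt_of_contDiffOn_infty hT (hb k) hx
    have h1 := wedgeQuotient_mul_chartArea hσ β (F := F) p hx (hF.mdifferentiableAt (by simp))
    have h2 := pd_chartCovec_comm hβ hβc p hx
    rw [pd_eq_of_eventuallyEq _ (hc 1), pd_eq_of_eventuallyEq _ (hc 0),
      pd_const_mul _ _ (hfd.fun_mul (hbd 1)), pd_const_mul _ _ (hfd.fun_mul (hbd 0)),
      pd_mul _ hfd (hbd 1), pd_mul _ hfd (hbd 0), h2, hac]
    linear_combination c * h1
  rw [chartIntegral, setIntegral_congr_fun hT.measurableSet hkey,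
    setIntegral_eq_integral_of_forall_compl_eq_zero, integral_sub (hpdi 1 0) (hpdi 0 1),
    integral_pd_eq_zero 0 (hus 1) (huc 1), integral_pd_eq_zero 1 (hus 0) (huc 0), sub_zero]
  intro x hx
  have hxK : x ∉ K := fun h => hx (hKT h)
  rw [hpd0 1 0 x hxK, hpd0 0 1 x hxK, sub_zero]

/-- The integral `∫ g |σ|` may be computed in any chart that contains the support of `g`. -/
theorem chartIntegral_eq (σ : Form 2 2 S) {p p' : S} {g : S → ℝ}
    (hg : ∀ q, g q ≠ 0 → q ∈ (extChartAt (𝓡 2) p).source)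
    (hg' : ∀ q, g q ≠ 0 → q ∈ (extChartAt (𝓡 2) p').source) :
    chartIntegral σ p g = chartIntegral σ p' g := by
  have hsub : ∀ {p p' : S}, (∀ q, g q ≠ 0 → q ∈ (extChartAt (𝓡 2) p').source) →
      chartIntegral σ p g = ∫ x in (extChartAt (𝓡 2) p).target ∩
        (extChartAt (𝓡 2) p).symm ⁻¹' (extChartAt (𝓡 2) p').source,
          g ((extChartAt (𝓡 2) p).symm x) * |chartArea σ p x| := by
    intro p p' h
    refine setIntegral_eq_of_subset_of_forall_sdiff_eq_zero
      (isOpen_extChartAt_target_euclidean (n := 2) p).measurableSet inter_subset_left ?_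
    rintro x ⟨hx, hx'⟩
    have : g ((extChartAt (𝓡 2) p).symm x) = 0 := by
      by_contra h0
      exact hx' ⟨hx, h _ h0⟩
    rw [this, zero_mul]
  rw [hsub hg', hsub (p := p') hg]
  set φ := extChartAt (𝓡 2) p with hφ
  set φ' := extChartAt (𝓡 2) p' with hφ'
  have himage : φ'.target ∩ φ'.symm ⁻¹' φ.source =
      (φ' ∘ φ.symm) '' (φ.target ∩ φ.symm ⁻¹' φ'.source) := by
    ext y
    constructor
    · rintro ⟨hy, hy'⟩
      refine ⟨φ (φ'.symm y), ⟨φ.map_source hy', ?_⟩, ?_⟩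
      · rw [mem_preimage, φ.left_inv hy']
        exact φ'.map_target hy
      · rw [Function.comp_apply, φ.left_inv hy', φ'.right_inv hy]
    · rintro ⟨x, ⟨hx, hx'⟩, rfl⟩
      refine ⟨φ'.map_source hx', ?_⟩
      rw [mem_preimage, Function.comp_apply, φ'.left_inv hx']
      exact φ.map_target hx
  have hmeas : MeasurableSet (φ.target ∩ φ.symm ⁻¹' φ'.source) :=
    ((continuousOn_extChartAt_symm p).isOpen_inter_preimage
      (isOpen_extChartAt_target_euclidean (n := 2) p) (isOpen_extChartAt_source p')).measurableSet
  have hinj : InjOn (φ' ∘ φ.symm) (φ.target ∩ φ.symm ⁻¹' φ'.source) := by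
    rintro x ⟨hx, hx'⟩ y ⟨hy, hy'⟩ h
    exact φ.symm.injOn hx hy (φ'.injOn hx' hy' h)
  rw [himage, integral_image_eq_integral_abs_det_fderiv_smul volume hmeas
    (fun x hx => ((contDiffAt_transition p p' hx.1 hx.2).differentiableAt
      (by simp)).hasFDerivAt.hasFDerivWithinAt) hinj]
  refine setIntegral_congr_fun hmeas fun x hx => ?_
  simp only [smul_eq_mul, chartArea_transition σ p p' hx.1 hx.2, abs_mul]
  rw [Function.comp_apply, φ'.left_inv hx.2]
  ring

theorem eq_zero_of_chartIntegral_eq_zero [CompactSpace S] (hσ : IsSymplecticForm σ) {p : S}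
    {g : S → ℝ} (hg : Continuous g) (hg0 : ∀ q, 0 ≤ g q)
    (hgs : tsupport g ⊆ (extChartAt (𝓡 2) p).source) (h : chartIntegral σ p g = 0) (q : S) :
    g q = 0 := by
  by_contra hq
  have hT := isOpen_extChartAt_target_euclidean (n := 2) p
  have hqs := hgs (subset_tsupport g hq)
  have h1 := (setIntegral_eq_zero_iff_of_nonneg_ae (Eventually.of_forall fun x =>
    mul_nonneg (hg0 _) (abs_nonneg _)) (integrableOn_chart hσ.smooth hg hgs)).1 h
  have h2 := Measure.eqOn_open_of_ae_eq h1 hT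
    ((hg.comp_continuousOn (continuousOn_extChartAt_symm p)).mul
      (contDiffOn_chartArea hσ.smooth p).continuousOn.abs) continuousOn_const
    ((extChartAt (𝓡 2) p).map_source hqs)
  simp only [(extChartAt (𝓡 2) p).left_inv hqs, Pi.zero_apply] at h2
  exact mul_ne_zero hq (abs_ne_zero.2 (chartArea_ne_zero hσ p
    ((extChartAt (𝓡 2) p).map_source hqs))) h2

/-- On a compact surface, `dH ∧ β` cannot have a sign with respect to an area form when `β` is
closed: its integral vanishes by Stokes' theorem. -/
theorem eq_zero_of_wedgeQuotient_eq_neg [CompactSpace S] [T2Space S] (hσ : IsSymplecticForm σ)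
    (hβ : IsSmoothForm β) (hβc : ∀ q, extDerivM β q = 0) {H : S → ℝ}
    (hH : ContMDiff (𝓡 2) 𝓘(ℝ, ℝ) ∞ H) {e : S → ℝ} (he0 : ∀ q, 0 ≤ e q)
    (heq : ∀ q, wedgeQuotient σ β H q = - e q) (q : S) : e q = 0 := by
  have hec : Continuous e := by
    have : e = fun q => - wedgeQuotient σ β H q := by funext q; rw [heq, neg_neg]
    rw [this]
    exact (continuous_wedgeQuotient hσ hβ hH).neg
  obtain ⟨N, c, hc⟩ : ∃ (N : ℕ) (c : Fin N → S), univ ⊆ ⋃ i, (extChartAt (𝓡 2) (c i)).source := by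
    obtain ⟨t, ht⟩ := isCompact_univ.elim_nhds_subcover
      (fun p : S => (extChartAt (𝓡 2) p).source) fun p _ => extChartAt_source_mem_nhds p
    refine ⟨t.card, fun i => (t.equivFin.symm i : S), fun p hp => ?_⟩
    obtain ⟨p', hp', hpp'⟩ := mem_iUnion₂.1 (ht.2 hp)
    exact mem_iUnion.2 ⟨t.equivFin ⟨p', hp'⟩, by simpa using hpp'⟩
  obtain ⟨ρ, hρ⟩ := SmoothPartitionOfUnity.exists_isSubordinate (𝓡 2) isClosed_univ
    (fun i => (extChartAt (𝓡 2) (c i)).source) (fun i => isOpen_extChartAt_source (c i)) hc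
  have hρ1 : ∀ q, ∑ i, ρ i q = 1 := fun q => by
    rw [← ρ.sum_eq_one (mem_univ q), finsum_eq_sum_of_fintype]
  have hρH : ∀ k, ContMDiff (𝓡 2) 𝓘(ℝ, ℝ) ∞ fun q => ρ k q * H q := fun k =>
    (ρ k).contMDiff.mul hH
  set G : Fin N → S → ℝ := fun k => wedgeQuotient σ β fun q => ρ k q * H q with hG
  have hGc : ∀ k, Continuous (G k) := fun k => continuous_wedgeQuotient hσ hβ (hρH k)
  have hsum : ∀ q, ∑ k, G k q = - e q := by
    intro q
    rw [← heq q, hG]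
    simp only
    rw [← wedgeQuotient_sum β (fun k q => ρ k q * H q) q (exists_area_ne_zero hσ q)
      fun k => (hρH k).mdifferentiableAt (by simp)]
    congr 1
    funext s
    rw [← Finset.sum_mul, hρ1, one_mul]
  have hGs : ∀ k, tsupport (G k) ⊆ (extChartAt (𝓡 2) (c k)).source := by
    intro k
    refine (closure_minimal (fun q hq => ?_) (isClosed_tsupport (ρ k))).trans (hρ k)
    by_contra hqk
    have hev : (fun q => ρ k q * H q) =ᶠ[𝓝 q] fun _ => 0 := by
      filter_upwards [(isClosed_tsupport (ρ k)).isOpen_compl.mem_nhds hqk] with q' hq'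
      rw [image_eq_zero_of_notMem_tsupport hq', zero_mul]
    have hd : differential (fun q => ρ k q * H q) q = 0 := by
      rw [differential, hev.mfderiv_eq]
      exact mfderiv_const
    apply hq
    have h0 : ∀ v, differential (fun q => ρ k q * H q) q v = 0 := fun v => DFunLike.congr_fun hd v
    exact wedgeQuotient_eq_of_forall β _ q (exists_area_ne_zero hσ q) fun v w => by simp [h0]
  have hρc : ∀ i, Continuous (ρ i) := fun i => (ρ i).contMDiff.continuous
  have hli : ∀ i (g : S → ℝ), tsupport (fun q => ρ i q * g q) ⊆ (extChartAt (𝓡 2) (c i)).source :=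
    fun i g => (tsupport_mul_subset_left (f := ρ i) (g := g)).trans (hρ i)
  have hri : ∀ i k, tsupport (fun q => ρ i q * G k q) ⊆ (extChartAt (𝓡 2) (c k)).source :=
    fun i k => (tsupport_mul_subset_right (f := ρ i) (g := G k)).trans (hGs k)
  -- the double sum of `∫ ρᵢ Gₖ |σ|` is evaluated in two ways: over `i` first it vanishes by Stokes'
  -- theorem in the `k`-th chart, over `k` first it is the integral of `-e`
  have hswap : ∀ i k, chartIntegral σ (c i) (fun q => ρ i q * G k q) =
      chartIntegral σ (c k) (fun q => ρ i q * G k q) := fun i k =>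
    chartIntegral_eq σ (fun q hq => hli i _ (subset_tsupport _ hq))
      (fun q hq => hri i k (subset_tsupport _ hq))
  have hk : ∀ k, ∑ i, chartIntegral σ (c k) (fun q => ρ i q * G k q) = 0 := by
    intro k
    rw [← chartIntegral_sum (g := fun i q => ρ i q * G k q) hσ.smooth
      (fun i => (hρc i).mul (hGc k)) (hri · k)]
    simp only [← Finset.sum_mul, hρ1, one_mul]
    exact chartIntegral_wedgeQuotient_eq_zero hσ hβ hβc (hρH k)
      ((tsupport_mul_subset_left (f := ρ k) (g := H)).trans (hρ k))
  have hi : ∀ i, ∑ k, chartIntegral σ (c i) (fun q => ρ i q * G k q) =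
      - chartIntegral σ (c i) (fun q => ρ i q * e q) := by
    intro i
    rw [← chartIntegral_sum (g := fun k q => ρ i q * G k q) hσ.smooth
      (fun k => (hρc i).mul (hGc k)) fun k => hli i _]
    simp only [← Finset.mul_sum, hsum, chartIntegral, mul_neg, neg_mul, integral_neg]
  have htot : ∑ i, chartIntegral σ (c i) (fun q => ρ i q * e q) = 0 := by
    have h1 : ∑ i, ∑ k, chartIntegral σ (c i) (fun q => ρ i q * G k q) = 0 := by
      rw [Finset.sum_congr rfl fun i _ => Finset.sum_congr rfl fun k _ => hswap i k,
        Finset.sum_comm]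
      exact Finset.sum_eq_zero fun k _ => hk k
    rw [Finset.sum_congr rfl fun i _ => hi i, Finset.sum_neg_distrib, neg_eq_zero] at h1
    exact h1
  have hnn : ∀ i q, 0 ≤ ρ i q * e q := fun i q => mul_nonneg (ρ.nonneg i q) (he0 q)
  have hzero := (Finset.sum_eq_zero_iff_of_nonneg fun i _ => integral_nonneg fun x =>
    mul_nonneg (hnn i _) (abs_nonneg _)).1 htot
  have h1 : ∀ i, ρ i q * e q = 0 := fun i =>
    eq_zero_of_chartIntegral_eq_zero hσ ((hρc i).mul hec) (hnn i) (hli i e)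
      (hzero i (Finset.mem_univ i)) q
  rw [← one_mul (e q), ← hρ1 q, Finset.sum_mul]
  exact Finset.sum_eq_zero fun i _ => h1 i

end StokesIntegral

/-! ### The one-form of a Beltrami field on an invariant surface -/

section Pullback

variable {M : Type*} [TopologicalSpace M]
    [ChartedSpace (EuclideanSpace ℝ (Fin 3)) M] [IsManifold (𝓡 3) ∞ M]
    {S : Type*} [TopologicalSpace S] [ChartedSpace (EuclideanSpace ℝ (Fin 2)) S]
    [IsManifold (𝓡 2) ∞ S]

/-- The pullback of a differential form on `M` under a map `j : S → M`. -/
noncomputable def pullbackForm {k : ℕ} (j : S → M) (η : Form 3 k M) : Form 2 k S := fun s =>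
  (η (j s)).compContinuousLinearMap (mfderiv (𝓡 2) (𝓡 3) j s)

theorem chartForm_pullbackForm {k : ℕ} {j : S → M} (hj : ContMDiff (𝓡 2) (𝓡 3) ∞ j)
    (η : Form 3 k M) (p : S) (q : M) {x : EuclideanSpace ℝ (Fin 2)}
    (hx : x ∈ (extChartAt (𝓡 2) p).target)
    (hxq : j ((extChartAt (𝓡 2) p).symm x) ∈ (extChartAt (𝓡 3) q).source) :
    chartForm (pullbackForm j η) p x =
      (chartForm η q (extChartAt (𝓡 3) q (j ((extChartAt (𝓡 2) p).symm x)))).compContinuousLinearMap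
        (fderiv ℝ (fun y => extChartAt (𝓡 3) q (j ((extChartAt (𝓡 2) p).symm y))) x) := by
  have hψ := ((contMDiffOn_extChartAt_symm (I := 𝓡 2) (n := ∞) p).contMDiffAt
      ((isOpen_extChartAt_target_euclidean (n := 2) p).mem_nhds hx)).mdifferentiableAt (by simp)
  have hjd := (hj ((extChartAt (𝓡 2) p).symm x)).mdifferentiableAt (by simp)
  have hφ := mdifferentiableAt_extChartAt (I := 𝓡 3) (x := q) (by simpa using hxq)
  have hD := (mfderiv_eq_fderiv (f := extChartAt (𝓡 3) q ∘ j ∘ (extChartAt (𝓡 2) p).symm)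
    (x := x)).symm.trans ((mfderiv_comp x hφ (hjd.comp x hψ)).trans
      (congrArg (fun L => (mfderiv (𝓡 3) 𝓘(ℝ, EuclideanSpace ℝ (Fin 3)) (extChartAt (𝓡 3) q)
        (j ((extChartAt (𝓡 2) p).symm x))) ∘L L) (mfderiv_comp x hjd hψ)))
  rw [chartForm_extChartAt η q hxq]
  ext v
  refine congrArg (η (j ((extChartAt (𝓡 2) p).symm x))) ?_
  funext a
  have h1 := DFunLike.congr_fun hD (v a)
  refine (mfderiv_symm_comp_mfderiv q hxq _).symm.trans ?_
  exact congrArg (mfderiv 𝓘(ℝ, EuclideanSpace ℝ (Fin 3)) (𝓡 3) (extChartAt (𝓡 3) q).symm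
    (extChartAt (𝓡 3) q (j ((extChartAt (𝓡 2) p).symm x)))) h1.symm

/-- The exterior derivative commutes with pullbacks. -/
theorem extDerivM_pullbackForm {k : ℕ} {j : S → M} (hj : ContMDiff (𝓡 2) (𝓡 3) ∞ j)
    (η : Form 3 k M) (hη : IsSmoothForm η) (p : S) (v : Fin (k + 1) → TangentSpace (𝓡 2) p) :
    extDerivM (pullbackForm j η) p v =
      extDerivM η (j p) fun a => mfderiv (𝓡 2) (𝓡 3) j p (v a) := by
  set x := extChartAt (𝓡 2) p p with hx
  have hxt : x ∈ (extChartAt (𝓡 2) p).target := mem_extChartAt_target p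
  have hxp : (extChartAt (𝓡 2) p).symm x = p := extChartAt_to_inv p
  set G : EuclideanSpace ℝ (Fin 2) → EuclideanSpace ℝ (Fin 3) := fun y =>
    extChartAt (𝓡 3) (j p) (j ((extChartAt (𝓡 2) p).symm y)) with hG
  have hGx : G x = extChartAt (𝓡 3) (j p) (j p) := by simp only [hG, hxp]
  have hev : chartForm (pullbackForm j η) p =ᶠ[𝓝 x]
      fun y => (chartForm η (j p) (G y)).compContinuousLinearMap (fderiv ℝ G y) := by
    have hc : ContinuousAt (fun y => j ((extChartAt (𝓡 2) p).symm y)) x :=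
      hj.continuous.continuousAt.comp (continuousAt_extChartAt_symm p)
    have hs : (extChartAt (𝓡 3) (j p)).source ∈ 𝓝 (j ((extChartAt (𝓡 2) p).symm x)) := by
      rw [hxp]
      exact extChartAt_source_mem_nhds (j p)
    filter_upwards [(isOpen_extChartAt_target_euclidean (n := 2) p).mem_nhds hxt,
      hc.eventually hs] with y hy hy'
    exact chartForm_pullbackForm hj η p (j p) hy hy'
  have hGs : ContDiffAt ℝ ∞ G x := by
    rw [← contMDiffAt_iff_contDiffAt]
    have h1 : ContMDiffAt (𝓡 3) 𝓘(ℝ, EuclideanSpace ℝ (Fin 3)) ∞ (extChartAt (𝓡 3) (j p))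
        (j ((extChartAt (𝓡 2) p).symm x)) := by
      rw [hxp]
      exact contMDiffAt_extChartAt
    exact h1.comp x ((hj _).comp x ((contMDiffOn_extChartAt_symm (I := 𝓡 2) (n := ∞) p).contMDiffAt
      ((isOpen_extChartAt_target_euclidean (n := 2) p).mem_nhds hxt)))
  have hd : DifferentiableAt ℝ (chartForm η (j p)) (G x) := by
    rw [hGx]
    exact ((hη (j p)).contDiffAt ((isOpen_extChartAt_target_euclidean (n := 3) (j p)).mem_nhds
      (mem_extChartAt_target (j p)))).differentiableAt (by simp)
  have hpull := extDeriv_pullback hd hGs (by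
    simpa using WithTop.coe_le_coe.2 (le_top : (2 : ℕ∞) ≤ ⊤))
  rw [← hev.extDeriv_eq, hGx] at hpull
  have hGd : ∀ w : TangentSpace (𝓡 2) p, fderiv ℝ G x
      (mfderiv (𝓡 2) 𝓘(ℝ, EuclideanSpace ℝ (Fin 2)) (extChartAt (𝓡 2) p) p w) =
      mfderiv (𝓡 3) 𝓘(ℝ, EuclideanSpace ℝ (Fin 3)) (extChartAt (𝓡 3) (j p)) (j p)
        (mfderiv (𝓡 2) (𝓡 3) j p w) := by
    intro w
    have hjd := (hj p).mdifferentiableAt (by simp)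
    have hφ := mdifferentiableAt_extChartAt (I := 𝓡 3) (x := j p) (mem_chart_source _ (j p))
    have hφ2 := mdifferentiableAt_extChartAt (I := 𝓡 2) (x := p) (mem_chart_source _ p)
    have h1 := mfderiv_comp p hφ hjd
    have hGd' : MDifferentiableAt 𝓘(ℝ, EuclideanSpace ℝ (Fin 2)) 𝓘(ℝ, EuclideanSpace ℝ (Fin 3)) G
      (extChartAt (𝓡 2) p p) := (hGs.differentiableAt (by simp)).mdifferentiableAt
    have h2 := mfderiv_comp p hGd' hφ2
    have h3 : G ∘ extChartAt (𝓡 2) p =ᶠ[𝓝 p] extChartAt (𝓡 3) (j p) ∘ j := by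
      filter_upwards [extChartAt_source_mem_nhds (I := 𝓡 2) p] with s hs
      simp only [hG, Function.comp_apply, (extChartAt (𝓡 2) p).left_inv hs]
    rw [h3.mfderiv_eq] at h2
    have h4 := DFunLike.congr_fun (h2.symm.trans h1) w
    rw [mfderiv_eq_fderiv] at h4
    exact h4
  have h5 := congrArg (fun θ => θ fun a => (mfderiv (𝓡 2) 𝓘(ℝ, EuclideanSpace ℝ (Fin 2))
    (extChartAt (𝓡 2) p) p (v a) : EuclideanSpace ℝ (Fin 2))) hpull
  refine Eq.trans h5 ?_
  refine congrArg (extDeriv (chartForm η (j p)) (extChartAt (𝓡 3) (j p) (j p))) ?_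
  funext a
  exact hGd (v a)

/-- The pullback of a smooth one-form is smooth. -/
theorem isSmoothForm_pullbackForm {j : S → M} (hj : ContMDiff (𝓡 2) (𝓡 3) ∞ j)
    {η : Form 3 1 M} (hη : IsSmoothForm η) : IsSmoothForm (pullbackForm j η) := by
  intro p
  refine contDiffOn_form_of_components fun i x hx => ContDiffAt.contDiffWithinAt ?_
  have hT := isOpen_extChartAt_target_euclidean (n := 2) p
  set q := j ((extChartAt (𝓡 2) p).symm x) with hq
  set G : EuclideanSpace ℝ (Fin 2) → EuclideanSpace ℝ (Fin 3) := fun y =>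
    extChartAt (𝓡 3) q (j ((extChartAt (𝓡 2) p).symm y)) with hG
  have hψ := (contMDiffOn_extChartAt_symm (I := 𝓡 2) (n := ∞) p).contMDiffAt (hT.mem_nhds hx)
  have hjψ := (hj _).comp x hψ
  have hGs : ContDiffAt ℝ ∞ G x := by
    rw [← contMDiffAt_iff_contDiffAt]
    exact (contMDiffAt_extChartAt (I := 𝓡 3) (n := ∞) (x := q)).comp x hjψ
  let c : Fin 3 → EuclideanSpace ℝ (Fin 3) → ℝ := fun k y =>
    chartForm η q y fun _ => EuclideanSpace.single k 1
  have hexp : ∀ y w, (chartForm η q y fun _ => w) = ∑ k, w k * c k y := by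
    intro y w
    let L : EuclideanSpace ℝ (Fin 3) →L[ℝ] ℝ :=
      (ContinuousAlternatingMap.ofSubsingleton ℝ (EuclideanSpace ℝ (Fin 3)) ℝ (0 : Fin 1)).symm
        (chartForm η q y)
    have hw : w = ∑ k, w k • EuclideanSpace.single k (1 : ℝ) := by
      simpa using ((EuclideanSpace.basisFun (Fin 3) ℝ).sum_repr w).symm
    have h : L w = ∑ k, w k * L (EuclideanSpace.single k (1 : ℝ)) := by
      conv_lhs => rw [hw]
      simp only [map_sum, map_smul, smul_eq_mul]
    exact h
  have hev : (fun y => chartForm (pullbackForm j η) p y fun a => EuclideanSpace.single (i a) 1)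
      =ᶠ[𝓝 x] fun y => ∑ k, fderiv ℝ G y (EuclideanSpace.single (i 0) 1) k * c k (G y) := by
    filter_upwards [hT.mem_nhds hx, hjψ.continuousAt.eventually
      (extChartAt_source_mem_nhds (I := 𝓡 3) q)] with y hy hy'
    rw [chartForm_pullbackForm hj η p q hy hy', ← hexp]
    refine congrArg (chartForm η q (G y)) ?_
    funext a
    rw [Subsingleton.elim a 0]
    rfl
  refine ContDiffAt.congr_of_eventuallyEq (ContDiffAt.sum fun k _ => ContDiffAt.mul ?_ ?_) hev
  · exact (EuclideanSpace.proj (𝕜 := ℝ) k).contDiff.contDiffAt.comp x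
      ((hGs.fderiv_right (m := ∞) (by simp)).clm_apply contDiffAt_const)
  · have hqt : G x ∈ (extChartAt (𝓡 3) q).target := mem_extChartAt_target q
    exact ((ContinuousAlternatingMap.apply ℝ (EuclideanSpace ℝ (Fin 3)) ℝ
      fun _ : Fin 1 => EuclideanSpace.single k 1).contDiff.contDiffAt.comp _
      ((hη q).contDiffAt ((isOpen_extChartAt_target_euclidean (n := 3) q).mem_nhds hqt))).comp x hGs

end Pullback

section RestrictedBeltrami

variable {M : Type*} [TopologicalSpace M]
    [ChartedSpace (EuclideanSpace ℝ (Fin 3)) M] [IsManifold (𝓡 3) ∞ M]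
    [RiemannianBundle (fun p : M => TangentSpace (𝓡 3) p)]
    [IsContMDiffRiemannianBundle (𝓡 3) ∞ (EuclideanSpace ℝ (Fin 3))
      (fun p : M => TangentSpace (𝓡 3) p)]
    {S : Type*} [TopologicalSpace S] [ChartedSpace (EuclideanSpace ℝ (Fin 2)) S]
    [IsManifold (𝓡 2) ∞ S]
    {o : ∀ p : M, Orientation ℝ (TangentSpace (𝓡 3) p) (Fin 3)}
    {X : ∀ p : M, TangentSpace (𝓡 3) p} {j : S → M} {Y : ∀ s : S, TangentSpace (𝓡 2) s}

/-- If `X` is a Beltrami field tangent to a surface, then the restriction to the surface of the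
one-form `g(X, ·)` is closed: its differential is the restriction of the flux form `f ι_X μ`, which
vanishes because `X` is tangent. -/
theorem extDerivM_pullbackForm_flat (hX : IsRotationalBeltrami o X)
    (hj : ContMDiff (𝓡 2) (𝓡 3) ∞ j) (hY : ∀ s, mfderiv (𝓡 2) (𝓡 3) j s (Y s) = X (j s)) (s : S) :
    extDerivM (pullbackForm j (flat X)) s = 0 := by
  obtain ⟨hXs, -, f, -, -, hcurl⟩ := hX
  ext v
  rw [extDerivM_pullbackForm hj _ (isSmoothForm_flat hXs) s v, ← hcurl]
  let D : EuclideanSpace ℝ (Fin 2) →ₗ[ℝ] TangentSpace (𝓡 3) (j s) :=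
    (mfderiv (𝓡 2) (𝓡 3) j s).toLinearMap
  let y : EuclideanSpace ℝ (Fin 2) := Y s
  let w : Fin 3 → EuclideanSpace ℝ (Fin 2) := ![f (j s) • y, v 0, v 1]
  -- the three arguments come from a plane and are linearly dependent
  have h0 : ((o (j s)).volumeForm.compLinearMap D) w = 0 := by
    refine AlternatingMap.map_linearDependent _ w fun h => ?_
    have := h.fintype_card_le_finrank
    simp at this
  refine Eq.trans ?_ h0
  rw [AlternatingMap.compLinearMap_apply]
  refine congrArg (o (j s)).volumeForm ?_
  funext a
  fin_cases a
  · have : D (f (j s) • y) = f (j s) • D y := map_smul D _ _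
    exact (this.trans (congrArg (fun u => f (j s) • u) (hY s))).symm
  · rfl
  · rfl

omit [IsManifold (𝓡 2) ∞ S] in
/-- If `ι_Y σ = dH` and `β` is a one-form on a surface, then `dH ∧ β = -β(Y) σ`. -/
theorem wedgeQuotient_of_hamiltonian {σ : Form 2 2 S} (hσ : IsSymplecticForm σ) (β : Form 2 1 S)
    {H : S → ℝ} (hH : ∀ (s : S) (v : TangentSpace (𝓡 2) s),
      σ s ![Y s, v] = mfderiv (𝓡 2) 𝓘(ℝ, ℝ) H s v) (s : S) :
    wedgeQuotient σ β H s = - β s fun _ => Y s := by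
  refine wedgeQuotient_eq_of_forall β H s (exists_area_ne_zero hσ s) fun v w => ?_
  have hd : ∀ v, differential H s v = σ s ![Y s, v] := fun v => (hH s v).symm
  rw [hd, hd]
  let θ : EuclideanSpace ℝ (Fin 2) [⋀^Fin 2]→L[ℝ] ℝ := σ s
  let b : EuclideanSpace ℝ (Fin 2) →L[ℝ] ℝ :=
    (ContinuousAlternatingMap.ofSubsingleton ℝ (EuclideanSpace ℝ (Fin 2)) ℝ (0 : Fin 1)).symm (β s)
  have key : ∀ y v w : EuclideanSpace ℝ (Fin 2),
      - b y * θ ![v, w] = θ ![y, v] * b w - θ ![y, w] * b v := by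
    intro y v w
    rw [alternating_apply_two θ v w, alternating_apply_two θ y v, alternating_apply_two θ y w,
      linearMap_apply_two b y, linearMap_apply_two b v, linearMap_apply_two b w]
    ring
  exact key (Y s) v w

/-- If the restriction of a rotational Beltrami field to a compact invariant surface is Hamiltonian,
then the field vanishes on the surface: Stokes' theorem for `d(Hβ) = dH ∧ β = -|X|² σ`. -/
theorem eq_zero_of_isHamiltonianField_restrictField [T2Space M] [CompactSpace S]
    (hX : IsRotationalBeltrami o X) (hj : IsSmoothEmbedding (𝓡 2) (𝓡 3) ∞ j)
    (hinv : IsInvariantUnder X (range j))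
    (h : IsHamiltonianField (restrictField (m := 2) j X)) (s : S) : X (j s) = 0 := by
  obtain ⟨σ, hσ, H, hH, hYH⟩ := h
  have : T2Space S := hj.isEmbedding.t2Space
  have hY := mfderiv_restrictField hX.1 hj hinv
  have hflat : ∀ s, pullbackForm j (flat X) s (fun _ => restrictField (m := 2) j X s) =
      inner ℝ (X (j s)) (X (j s)) := fun s => congrArg (inner ℝ (X (j s))) (hY s)
  have h := eq_zero_of_wedgeQuotient_eq_neg hσ
    (isSmoothForm_pullbackForm hj.contMDiff (isSmoothForm_flat hX.1))
    (extDerivM_pullbackForm_flat hX hj.contMDiff hY) hH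
    (e := fun s => inner ℝ (X (j s)) (X (j s))) (fun s => real_inner_self_nonneg)
    (fun s => by rw [wedgeQuotient_of_hamiltonian hσ _ hYH, hflat]) s
  exact inner_self_eq_zero.1 h

end RestrictedBeltrami

end BeltramiSurface

theorem mainTheorem8
    {M : Type*} [TopologicalSpace M] [T2Space M]
    [ChartedSpace (EuclideanSpace ℝ (Fin 3)) M] [IsManifold (𝓡 3) ∞ M]
    [RiemannianBundle (fun p : M => TangentSpace (𝓡 3) p)]
    [IsContMDiffRiemannianBundle (𝓡 3) ∞ (EuclideanSpace ℝ (Fin 3))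
      (fun p : M => TangentSpace (𝓡 3) p)]
    (o : ∀ p : M, Orientation ℝ (TangentSpace (𝓡 3) p) (Fin 3))
    (ho : BeltramiSurface.IsManifoldOrientation o)
    (X : ∀ p : M, TangentSpace (𝓡 3) p)
    (hX : BeltramiSurface.IsRotationalBeltrami o X)
    {S : Type*} [TopologicalSpace S] [CompactSpace S]
    [ChartedSpace (EuclideanSpace ℝ (Fin 2)) S] [IsManifold (𝓡 2) ∞ S]
    (j : S → M) (hj : IsSmoothEmbedding (𝓡 2) (𝓡 3) ∞ j)
    (hinv : BeltramiSurface.IsInvariantUnder X (range j))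
    (hX₀ : ∃ s : S, ∃ q ∈ connectedComponent (j s), X q ≠ 0) :
    ¬ BeltramiSurface.IsHamiltonianField (BeltramiSurface.restrictField (m := 2) j X) := by
  intro h
  have hzero := BeltramiSurface.eq_zero_of_isHamiltonianField_restrictField hX hj hinv h
  obtain ⟨s, q, hq, hXq⟩ := hX₀
  exact hXq
    (BeltramiSurface.eq_zero_on_connectedComponent_of_eq_zero_on_surface ho hX hj hzero s hq)
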